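/- \textbf{Definitions.} Languages are over finite alphabets. The quotient of $L\subseteq\Sigma^*$ by $w$ is $w^{-1}L=\{x\mid wx\in L\}$; the complexity $\kappa(L)$ is the number of distinct quotients of $L$. The syntactic semigroup of $L$ is the quotient of $\Sigma^+$ by the congruence $x\sim y\iff(\forall w,z\in\Sigma^*:\ wxz\in L\Leftrightarrow wyz\in L)$. An atom of $L$ is an equivalence class of the relation on $\Sigma^*$ given by $x\approx y\iff(\forall w\in\Sigma^*:\ wx\in L\Leftrightarrow wy\in L)$; every atom $A$ is written $A_S$, where $S$ is the set of quotients of $L$ that contain $A$, so that $A$ is the intersection of the quotients in $S$ and of the complements of the quotients not in $S$. A left ideal is a non-empty $L$ with $L=\Sigma^*L$. A DFA is minimal if all its states are reachable and no two distinct states accept the same language. A binary boolean function $\circ$ is proper if it is neither constant nor a function of one variable only; $w\in L\circ L'$ iff $(w\in L)\circ(w\in L')$. For $n\ge4$ let $\mathcal D_n(a,b,c,d,e)$ be the DFA with states $Q_n=\{1,\dots,n\}$, alphabet $\Sigma=\{a,b,c,d,e\}$, initial state $1$, final state $n$, where $a$ acts as the cycle $(2,\dots,n)$, $b$ as the transposition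 $(2,3)$, $c$ maps $n$ to $2$ and fixes all other states, $d$ maps $n$ to $1$ and fixes all other states, and $e$ maps all states to $2$. Let $L_n=L_n(a,b,c,d,e)$ be its language. For a partial permutation $\pi$ of $\Sigma$ (a partial function that is injective on its domain), the dialect $L_n(\pi(a),\dots,\pi(e))$ is the image of $L_n$ under the substitution $x\mapsto\{\pi(x)\}$ if $\pi(x)$ is defined and $x\mapsto\emptyset$ otherwise, regarded as a language over the range of $\pi$; undefined values are written ``$-$''. A stream $(L_n\mid n\ge k)$ of languages of a class $C$, with $\kappa(L_n)=n$, together with the dialect stream given by $\pi$, is most complex in $C$ if, among the languages of $C$ (over arbitrary finite alphabets, both arguments of a binary operation being over the same alphabet) of the same complexities, the following are maximal for all $m,n\ge k$: the size of the syntactic semigroup of $L_n$; the complexity of each quotient of $L_n$ (i.e. for every $K\in C$ with $\kappa(K)=n$ there is a bijection $\varphi$ from the quotients of $K$ to those of $L_n$ with $\kappa(q)\le\kappa(\varphi(q))$); the number of atoms of $L_n$; the complexity of each atom $A_S$ of $L_n$ (in comparison with all atoms $A_{S'}$ of such $K$ with $|S'|=|S|$); the complexities of the reverse of $L_n$, of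 $L_n^*$, of $L_mL_n$, and of $L_m\circ L_n(\pi(\Sigma))$ for every proper $\circ$. \textbf{Theorem (Left Ideals).} For each $n\ge4$ the DFA $\mathcal D_n(a,b,c,d,e)$ is minimal and $L_n(a,b,c,d,e)$ is a left ideal of complexity $n$. The stream $(L_n(a,b,c,d,e)\mid n\ge4)$ with dialect stream $(L_n(a,b,e,d,c)\mid n\ge4)$ is most complex in the class of regular left ideals. Moreover the following hold for all $m,n\ge4$; all the dialects mentioned are left ideals of complexity $n$ (resp. $m$) over the restricted alphabets shown, and each stated value is an upper bound for the corresponding quantity for all regular left ideals of complexity $n$ (resp. $m$ and $n$, over a common alphabet), over any finite alphabet: \begin{enumerate} \item The syntactic semigroup of $L_n(a,b,c,d,e)$ has cardinality $n^{n-1}+n-1$. Moreover, fewer than five letters do not suffice: every regular left ideal of complexity $n$ over an alphabet with fewer than five letters has a syntactic semigroup of smaller cardinality. \item All quotients of $L_n(a,-,-,d,e)$ have complexity $n$. \item $L_n(a,-,c,d,e)$ has $2^{n-1}+1$ atoms. \item Each atom $A_S$ of $L_n(a,b,c,d,e)$ has complexity \[\kappa(A_S)=\begin{cases} n,&\text{if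 } |S|=n;\\ 2^{n-1},&\text{if } S=\emptyset;\\ 1+\sum_{x=1}^{|S|}\sum_{y=1}^{n-|S|}\binom{n-1}{x}\binom{n-x-1}{y-1},&\text{otherwise.}\end{cases}\] \item The reverse of $L_n(a,-,c,d,e)$ has complexity $2^{n-1}+1$. \item The star of $L_n(a,-,-,-,e)$ has complexity $n+1$. \item The product $L_m(a,-,-,-,e)\,L_n(a,-,-,-,e)$ has complexity $m+n-1$. \item For every proper binary boolean function $\circ$, the complexity of $L_m(a,-,c,-,e)\circ L_n(a,-,e,-,c)$ is $mn$. \end{enumerate} -/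

import Mathlib

open scoped Computability

namespace Language

variable {α : Type*}

/-- The set of left quotients `w⁻¹L = {x | wx ∈ L}` of `L`. -/
def quotients (L : Language α) : Set (Language α) := Set.range L.leftQuotient

/-- The (quotient) complexity `κ(L)`: the number of left quotients of `L`. -/
noncomputable def complexity (L : Language α) : ℕ∞ := L.quotients.encard

/-- The Myhill (syntactic) congruence of `L`, on the set of non-empty words. -/
def syntacticSetoid (L : Language α) : Setoid {x : List α // x ≠ []} where
  r x y := ∀ w z : List α, w ++ x.1 ++ z ∈ L ↔ w ++ y.1 ++ z ∈ L
  iseqv :=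
    ⟨fun _ _ _ => Iff.rfl, fun h w z => (h w z).symm, fun h k w z => (h w z).trans (k w z)⟩

/-- `σ(L)`: the cardinality of the syntactic semigroup of `L`. -/
noncomputable def syntacticSize (L : Language α) : ℕ∞ := ENat.card (Quotient L.syntacticSetoid)

/-- The left congruence of `L`: two words are related when they lie in the same quotients. -/
def atomSetoid (L : Language α) : Setoid (List α) where
  r x y := ∀ w : List α, w ++ x ∈ L ↔ w ++ y ∈ L
  iseqv := ⟨fun _ _ => Iff.rfl, fun h w => (h w).symm, fun h k w => (h w).trans (k w)⟩

/-- The atoms of `L`: the classes of the left congruence. -/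
def atoms (L : Language α) : Set (Language α) := {A | ∃ x : List α, A = {y | L.atomSetoid y x}}

/-- For an atom `A = A_S` of `L`, the set `S` of those quotients of `L` that occur uncomplemented
in the intersection defining `A`, i.e. of the quotients that contain `A`. -/
def atomIndex (L A : Language α) : Set (Language α) := {K ∈ L.quotients | A ≤ K}

/-- A left ideal: a non-empty language with `Σ*L = L`. -/
def IsLeftIdeal (L : Language α) : Prop := L ≠ 0 ∧ (⊤ : Language α) * L = L

open scoped Classical in
/-- The extension of a binary boolean function to languages. -/
def boolOp (f : Bool → Bool → Bool) (L L' : Language α) : Language α :=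
  {w | f (decide (w ∈ L)) (decide (w ∈ L')) = true}

/-- The image `s_π(L)` of `L` under the substitution `a ↦ {π(a)}` if `π(a)` is defined, and
`a ↦ ∅` if `π(a)` is undefined (`none`). -/
def dialect (π : α → Option α) (L : Language α) : Language α :=
  {w | ∃ u ∈ L, u.map π = w.map some}

/-- The dialect `s_π(L)` viewed as a language over the alphabet `Γ`
(in use, `Γ` is the range of `π`). -/
def dialectOver (Γ : Set α) (π : α → Option α) (L : Language α) : Language Γ :=
  {w | w.map Subtype.val ∈ L.dialect π}

end Language

/-- A DFA is minimal if all its states are reachable and no two distinct states accept the same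
language. -/
def DFA.IsMinimal {α σ : Type*} (M : DFA α σ) : Prop :=
  (∀ q, ∃ w, M.eval w = q) ∧ ∀ p q, M.acceptsFrom p = M.acceptsFrom q → p = q

namespace MostComplex

/-- A binary boolean function is proper if it is neither constant nor a function of one variable
only. -/
def IsProper (f : Bool → Bool → Bool) : Prop :=
  (¬ ∃ g : Bool → Bool, ∀ x y, f x y = g x) ∧ (¬ ∃ g : Bool → Bool, ∀ x y, f x y = g y)

/-- A partial permutation: a partial function that is injective on its domain. -/
def IsPartialPerm {σ : Type*} (π : σ → Option σ) : Prop :=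
  ∀ x y z, π x = some z → π y = some z → x = y

/-- The subclass `C_n` of the languages of complexity `n` of a class `C`. -/
def ofComplexity (C : ∀ α : Type, Set (Language α)) (n : ℕ) (α : Type) : Set (Language α) :=
  {L ∈ C α | L.complexity = n}

/-- The stream `(L_n | n ≥ k)` over the finite alphabet `σ`, with the dialect stream
`(s_π(L_n) | n ≥ k)`, is most complex in the class `C`. Maximality is over all languages of `C`
over all finite alphabets, with the same complexities. The quotients of `L_n` are compared one by
one with those of another language along a bijection; an atom `A_S` is compared with the atoms
`A_{S'}` such that `|S'| = |S|`. -/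
structure IsMostComplex (C : ∀ α : Type, Set (Language α)) {σ : Type} [Finite σ] (k : ℕ)
    (L : ∀ n, k ≤ n → Language σ) (π : σ → Option σ) : Prop where
  isPartialPerm : IsPartialPerm π
  mem : ∀ n hn, L n hn ∈ ofComplexity C n σ
  semigroup : ∀ n hn (α : Type) [Finite α], ∀ K ∈ ofComplexity C n α,
    K.syntacticSize ≤ (L n hn).syntacticSize
  quotient : ∀ n hn (α : Type) [Finite α], ∀ K ∈ ofComplexity C n α,
    ∃ φ : K.quotients ≃ (L n hn).quotients, ∀ q, q.1.complexity ≤ (φ q).1.complexity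
  atoms : ∀ n hn (α : Type) [Finite α], ∀ K ∈ ofComplexity C n α,
    K.atoms.encard ≤ (L n hn).atoms.encard
  atom : ∀ n hn (α : Type) [Finite α], ∀ K ∈ ofComplexity C n α,
    ∀ A ∈ K.atoms, ∀ B ∈ (L n hn).atoms,
      (K.atomIndex A).encard = ((L n hn).atomIndex B).encard → A.complexity ≤ B.complexity
  reverse : ∀ n hn (α : Type) [Finite α], ∀ K ∈ ofComplexity C n α,
    K.reverse.complexity ≤ (L n hn).reverse.complexity
  star : ∀ n hn (α : Type) [Finite α], ∀ K ∈ ofComplexity C n α,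
    (K∗).complexity ≤ ((L n hn)∗).complexity
  product : ∀ m hm n hn (α : Type) [Finite α],
    ∀ K ∈ ofComplexity C m α, ∀ K' ∈ ofComplexity C n α,
      (K * K').complexity ≤ (L m hm * L n hn).complexity
  boolean : ∀ m hm n hn (f : Bool → Bool → Bool), IsProper f → ∀ (α : Type) [Finite α],
    ∀ K ∈ ofComplexity C m α, ∀ K' ∈ ofComplexity C n α,
      (Language.boolOp f K K').complexity ≤
        (Language.boolOp f (L m hm) ((L n hn).dialect π)).complexity

/-- The class of regular left ideals. -/
def RegularLeftIdeal (α : Type) : Set (Language α) := {L | L.IsRegular ∧ L.IsLeftIdeal}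

/-- The alphabet `{a, b, c, d, e}`. -/
inductive Letter
  | a | b | c | d | e
  deriving DecidableEq

instance : Fintype Letter where
  elems := {.a, .b, .c, .d, .e}
  complete x := by cases x <;> simp

/-- The partial function `π` with `(π(a), π(b), π(c), π(d), π(e)) = (x₁, x₂, x₃, x₄, x₅)`. -/
def assign (x₁ x₂ x₃ x₄ x₅ : Option Letter) : Letter → Option Letter
  | .a => x₁
  | .b => x₂
  | .c => x₃
  | .d => x₄
  | .e => x₅

/-- The transformations `a : (2,…,n)`, `b : (2,3)`, `c : (n → 2)`, `d : (n → 1)`, `e : (Q_n → 2)`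
of `Q_n = {1,…,n}`; the state `q` of `Q_n` is represented by `q - 1` in `Fin n`. -/
def witnessStep {n : ℕ} (hn : 4 ≤ n) : Letter → Fin n → Fin n
  | .a => fun q =>
      if q.1 = 0 then q else if h : q.1 + 1 < n then ⟨q.1 + 1, h⟩ else ⟨1, by omega⟩
  | .b => Equiv.swap ⟨1, by omega⟩ ⟨2, by omega⟩
  | .c => Function.update id ⟨n - 1, by omega⟩ ⟨1, by omega⟩
  | .d => Function.update id ⟨n - 1, by omega⟩ ⟨0, by omega⟩
  | .e => fun _ => ⟨1, by omega⟩

/-- The DFA `D_n(a,b,c,d,e)`, with initial state `1` and the only final state `n`. -/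
def witnessDFA (n : ℕ) (hn : 4 ≤ n) : DFA Letter (Fin n) where
  step q x := witnessStep hn x q
  start := ⟨0, by omega⟩
  accept := {⟨n - 1, by omega⟩}

/-- The language `L_n(a,b,c,d,e)`. -/
def witness (n : ℕ) (hn : 4 ≤ n) : Language Letter := (witnessDFA n hn).accepts

/-- The dialect `L_n(π(a),π(b),π(c),π(d),π(e))` as a language over the alphabet `Γ`. -/
def witnessOver (n : ℕ) (hn : 4 ≤ n) (Γ : Set Letter) (π : Letter → Option Letter) :
    Language Γ :=
  (witness n hn).dialectOver Γ π

/-- The bound on the complexity of an atom `A_S` of a left ideal of complexity `n`, as a function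
of `n` and `s = |S|`; here `S` is the set of all quotients iff `s = n`. -/
def atomBound (n s : ℕ) : ℕ :=
  if s = n then n
  else if s = 0 then 2 ^ (n - 1)
  else 1 + ∑ x ∈ Finset.Icc 1 s, ∑ y ∈ Finset.Icc 1 (n - s),
    (n - 1).choose x * (n - x - 1).choose (y - 1)

end MostComplex

open MostComplex Language

/-! Everything is read off a minimal DFA. For a left ideal `L` one has `L ⊆ w⁻¹L` for every `w`, so
inclusion of state languages is a partial order whose least element is the initial state `z`, and
every word acts by a monotone map. If this pointed poset is flat (no chain `z < p < q`), a monotone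
map fixes `z` or is constant, which leaves `n^(n-1) + n - 1` maps (`ncard_fixOrConst`). A chain
constrains a pair of values and costs almost a factor two, enough for a strictly smaller count
(`ncard_monotone_lt`). So an extremal semigroup is all of `fixOrConst z`, and generating that takes
two permutations, a letter merging two non-initial states, a letter merging a state with `z`, and a
constant (`five_le_card`).

An atom consists of the words accepted from exactly the states of a set `S`, and `S` is everything
or avoids `z`; this bounds the number of atoms, hence the quotients of the reverse
(`complexity_reverse`). A word acting as `f` turns the atom of `S` into the cell "accepted from all
of `f(S)`, from none of `f(Sᶜ)`". Only the minimal states of the first set and the maximal states of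
the second matter, so `z` may usually be adjoined to the second set, and the cells are counted by
pairs of disjoint sets (`quotients_atomAt_subset`, `complexity_atomAt_compl_le`). Conversely, if all
maps in `fixOrConst z` and all sets avoiding `z` occur, every such pair is realised
(`complexity_atomAt_eq`).

For the other operations, the star of a left ideal only adds the empty word, a quotient of a product
is governed by the shortest prefix lying in the first factor, and boolean operations need only pairs
of quotients.

In the witness, `a` permutes the states, so whatever is closed under `a` is closed under its
inverse; this yields all transpositions from `b`, all merges from `c` and `d`, and all subsets as
accepting sets. Exchanging `c` and `e` in the second boolean operand gives letters that are constant
on one side and almost the identity on the other, so the two coordinates can be steered separately.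
-/

theorem Set.encard_range_congr {ι β γ : Type*} (F : ι → β) (G : ι → γ)
    (h : ∀ x y, F x = F y ↔ G x = G y) : (Set.range F).encard = (Set.range G).encard := by
  have hk : Setoid.ker F = Setoid.ker G := by
    ext x y; exact h x y
  have e1 := ENat.card_congr (Setoid.quotientKerEquivRange F)
  have e2 := ENat.card_congr (Setoid.quotientKerEquivRange G)
  rw [hk] at e1
  rw [Set.encard, Set.encard, ← e1, ← e2]

/-! ### Left ideals, quotients and atoms of a language -/

namespace Language

variable {α : Type*} {L : Language α}

theorem IsLeftIdeal.append_mem (h : L.IsLeftIdeal) (u : List α) {w : List α} (hw : w ∈ L) :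
    u ++ w ∈ L := by
  have : u ++ w ∈ (⊤ : Language α) * L := mem_mul.2 ⟨u, trivial, w, hw, rfl⟩
  rwa [h.2] at this

theorem IsLeftIdeal.le_leftQuotient (h : L.IsLeftIdeal) (u : List α) : L ≤ L.leftQuotient u :=
  fun _ hw => h.append_mem u hw

theorem isLeftIdeal_of_le_leftQuotient (hne : ∃ w, w ∈ L) (h : ∀ u, L ≤ L.leftQuotient u) :
    L.IsLeftIdeal := by
  obtain ⟨w, hw⟩ := hne
  refine ⟨fun h0 => by rw [h0] at hw; exact hw, ?_⟩
  ext x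
  rw [mem_mul]
  constructor
  · rintro ⟨u, -, v, hv, rfl⟩
    exact h u hv
  · intro hx
    exact ⟨[], trivial, x, hx, rfl⟩

theorem leftQuotient_mem_quotients (L : Language α) (w : List α) :
    L.leftQuotient w ∈ L.quotients := ⟨w, rfl⟩

theorem self_mem_quotients (L : Language α) : L ∈ L.quotients := ⟨[], rfl⟩

theorem quotients_subset_of_mem {q : Language α} (hq : q ∈ L.quotients) :
    q.quotients ⊆ L.quotients := by
  obtain ⟨w, rfl⟩ := hq
  rintro _ ⟨v, rfl⟩
  exact ⟨w ++ v, leftQuotient_append _ _ _⟩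

/-- The atom that contains a given word. -/
def atomOf (L : Language α) (x : List α) : Language α := {y | L.atomSetoid y x}

theorem atoms_eq_range (L : Language α) : L.atoms = Set.range L.atomOf := by
  ext A
  constructor
  · rintro ⟨x, rfl⟩; exact ⟨x, rfl⟩
  · rintro ⟨x, rfl⟩; exact ⟨x, rfl⟩

theorem atomOf_eq_iff (L : Language α) (x y : List α) :
    L.atomOf x = L.atomOf y ↔ L.atomSetoid x y := by
  constructor
  · intro h
    have : x ∈ L.atomOf x := L.atomSetoid.refl x
    rw [h] at this
    exact this
  · intro h
    ext z
    exact ⟨fun hz => L.atomSetoid.trans hz h, fun hz => L.atomSetoid.trans hz (L.atomSetoid.symm h)⟩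

/-- The quotients of the reverse correspond to the atoms. -/
theorem complexity_reverse (L : Language α) : L.reverse.complexity = L.atoms.encard := by
  rw [complexity, quotients, atoms_eq_range,
    ← (List.reverse_surjective (α := α)).range_comp L.atomOf]
  apply Set.encard_range_congr
  intro x y
  simp only [Function.comp_apply]
  rw [atomOf_eq_iff]
  constructor
  · intro h w
    have := Set.ext_iff.1 h w.reverse
    change (x ++ w.reverse).reverse ∈ L ↔ (y ++ w.reverse).reverse ∈ L at this
    simpa using this
  · intro h
    ext w
    change (x ++ w).reverse ∈ L ↔ (y ++ w).reverse ∈ L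
    simpa using h w.reverse

end Language

/-! ### Minimal DFAs: semigroup, atoms and quotients of atoms in terms of states -/

namespace DFA

variable {α σ : Type*} {M : DFA α σ}

theorem evalFrom_append (M : DFA α σ) (s : σ) (x y : List α) :
    M.evalFrom s (x ++ y) = M.evalFrom (M.evalFrom s x) y := M.evalFrom_of_append s x y

theorem eval_eq_evalFrom (M : DFA α σ) (x : List α) : M.eval x = M.evalFrom M.start x := rfl

/-- The set of states from which a word is accepted. -/
def acceptingStates (M : DFA α σ) (x : List α) : Set σ := {q | x ∈ M.acceptsFrom q}

theorem mem_acceptingStates {x : List α} {q : σ} :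
    q ∈ M.acceptingStates x ↔ M.evalFrom q x ∈ M.accept := Iff.rfl

theorem acceptingStates_append (M : DFA α σ) (w x : List α) :
    M.acceptingStates (w ++ x) = (fun q => M.evalFrom q w) ⁻¹' M.acceptingStates x := by
  ext q
  simp [mem_acceptingStates, evalFrom_append]

/-- The words accepted from exactly the states of `S`. -/
def atomAt (M : DFA α σ) (S : Set σ) : Language α := {y | M.acceptingStates y = S}

theorem mem_atomAt {S : Set σ} {x : List α} : x ∈ M.atomAt S ↔ M.acceptingStates x = S := Iff.rfl

/-- The transformations of the states by non-empty words. -/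
def transitions (M : DFA α σ) : Set (σ → σ) :=
  Set.range fun w : {x : List α // x ≠ []} => fun q => M.evalFrom q w.1

theorem toDFA_evalFrom (L : Language α) (s : Set.range L.leftQuotient) (w : List α) :
    (L.toDFA.evalFrom s w).val = s.val.leftQuotient w := by
  induction w using List.reverseRecOn with
  | nil => simp
  | append_singleton x a ih => simp [ih, leftQuotient_append]

theorem toDFA_acceptsFrom (L : Language α) (s : Set.range L.leftQuotient) :
    L.toDFA.acceptsFrom s = s.val := by
  ext x
  rw [mem_acceptsFrom, mem_accept_toDFA, toDFA_evalFrom, mem_leftQuotient, List.append_nil]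

theorem isMinimal_toDFA (L : Language α) : L.toDFA.IsMinimal := by
  constructor
  · rintro ⟨_, w, rfl⟩
    refine ⟨w, Subtype.ext ?_⟩
    rw [eval_eq_evalFrom, toDFA_evalFrom, start_toDFA]
  · intro p q h
    rw [toDFA_acceptsFrom, toDFA_acceptsFrom] at h
    exact Subtype.ext h

namespace IsMinimal

theorem quotients (hM : M.IsMinimal) : M.accepts.quotients = Set.range M.acceptsFrom := by
  have : Function.Surjective M.eval := hM.1
  rw [Language.quotients, leftQuotient_accepts, this.range_comp]

theorem injective (hM : M.IsMinimal) : Function.Injective M.acceptsFrom := fun _ _ h => hM.2 _ _ h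

theorem complexity (hM : M.IsMinimal) : M.accepts.complexity = ENat.card σ := by
  rw [Language.complexity, hM.quotients, ← Set.image_univ, hM.injective.encard_image,
    Set.encard_univ]

/-- Left contexts reach every state and right contexts separate states, so the syntactic semigroup
is the transition semigroup. -/
theorem syntacticSetoid_iff (hM : M.IsMinimal) (x y : {x : List α // x ≠ []}) :
    M.accepts.syntacticSetoid x y ↔
      (fun q => M.evalFrom q x.1) = fun q => M.evalFrom q y.1 := by
  constructor
  · intro h
    funext q
    obtain ⟨w, rfl⟩ := hM.1 q
    apply hM.2
    ext z
    have := h w z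
    simpa only [mem_accepts, mem_acceptsFrom, eval_eq_evalFrom, evalFrom_append] using this
  · intro h w z
    simp only [mem_accepts, eval_eq_evalFrom, evalFrom_append]
    rw [congr_fun h (M.evalFrom M.start w)]

theorem syntacticSize (hM : M.IsMinimal) : M.accepts.syntacticSize = M.transitions.encard := by
  have hk : M.accepts.syntacticSetoid
      = Setoid.ker fun (w : {x : List α // x ≠ []}) => fun q => M.evalFrom q w.1 := by
    ext x y; exact hM.syntacticSetoid_iff x y
  rw [Language.syntacticSize, hk, ENat.card_congr (Setoid.quotientKerEquivRange _)]
  rfl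

theorem atomSetoid_iff (hM : M.IsMinimal) (x y : List α) :
    M.accepts.atomSetoid x y ↔ M.acceptingStates x = M.acceptingStates y := by
  constructor
  · intro h
    ext q
    obtain ⟨w, rfl⟩ := hM.1 q
    have := h w
    simpa only [mem_accepts, mem_acceptingStates, eval_eq_evalFrom, evalFrom_append] using this
  · intro h w
    simp only [mem_accepts, eval_eq_evalFrom, evalFrom_append]
    exact Set.ext_iff.1 h _

theorem encard_atoms (hM : M.IsMinimal) :
    M.accepts.atoms.encard = (Set.range M.acceptingStates).encard := by
  rw [atoms_eq_range]
  apply Set.encard_range_congr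
  intro x y
  rw [atomOf_eq_iff, hM.atomSetoid_iff]

theorem mem_atoms (hM : M.IsMinimal) {A : Language α} :
    A ∈ M.accepts.atoms ↔ ∃ x, A = M.atomAt (M.acceptingStates x) := by
  have (x : List α) : M.accepts.atomOf x = M.atomAt (M.acceptingStates x) := by
    ext y; exact hM.atomSetoid_iff y x
  rw [atoms_eq_range]
  simp [this, eq_comm]

theorem atomIndex (hM : M.IsMinimal) (x : List α) :
    M.accepts.atomIndex (M.atomAt (M.acceptingStates x))
      = M.acceptsFrom '' M.acceptingStates x := by
  ext K
  rw [Language.atomIndex, hM.quotients]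
  constructor
  · rintro ⟨⟨q, rfl⟩, h⟩
    exact ⟨q, h (mem_atomAt.2 rfl : x ∈ _), rfl⟩
  · rintro ⟨q, hq, rfl⟩
    refine ⟨⟨q, rfl⟩, fun y hy => ?_⟩
    have : q ∈ M.acceptingStates y := (mem_atomAt.1 hy) ▸ hq
    exact this

theorem ncard_atomIndex (hM : M.IsMinimal) (x : List α) :
    (M.accepts.atomIndex (M.atomAt (M.acceptingStates x))).ncard
      = (M.acceptingStates x).ncard := by
  rw [hM.atomIndex, Set.ncard_image_of_injective _ hM.injective]

end IsMinimal

/-- The words accepted from all states of `X` and from no state of `Y`. -/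
def cell (M : DFA α σ) (X Y : Set σ) : Language α :=
  {y | X ⊆ M.acceptingStates y ∧ Disjoint Y (M.acceptingStates y)}

theorem mem_cell {X Y : Set σ} {y : List α} :
    y ∈ M.cell X Y ↔ X ⊆ M.acceptingStates y ∧ Disjoint Y (M.acceptingStates y) := Iff.rfl

/-- The accepting set of `w ++ y` is the preimage under `w` of that of `y`; requiring it to equal
`S` is one condition on the image of `S` and one on the image of `Sᶜ`. -/
theorem leftQuotient_atom (M : DFA α σ) (S : Set σ) (w : List α) :
    (M.atomAt S).leftQuotient w
      = M.cell ((fun q => M.evalFrom q w) '' S) ((fun q => M.evalFrom q w) '' Sᶜ) := by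
  ext y
  change M.acceptingStates (w ++ y) = S ↔ _
  rw [mem_cell, acceptingStates_append, Set.image_subset_iff, Set.disjoint_left]
  simp only [Set.forall_mem_image]
  constructor
  · rintro rfl
    exact ⟨le_rfl, fun q hq => hq⟩
  · rintro ⟨h1, h2⟩
    ext q
    exact ⟨fun hq => by_contra fun h => h2 h hq, fun hq => h1 hq⟩

theorem atom_quotients (M : DFA α σ) (S : Set σ) :
    (M.atomAt S).quotients
      = Set.range fun w : List α =>
        M.cell ((fun q => M.evalFrom q w) '' S) ((fun q => M.evalFrom q w) '' Sᶜ) := by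
  rw [Language.quotients]
  congr 1
  funext w
  exact M.leftQuotient_atom S w

end DFA

/-- Every language of finite complexity is accepted by a minimal DFA of that size; for a left
ideal, the language of the initial state is contained in that of any other state. -/
theorem MostComplex.exists_minimal_dfa {α : Type} {n : ℕ} {K : Language α}
    (hK : K ∈ ofComplexity RegularLeftIdeal n α) :
    ∃ (σ : Type) (_ : Fintype σ) (M : DFA α σ), Fintype.card σ = n ∧ M.IsMinimal ∧
      M.accepts = K ∧ ∀ q, M.acceptsFrom M.start ≤ M.acceptsFrom q := by
  obtain ⟨⟨hr, hl⟩, hc⟩ := hK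
  have hfin : (Set.range K.leftQuotient).Finite := hr.finite_range_leftQuotient
  let _ := hfin.fintype
  refine ⟨Set.range K.leftQuotient, inferInstance, K.toDFA, ?_, DFA.isMinimal_toDFA K,
    accepts_toDFA K, ?_⟩
  · have := (DFA.isMinimal_toDFA K).complexity
    rw [accepts_toDFA, hc, ENat.card_eq_coe_fintype_card] at this
    exact_mod_cast this.symm
  · rintro ⟨_, w, rfl⟩
    rw [DFA.toDFA_acceptsFrom, DFA.toDFA_acceptsFrom]
    exact hl.le_leftQuotient w

/-- The transformations that fix `z` or are constant. -/
def fixOrConst {Q : Type*} (z : Q) : Set (Q → Q) := {f | f z = z ∨ ∃ r, f = fun _ => r}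

/-- Values at the other points are free, whence the exponent. -/
theorem ncard_fixing {Q : Type*} [Fintype Q] [DecidableEq Q] (z : Q) :
    {f : Q → Q | f z = z}.ncard = Fintype.card Q ^ (Fintype.card Q - 1) := by
  let e : {f : Q → Q | f z = z} ≃ ({x // x ≠ z} → Q) :=
    { toFun := fun f x => f.1 x
      invFun := fun g => ⟨fun x => if h : x = z then z else g ⟨x, h⟩, by simp⟩
      left_inv := by
        rintro ⟨f, hf⟩
        ext x
        by_cases h : x = z
        · subst h; simpa using hf.symm
        · simp [h]
      right_inv := by
        intro g
        ext ⟨x, h⟩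
        simp [h] }
  rw [← Nat.card_coe_set_eq, Nat.card_congr e, Nat.card_eq_fintype_card]
  simp [Fintype.card_subtype_compl]

theorem ncard_fixOrConst {Q : Type*} [Fintype Q] [DecidableEq Q] (z : Q)
    (hQ : 2 ≤ Fintype.card Q) :
    (fixOrConst z).ncard = Fintype.card Q ^ (Fintype.card Q - 1) + Fintype.card Q - 1 := by
  have hne : Nonempty Q := ⟨z⟩
  have : fixOrConst z = {f : Q → Q | f z = z} ∪ (fun r : Q => fun _ : Q => r) '' {r | r ≠ z} := by
    ext f
    constructor
    · rintro (h | ⟨r, rfl⟩)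
      · exact Or.inl h
      · by_cases hr : r = z
        · exact Or.inl hr
        · exact Or.inr ⟨r, hr, rfl⟩
    · rintro (h | ⟨r, -, rfl⟩)
      · exact Or.inl h
      · exact Or.inr ⟨r, rfl⟩
  rw [this, Set.ncard_union_eq, ncard_fixing, Set.ncard_image_of_injective]
  · have : {r : Q | r ≠ z} = ({z} : Set Q)ᶜ := rfl
    rw [this, Set.ncard_compl, Set.ncard_singleton, Nat.card_eq_fintype_card]
    omega
  · intro r s h
    exact congr_fun h z
  · rw [Set.disjoint_left]
    rintro _ h ⟨r, hr, rfl⟩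
    exact hr h

/-! ### Counting monotone self-maps of a pointed poset -/

section Counting

/-- The first two binomial terms `j^k + k * j^(k-1)` already suffice. -/
theorem two_mul_pow_le_succ_pow {j k : ℕ} (h : j ≤ k) (hk : k ≠ 0) : 2 * j ^ k ≤ (j + 1) ^ k := by
  obtain ⟨i, rfl⟩ := Nat.exists_eq_succ_of_ne_zero hk
  have key : ∀ i : ℕ, j ^ (i + 1) + (i + 1) * j ^ i ≤ (j + 1) ^ (i + 1) := by
    intro i
    induction i with
    | zero => simp
    | succ i ih =>
      calc j ^ (i + 1 + 1) + (i + 1 + 1) * j ^ (i + 1)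
          ≤ (j ^ (i + 1) + (i + 1) * j ^ i) * (j + 1) := by ring_nf; nlinarith [Nat.zero_le (j ^ i)]
        _ ≤ _ := by rw [pow_succ (j + 1)]; gcongr
  have h1 := key i
  have h2 : j * j ^ i ≤ (i + 1) * j ^ i := by gcongr
  rw [Nat.succ_eq_add_one]
  calc 2 * j ^ (i + 1) = j ^ (i + 1) + j * j ^ i := by ring
    _ ≤ _ := by omega

/-- This is `(1 + 1/m)^k ≥ 1 + k/m + k(k-1)/(2m²)` with denominators cleared and the negative term
moved to the right. -/
theorem second_order_bernoulli (m k : ℕ) :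
    m ^ k * (2 * m ^ 2 + 2 * k * m + k ^ 2) ≤ 2 * m ^ 2 * (m + 1) ^ k + m ^ k * k := by
  induction k with
  | zero => simp
  | succ k ih =>
    have h1 : m ^ k * (2 * m ^ 2 + 2 * k * m + k ^ 2) * (m + 1) ≤
        (2 * m ^ 2 * (m + 1) ^ k + m ^ k * k) * (m + 1) := Nat.mul_le_mul_right _ ih
    have h2 : m ^ k * k ≤ m ^ k * k ^ 2 := by gcongr; exact Nat.le_self_pow two_ne_zero k
    ring_nf at h1 h2 ⊢
    omega

/-- Here the base exceeds the exponent, so two binomial terms no longer suffice and the quadratic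
one is needed. The bound on `k` is sharp: `2 * 4^3 > 5^3`. -/
theorem two_mul_succ_pow_le {k : ℕ} (hk : 4 ≤ k) : 2 * (k + 1) ^ k ≤ (k + 2) ^ k := by
  have h := second_order_bernoulli (k + 1) k
  have h2 : (k + 1) ^ k * (4 * (k + 1) ^ 2 + k) ≤
      (k + 1) ^ k * (2 * (k + 1) ^ 2 + 2 * k * (k + 1) + k ^ 2) :=
    Nat.mul_le_mul_left _ (by nlinarith)
  have h3 : 2 * (k + 1) ^ 2 * (2 * (k + 1) ^ k) ≤ 2 * (k + 1) ^ 2 * (k + 2) ^ k := by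
    have : k + 1 + 1 = k + 2 := rfl
    rw [this] at h
    nlinarith
  exact Nat.le_of_mul_le_mul_left h3 (by positivity)

theorem sum_succ_mul_pow_le {k j : ℕ} (hk : k ≠ 0) (hj : j ≤ k) :
    ∑ u ∈ Finset.Icc 1 j, (u + 1) * u ^ k ≤ j * (j + 1) ^ k := by
  induction j with
  | zero => simp
  | succ j ih =>
    rw [Finset.sum_Icc_succ_top (by omega)]
    have h1 := ih (by omega)
    have h2 := two_mul_pow_le_succ_pow hj hk
    have h3 : (j + 1) * (2 * (j + 1) ^ k) ≤ (j + 1) * (j + 1 + 1) ^ k := by gcongr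
    nlinarith

/-- With `k = n - 2`, the terms up to `k` sum to at most `k(k+1)^k`; adding the last two terms and
using `2(k+1)^k ≤ (k+2)^k` gives at most `2n^(n-1)`. The surplus `2(n-1)` makes the inequality
strict. -/
theorem sum_succ_mul_pow_lt {n : ℕ} (hn : 4 ≤ n) :
    ∑ u ∈ Finset.Icc 1 n, (u + 1) * u ^ (n - 2) < 2 * (n ^ (n - 1) + n - 1) := by
  obtain ⟨k, rfl⟩ := Nat.exists_eq_add_of_le' (show 2 ≤ n by omega)
  have e1 : k + 2 - 2 = k := by omega
  have e2 : k + 2 - 1 = k + 1 := by omega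
  rw [e1, e2]
  by_cases hk : 4 ≤ k
  · rw [Finset.sum_Icc_succ_top (by omega), Finset.sum_Icc_succ_top (by omega)]
    have h1 := sum_succ_mul_pow_le (k := k) (j := k) (by omega) le_rfl
    have h2 := Nat.mul_le_mul_left (k + 1) (two_mul_succ_pow_le hk)
    have h3 : (k + 2) ^ (k + 1) = (k + 2) * (k + 2) ^ k := by ring
    have h4 : k + 1 + 1 = k + 2 := rfl
    rw [h3, h4]
    have h5 : (k + 2) * (k + 2) ^ k + (k + 2) - 1 = (k + 2) * (k + 2) ^ k + (k + 1) := by omega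
    rw [h5]
    nlinarith
  -- The cases `n = 4` and `n = 5`, where the doubling estimate is unavailable.
  · interval_cases k <;> first | omega | decide

variable {Q : Type*} [PartialOrder Q]

/-- Ordering a finite poset linearly from the top, the `u`-th element has at most `u` elements
above it. -/
theorem sum_card_upper_le [DecidableEq Q] [DecidableLE Q] {g : ℕ → ℕ} (hg : Monotone g)
    (s : Finset Q) :
    ∑ r ∈ s, g (s.filter (r ≤ ·)).card ≤ ∑ u ∈ Finset.Icc 1 s.card, g u := by
  induction h : s.card generalizing s with
  | zero => simp [Finset.card_eq_zero.1 h]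
  | succ k ih =>
    have hne : s.Nonempty := Finset.card_pos.1 (by omega)
    -- A minimal element lies above no other element, so deleting it leaves all other up-sets
    -- unchanged; its own up-set is bounded by the whole of `s`.
    obtain ⟨m, hm⟩ := s.exists_minimal hne
    have hcard : (s.erase m).card = k := by rw [Finset.card_erase_of_mem hm.1]; omega
    rw [Finset.sum_Icc_succ_top (by omega), ← Finset.sum_erase_add _ _ hm.1]
    refine add_le_add ?_ ?_
    · refine le_trans (le_of_eq ?_) (ih (s.erase m) hcard)
      refine Finset.sum_congr rfl fun r hr => ?_
      congr 2
      ext x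
      simp only [Finset.mem_filter, Finset.mem_erase]
      constructor
      · rintro ⟨hx, hrx⟩
        refine ⟨⟨?_, hx⟩, hrx⟩
        rintro rfl
        have := hm.2 (Finset.mem_of_mem_erase hr) hrx
        exact (Finset.ne_of_mem_erase hr) (le_antisymm hrx this)
      · rintro ⟨⟨-, hx⟩, hrx⟩
        exact ⟨hx, hrx⟩
    · exact hg (h ▸ Finset.card_filter_le _ _)

/-- The relation and its converse have the same size, lie in the square of `s`, and by antisymmetry
meet only in the diagonal. -/
theorem two_mul_card_comparable_le [DecidableEq Q] [DecidableLE Q] (s : Finset Q) :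
    2 * ((s ×ˢ s).filter fun x => x.1 ≤ x.2).card ≤ (s.card + 1) * s.card := by
  set A := (s ×ˢ s).filter fun x => x.1 ≤ x.2 with hA
  set B := (s ×ˢ s).filter fun x => x.2 ≤ x.1 with hB
  have hAB : A.card = B.card := by
    refine Finset.card_nbij' Prod.swap Prod.swap ?_ ?_ ?_ ?_ <;>
      simp +contextual [hA, hB, Set.MapsTo, Set.LeftInvOn]
  have h1 := Finset.card_union_add_card_inter A B
  have h2 : (A ∪ B).card ≤ s.card * s.card := by
    rw [← Finset.card_product]
    exact Finset.card_le_card (Finset.union_subset (Finset.filter_subset _ _)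
      (Finset.filter_subset _ _))
  have h3 : (A ∩ B).card ≤ s.card := by
    refine Finset.card_le_card_of_injOn Prod.fst ?_ ?_
    · intro x hx
      simp only [hA, hB, Finset.coe_inter, Set.mem_inter_iff, Finset.mem_coe, Finset.mem_filter,
        Finset.mem_product] at hx
      exact hx.1.1.1
    · intro x hx y hy hxy
      simp only [hA, hB, Finset.coe_inter, Set.mem_inter_iff, Finset.mem_coe, Finset.mem_filter,
        Finset.mem_product] at hx hy
      refine Prod.ext hxy ?_
      rw [← le_antisymm hx.1.2 hx.2.2, ← le_antisymm hy.1.2 hy.2.2, hxy]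
  nlinarith

open scoped Classical in
-- All values lie in the up-set `U` of `r`. The values at `p` and `q` form a comparable pair in `U`,
-- of which there are at most `|U|(|U|+1)/2`; the other `n - 3` values are bounded by a free choice
-- in `U`.
theorem two_mul_card_monotone_fiber_le [Fintype Q] [OrderBot Q] {p q : Q} (hp : ⊥ < p)
    (hpq : p < q) (r : Q) :
    2 * (Finset.univ.filter fun f : Q → Q => Monotone f ∧ f ⊥ = r).card ≤
      ((Finset.univ.filter (r ≤ ·)).card + 1) *
        (Finset.univ.filter (r ≤ ·)).card ^ (Fintype.card Q - 2) := by
  set U : Finset Q := Finset.univ.filter (r ≤ ·) with hU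
  set R : Finset Q := Finset.univ \ {⊥, p, q} with hR
  have hRcard : R.card = Fintype.card Q - 3 := by
    rw [hR, Finset.card_sdiff_of_subset (Finset.subset_univ _), Finset.card_univ]
    congr 1
    rw [Finset.card_insert_of_notMem, Finset.card_insert_of_notMem, Finset.card_singleton]
    · simpa using hpq.ne
    · simp only [Finset.mem_insert, Finset.mem_singleton, not_or]
      exact ⟨hp.ne, (hp.trans hpq).ne⟩
  have h3 : 3 ≤ Fintype.card Q := by
    have : ({⊥, p, q} : Finset Q).card = 3 := by
      rw [Finset.card_insert_of_notMem, Finset.card_insert_of_notMem, Finset.card_singleton]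
      · simpa using hpq.ne
      · simp only [Finset.mem_insert, Finset.mem_singleton, not_or]
        exact ⟨hp.ne, (hp.trans hpq).ne⟩
    rw [← this]; exact Finset.card_le_univ _
  have hle : (Finset.univ.filter fun f : Q → Q => Monotone f ∧ f ⊥ = r).card ≤
      (((U ×ˢ U).filter fun x => x.1 ≤ x.2) ×ˢ Fintype.piFinset fun _ : R => U).card := by
    refine Finset.card_le_card_of_injOn (fun f => ((f p, f q), fun x => f x)) ?_ ?_
    · intro f hf
      simp only [Finset.coe_filter, Finset.mem_univ, true_and, Set.mem_ofPred_eq] at hf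
      have hUf : ∀ x, f x ∈ U := fun x => by
        simp only [hU, Finset.mem_filter, Finset.mem_univ, true_and]
        rw [← hf.2]; exact hf.1 bot_le
      simp only [Finset.coe_product, Set.mem_prod, Finset.mem_coe, Finset.mem_filter,
        Finset.mem_product, Fintype.mem_piFinset]
      exact ⟨⟨⟨hUf _, hUf _⟩, hf.1 hpq.le⟩, fun x => hUf _⟩
    · intro f hf g hg h
      simp only [Finset.coe_filter, Finset.mem_univ, true_and, Set.mem_ofPred_eq] at hf hg
      simp only [Prod.mk.injEq] at h
      funext x
      by_cases hx : x ∈ R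
      · exact congr_fun h.2 ⟨x, hx⟩
      · simp only [hR, Finset.mem_sdiff, Finset.mem_univ, true_and, Finset.mem_insert,
          Finset.mem_singleton, not_not] at hx
        rcases hx with rfl | rfl | rfl
        · rw [hf.2, hg.2]
        · exact h.1.1
        · exact h.1.2
  rw [Finset.card_product, Fintype.card_piFinset, Finset.prod_const,
    Finset.card_univ, Fintype.card_coe, hRcard] at hle
  have hc := two_mul_card_comparable_le U
  have hpow : U.card ^ (Fintype.card Q - 2) = U.card * U.card ^ (Fintype.card Q - 3) := by
    rw [← pow_succ']; congr 1; omega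
  rw [hpow, ← mul_assoc]
  calc _ ≤ 2 * (_ * U.card ^ (Fintype.card Q - 3)) := Nat.mul_le_mul_left 2 hle
    _ ≤ _ := by rw [← mul_assoc]; exact Nat.mul_le_mul_right _ hc

/-- A pointed poset that is not flat has few monotone self-maps. -/
theorem ncard_monotone_lt [Fintype Q] [OrderBot Q] (hQ : 4 ≤ Fintype.card Q) {p q : Q}
    (hp : ⊥ < p) (hpq : p < q) :
    {f : Q → Q | Monotone f}.ncard <
      Fintype.card Q ^ (Fintype.card Q - 1) + Fintype.card Q - 1 := by
  classical
  -- The maps are sorted by the image of the least element.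
  have h1 : {f : Q → Q | Monotone f}.ncard
      = ∑ r : Q, (Finset.univ.filter fun f : Q → Q => Monotone f ∧ f ⊥ = r).card := by
    rw [Set.ncard_eq_toFinset_card', Set.toFinset_ofPred,
      Finset.card_eq_sum_card_fiberwise (f := fun f : Q → Q => f ⊥) (t := Finset.univ)
        (fun _ _ => Finset.mem_coe.2 (Finset.mem_univ _))]
    simp_rw [Finset.filter_filter]
  have h2 : 2 * {f : Q → Q | Monotone f}.ncard ≤
      ∑ r : Q, ((Finset.univ.filter (r ≤ ·)).card + 1) *
        (Finset.univ.filter (r ≤ ·)).card ^ (Fintype.card Q - 2) := by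
    rw [h1, Finset.mul_sum]
    exact Finset.sum_le_sum fun r _ => two_mul_card_monotone_fiber_le hp hpq r
  have h3 := sum_card_upper_le (g := fun u => (u + 1) * u ^ (Fintype.card Q - 2))
    (fun a b hab => Nat.mul_le_mul (by omega) (Nat.pow_le_pow_left hab _)) (Finset.univ : Finset Q)
  have h4 := sum_succ_mul_pow_lt hQ
  rw [Finset.card_univ] at h3
  have := h2.trans h3
  omega

/-- The monotone self-maps of a flat pointed poset. -/
theorem monotone_mem_fixOrConst [OrderBot Q] (hflat : ∀ p q : Q, ⊥ < p → p ≤ q → p = q)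
    {f : Q → Q} (hf : Monotone f) : f ∈ fixOrConst (⊥ : Q) := by
  by_cases h : f ⊥ = ⊥
  · exact Or.inl h
  · exact Or.inr ⟨f ⊥, funext fun x => (hflat _ _ (bot_lt_iff_ne_bot.2 h) (hf bot_le)).symm⟩

end Counting

/-! ### The transition semigroup of a left ideal -/

namespace DFA

variable {α σ : Type*} {M : DFA α σ}

theorem acceptsFrom_evalFrom_mono (M : DFA α σ) {p q : σ} (h : M.acceptsFrom p ≤ M.acceptsFrom q)
    (w : List α) : M.acceptsFrom (M.evalFrom p w) ≤ M.acceptsFrom (M.evalFrom q w) := by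
  intro x hx
  have hx' : w ++ x ∈ M.acceptsFrom p := by
    rw [mem_acceptsFrom, evalFrom_append]; exact hx
  have : w ++ x ∈ M.acceptsFrom q := h hx'
  rwa [mem_acceptsFrom, evalFrom_append] at this

/-- The transition semigroup of a left ideal either is smaller than the bound, or consists of
transformations that are constant or fix the initial state. -/
theorem ncard_transitions_lt_or_subset [Fintype σ] (hσ : 4 ≤ Fintype.card σ) (hM : M.IsMinimal)
    (hstart : ∀ q, M.acceptsFrom M.start ≤ M.acceptsFrom q) :
    M.transitions.ncard < Fintype.card σ ^ (Fintype.card σ - 1) + Fintype.card σ - 1 ∨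
      M.transitions ⊆ fixOrConst M.start := by
  -- States are ordered by inclusion of their languages; minimality gives antisymmetry and the ideal
  -- property makes the initial state least.
  let _ : PartialOrder σ := PartialOrder.lift M.acceptsFrom hM.injective
  let _ : OrderBot σ := { bot := M.start, bot_le := hstart }
  have hmono : M.transitions ⊆ {f : σ → σ | Monotone f} := by
    rintro _ ⟨w, rfl⟩ p q hpq
    exact M.acceptsFrom_evalFrom_mono hpq w.1
  by_cases hflat : ∀ p q : σ, ⊥ < p → p ≤ q → p = q
  · right
    intro f hf
    exact monotone_mem_fixOrConst hflat (hmono hf)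
  · left
    push Not at hflat
    obtain ⟨p, q, hp, hpq, hne⟩ := hflat
    exact (Set.ncard_le_ncard hmono (Set.toFinite _)).trans_lt
      (ncard_monotone_lt hσ hp (lt_of_le_of_ne hpq hne))

/-- The letter `x` is the first non-injective one in the word; isolating it shows what a single
letter has to merge. -/
theorem exists_append_not_injective (M : DFA α σ) {w : List α}
    (hw : ¬ Function.Injective fun q => M.evalFrom q w) :
    ∃ u x v, w = u ++ x :: v ∧ (Function.Injective fun q => M.evalFrom q u) ∧
      ¬ Function.Injective fun q => M.step q x := by
  induction w with
  | nil => exact absurd (fun _ _ h => h) hw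
  | cons y w ih =>
    by_cases hy : Function.Injective fun q => M.step q y
    · have hw' : ¬ Function.Injective fun q => M.evalFrom q w :=
        fun h => hw (h.comp hy)
      obtain ⟨u, x, v, rfl, hu, hx⟩ := ih hw'
      exact ⟨y :: u, x, v, rfl, hu.comp hy, hx⟩
    · exact ⟨[], y, w, rfl, fun _ _ h => h, hy⟩

/-- On a finite set an injective first letter is a bijection, so it can be cancelled from the word.
-/
theorem step_injective_of_mem [Finite σ] (M : DFA α σ) {w : List α}
    (hw : Function.Injective fun q => M.evalFrom q w) {x : α} (hx : x ∈ w) :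
    Function.Injective fun q => M.step q x := by
  induction w with
  | nil => simp at hx
  | cons y w ih =>
    have hy : Function.Injective fun q => M.step q y :=
      Function.Injective.of_comp (f := fun q => M.evalFrom q w) hw
    rcases List.mem_cons.1 hx with rfl | hx
    · exact hy
    · refine ih ?_ hx
      have hsurj := Finite.surjective_of_injective hy
      intro p q hpq
      obtain ⟨p, rfl⟩ := hsurj p
      obtain ⟨q, rfl⟩ := hsurj q
      exact congr_arg (M.step · y) (hw hpq)

theorem step_mem_fixOrConst (hM : M.transitions = fixOrConst M.start) (x : α) :
    (fun q => M.step q x) ∈ fixOrConst M.start := by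
  rw [← hM]
  exact ⟨⟨[x], by simp⟩, by simp⟩

/-! ### Five generators are necessary -/

section FiveLetters

variable [Fintype σ]

theorem exists_step_start_ne (hM : M.transitions = fixOrConst M.start) (hσ : 2 ≤ Fintype.card σ) :
    ∃ x, M.step M.start x ≠ M.start := by
  by_contra! h
  have hfix : ∀ w, M.evalFrom M.start w = M.start := by
    intro w
    induction w with
    | nil => rfl
    | cons y w ih => rw [evalFrom_cons, h, ih]
  have : Nontrivial σ := Fintype.one_lt_card_iff_nontrivial.1 hσ
  obtain ⟨r, hr⟩ := exists_ne M.start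
  have hmem : (fun _ => r) ∈ M.transitions := hM ▸ Or.inr ⟨r, rfl⟩
  obtain ⟨w, hw⟩ := hmem
  exact hr ((congr_fun hw M.start).symm.trans (hfix _))

theorem evalFrom_start_of_injective (hM : M.transitions = fixOrConst M.start)
    (hσ : 2 ≤ Fintype.card σ) {u : List α} (hu : Function.Injective fun q => M.evalFrom q u) :
    M.evalFrom M.start u = M.start := by
  by_cases h : u = []
  · subst h; rfl
  · have hmem : (fun q => M.evalFrom q u) ∈ fixOrConst M.start := hM ▸ ⟨⟨u, h⟩, rfl⟩
    rcases hmem with h | ⟨r, hr⟩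
    · exact h
    · have : Nontrivial σ := Fintype.one_lt_card_iff_nontrivial.1 hσ
      obtain ⟨s, hs⟩ := exists_ne M.start
      exact absurd (hu ((congr_fun hr s).trans (congr_fun hr M.start).symm)) hs

/-- A transformation of defect one merging `p` and `q` needs a letter merging exactly one pair. -/
theorem exists_step_merging [DecidableEq σ] (hM : M.transitions = fixOrConst M.start)
    (hσ : 2 ≤ Fintype.card σ) {p q : σ} (hp : p ≠ M.start) (hpq : p ≠ q) :
    ∃ (x : α) (g : σ → σ), Function.Injective g ∧ g M.start = M.start ∧
      M.step (g p) x = M.step (g q) x ∧ ∀ r s, r ≠ s → M.step r x = M.step s x →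
        (r = g p ∧ s = g q) ∨ (r = g q ∧ s = g p) := by
  -- This map merges `p` and `q` and nothing else; `p` is not initial, so it fixes the initial
  -- state.
  have hmem : Function.update id p q ∈ M.transitions := by
    rw [hM]; left; simp [Function.update_of_ne hp.symm]
  obtain ⟨⟨w, hw0⟩, hw⟩ := hmem
  simp only at hw
  have hval : ∀ r s, r ≠ s → M.evalFrom r w = M.evalFrom s w →
      (r = p ∧ s = q) ∨ (r = q ∧ s = p) := by
    intro r s hrs h
    rw [congr_fun hw r, congr_fun hw s] at h
    by_cases hr : r = p <;> by_cases hs : s = p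
    · exact absurd (hr.trans hs.symm) hrs
    · subst hr
      rw [Function.update_self, Function.update_of_ne hs] at h
      exact Or.inl ⟨rfl, h.symm⟩
    · subst hs
      rw [Function.update_self, Function.update_of_ne hr] at h
      exact Or.inr ⟨h, rfl⟩
    · rw [Function.update_of_ne hr, Function.update_of_ne hs] at h
      exact absurd h hrs
  have hninj : ¬ Function.Injective fun q => M.evalFrom q w := by
    intro h
    refine hpq (h ?_)
    simp only [congr_fun hw p, congr_fun hw q]
    rw [Function.update_self, Function.update_of_ne hpq.symm]; rfl
  obtain ⟨u, x, v, rfl, hu, hx⟩ := M.exists_append_not_injective hninj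
  -- The prefix `u` permutes the states, so any pair merged by `x` is the image under `u` of a pair
  -- merged by the whole word.
  have hall : ∀ r s, r ≠ s → M.step r x = M.step s x →
      (r = M.evalFrom p u ∧ s = M.evalFrom q u) ∨ (r = M.evalFrom q u ∧ s = M.evalFrom p u) := by
    intro r s hrs h
    obtain ⟨r, rfl⟩ := Finite.surjective_of_injective hu r
    obtain ⟨s, rfl⟩ := Finite.surjective_of_injective hu s
    have := hval r s (fun h => hrs (by rw [h])) (by
      simp only at h
      rw [evalFrom_append, evalFrom_append, evalFrom_cons, evalFrom_cons, h])
    rcases this with ⟨rfl, rfl⟩ | ⟨rfl, rfl⟩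
    · exact Or.inl ⟨rfl, rfl⟩
    · exact Or.inr ⟨rfl, rfl⟩
  refine ⟨x, fun q => M.evalFrom q u, hu, evalFrom_start_of_injective hM hσ hu, ?_, hall⟩
  simp only [Function.Injective, not_forall] at hx
  obtain ⟨r, s, hrs, hne⟩ := hx
  rcases hall r s hne hrs with ⟨rfl, rfl⟩ | ⟨rfl, rfl⟩
  · exact hrs
  · exact hrs.symm

/-- Words acting as permutations use injective letters only. With a single such letter they would be
powers of it and commute, but the transpositions of `p, q` and of `q, r` do not. -/
theorem exists_two_injective_steps [DecidableEq σ] (hM : M.transitions = fixOrConst M.start)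
    {p q r : σ} (hp : p ≠ M.start) (hq : q ≠ M.start) (hr : r ≠ M.start) (hpq : p ≠ q)
    (hpr : p ≠ r) (hqr : q ≠ r) :
    ∃ x y : α, x ≠ y ∧ (Function.Injective fun q => M.step q x) ∧
      Function.Injective fun q => M.step q y := by
  by_contra! hcon
  have hsw : ∀ s t : σ, s ≠ M.start → t ≠ M.start →
      ∃ w : List α, w ≠ [] ∧ ∀ v, M.evalFrom v w = Equiv.swap s t v := by
    intro s t hs ht
    have hmem : (Equiv.swap s t : σ → σ) ∈ M.transitions := by
      rw [hM]; left; exact Equiv.swap_apply_of_ne_of_ne hs.symm ht.symm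
    obtain ⟨⟨w, hw0⟩, hw⟩ := hmem
    exact ⟨w, hw0, fun v => congr_fun hw v⟩
  obtain ⟨w₁, hne₁, hw₁⟩ := hsw p q hp hq
  obtain ⟨w₂, hne₂, hw₂⟩ := hsw q r hq hr
  have hinj₁ : ∀ x ∈ w₁, Function.Injective fun q => M.step q x := fun x hx =>
    M.step_injective_of_mem (by simp only [hw₁]; exact (Equiv.swap p q).injective) hx
  have hinj₂ : ∀ x ∈ w₂, Function.Injective fun q => M.step q x := fun x hx =>
    M.step_injective_of_mem (by simp only [hw₂]; exact (Equiv.swap q r).injective) hx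
  obtain ⟨x, hx⟩ := List.exists_mem_of_ne_nil _ hne₁
  have heq : ∀ y, (Function.Injective fun q => M.step q y) → y = x := fun y hy => by
    by_contra hne
    exact hcon x y (Ne.symm hne) (hinj₁ x hx) hy
  have e₁ := List.eq_replicate_length.2 fun y hy => heq y (hinj₁ y hy)
  have e₂ := List.eq_replicate_length.2 fun y hy => heq y (hinj₂ y hy)
  have hcomm : w₁ ++ w₂ = w₂ ++ w₁ := by
    rw [e₁, e₂, List.replicate_append_replicate, List.replicate_append_replicate, add_comm]
  have := congr_arg (M.evalFrom p) hcomm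
  rw [evalFrom_append, evalFrom_append, hw₁, hw₂, hw₂, hw₁, Equiv.swap_apply_left,
    Equiv.swap_apply_left, Equiv.swap_apply_of_ne_of_ne hpq hpr, Equiv.swap_apply_left] at this
  exact hqr this.symm

/-- The largest transition semigroup of a left ideal needs five generators. -/
theorem five_le_card [Finite α] (hM : M.transitions = fixOrConst M.start)
    (hσ : 4 ≤ Fintype.card σ) : 5 ≤ Nat.card α := by
  classical
  have h3 : 2 < (Finset.univ.erase M.start).card := by
    rw [Finset.card_erase_of_mem (Finset.mem_univ _), Finset.card_univ]; omega
  obtain ⟨p, hp, q, hq, r, hr, hpq, hpr, hqr⟩ := Finset.two_lt_card.1 h3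
  replace hp := Finset.ne_of_mem_erase hp
  replace hq := Finset.ne_of_mem_erase hq
  replace hr := Finset.ne_of_mem_erase hr
  obtain ⟨x₁, x₂, h12, hi₁, hi₂⟩ := exists_two_injective_steps hM hp hq hr hpq hpr hqr
  -- The letter `x₃` merges two non-initial states and `x₄` merges a non-initial state with the
  -- initial one. Each merges exactly one pair, so they differ from each other and from the constant
  -- letter `x₅`.
  obtain ⟨x₃, g, hg, hgs, hm, hu⟩ := exists_step_merging hM (by omega) hp hpq
  obtain ⟨x₄, k, hk, hks, hm', hu'⟩ := exists_step_merging hM (by omega) hp hp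
  obtain ⟨x₅, h5⟩ := exists_step_start_ne hM (by omega)
  -- A letter that moves the initial state must be constant.
  have hconst : ∀ s t, M.step s x₅ = M.step t x₅ := by
    rcases step_mem_fixOrConst hM x₅ with h | ⟨c, hc⟩
    · exact absurd h h5
    · intro s t
      exact (congr_fun hc s).trans (congr_fun hc t).symm
  have hn₃ : ¬ Function.Injective fun q => M.step q x₃ := fun h => hpq (hg (h hm))
  have hn₄ : ¬ Function.Injective fun q => M.step q x₄ := fun h => hp (hk (h hm'))
  have hn₅ : ¬ Function.Injective fun q => M.step q x₅ := fun h => hpq (h (hconst p q))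
  have ne34 : x₃ ≠ x₄ := by
    rintro rfl
    have hkp : k p ≠ k M.start := fun h => hp (hk h)
    rcases hu _ _ hkp hm' with ⟨-, h⟩ | ⟨-, h⟩
    · rw [hks, ← hgs] at h; exact hq (hg h).symm
    · rw [hks, ← hgs] at h; exact hp (hg h).symm
  have ne45 : x₄ ≠ x₅ := by
    rintro rfl
    rcases hu' p q hpq (hconst _ _) with ⟨-, h⟩ | ⟨h, -⟩
    · exact hq (h.trans hks)
    · exact hp (h.trans hks)
  have ne35 : x₃ ≠ x₅ := by
    rintro rfl
    rcases hu p M.start hp (hconst _ _) with ⟨-, h⟩ | ⟨-, h⟩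
    · rw [← hgs] at h; exact hq (hg h).symm
    · rw [← hgs] at h; exact hp (hg h).symm
  have hnd : [x₁, x₂, x₃, x₄, x₅].Nodup := by
    have n13 : x₁ ≠ x₃ := fun h => hn₃ (h ▸ hi₁)
    have n14 : x₁ ≠ x₄ := fun h => hn₄ (h ▸ hi₁)
    have n15 : x₁ ≠ x₅ := fun h => hn₅ (h ▸ hi₁)
    have n23 : x₂ ≠ x₃ := fun h => hn₃ (h ▸ hi₂)
    have n24 : x₂ ≠ x₄ := fun h => hn₄ (h ▸ hi₂)
    have n25 : x₂ ≠ x₅ := fun h => hn₅ (h ▸ hi₂)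
    simp [h12, n13, n14, n15, n23, n24, n25, ne34, ne35, ne45]
  have := Fintype.ofFinite α
  rw [Nat.card_eq_fintype_card]
  exact hnd.length_le_card

end FiveLetters

end DFA

namespace MostComplex

variable {α : Type} {n : ℕ} {K : Language α}

theorem syntacticSize_le (hn : 4 ≤ n) (hK : K ∈ ofComplexity RegularLeftIdeal n α) :
    K.syntacticSize ≤ ((n ^ (n - 1) + n - 1 : ℕ) : ℕ∞) := by
  classical
  obtain ⟨σ, _, M, rfl, hM, rfl, hstart⟩ := exists_minimal_dfa hK
  rw [hM.syntacticSize, ← (Set.toFinite _).cast_ncard_eq, Nat.cast_le]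
  rcases DFA.ncard_transitions_lt_or_subset hn hM hstart with h | h
  · exact h.le
  · rw [← ncard_fixOrConst M.start (by omega)]
    exact Set.ncard_le_ncard h (Set.toFinite _)

theorem syntacticSize_lt [Finite α] (hn : 4 ≤ n) (hα : Nat.card α < 5)
    (hK : K ∈ ofComplexity RegularLeftIdeal n α) :
    K.syntacticSize < ((n ^ (n - 1) + n - 1 : ℕ) : ℕ∞) := by
  classical
  obtain ⟨σ, _, M, rfl, hM, rfl, hstart⟩ := exists_minimal_dfa hK
  rw [hM.syntacticSize, ← (Set.toFinite _).cast_ncard_eq, Nat.cast_lt]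
  rcases DFA.ncard_transitions_lt_or_subset hn hM hstart with h | h
  · exact h
  · rw [← ncard_fixOrConst M.start (by omega)]
    refine Set.ncard_lt_ncard (h.ssubset_of_ne fun heq => ?_) (Set.toFinite _)
    have := DFA.five_le_card heq hn
    omega

end MostComplex

/-! ### Upper bounds for quotients, star, product and boolean operations -/

namespace Language

variable {α : Type*}

theorem complexity_le_of_mem_quotients {L q : Language α} (hq : q ∈ L.quotients) :
    q.complexity ≤ L.complexity :=
  Set.encard_le_encard (quotients_subset_of_mem hq)

/-- A non-empty concatenation ends with a factor in `K`, and the ideal absorbs everything before it.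
-/
theorem IsLeftIdeal.mem_kstar {K : Language α} (hK : K.IsLeftIdeal) {x : List α} :
    x ∈ K∗ ↔ x = [] ∨ x ∈ K := by
  constructor
  · rw [Language.mem_kstar]
    rintro ⟨S, rfl, hS⟩
    induction S using List.reverseRecOn with
    | nil => exact Or.inl rfl
    | append_singleton S y _ =>
      right
      rw [List.flatten_append, List.flatten_singleton]
      exact hK.append_mem _ (hS y (by simp))
  · rintro (rfl | hx)
    · exact nil_mem_kstar K
    · exact Language.mem_kstar.2 ⟨[x], by simp, by simpa using hx⟩

theorem IsLeftIdeal.leftQuotient_kstar {K : Language α} (hK : K.IsLeftIdeal) {w : List α}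
    (hw : w ≠ []) : (K∗).leftQuotient w = K.leftQuotient w := by
  ext x
  rw [mem_leftQuotient, hK.mem_kstar, mem_leftQuotient, List.append_eq_nil_iff]
  simp [hw]

theorem IsLeftIdeal.complexity_kstar_le {K : Language α} (hK : K.IsLeftIdeal) :
    (K∗).complexity ≤ K.complexity + 1 := by
  refine le_trans (Set.encard_le_encard ?_) (Set.encard_insert_le K.quotients (K∗))
  rintro _ ⟨w, rfl⟩
  by_cases hw : w = []
  · subst hw; exact Set.mem_insert _ _
  · rw [hK.leftQuotient_kstar hw]
    exact Or.inr ⟨w, rfl⟩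

/-- Since `u` is a shortest prefix in `K`, every factorisation cuts at or after the end of `u`.
Moving the cut back to the end of `u` only lengthens the second factor, which stays in the left
ideal. -/
theorem leftQuotient_mul_of_prefix_mem {K K' : Language α} (hK' : K'.IsLeftIdeal) {u v : List α}
    (hu : u ∈ K) (hmin : ∀ s, s <+: u → s ∈ K → s = u) :
    (K * K').leftQuotient (u ++ v) = K'.leftQuotient v := by
  ext x
  rw [mem_leftQuotient, mem_leftQuotient, mem_mul]
  constructor
  · rintro ⟨s, hs, t, ht, hst⟩
    rw [List.append_assoc, List.append_eq_append_iff] at hst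
    rcases hst with ⟨y, rfl, rfl⟩ | ⟨y, rfl, h⟩
    · have := hmin s (List.prefix_append _ _) hs
      have hy : y = [] := by simpa using this
      subst hy
      exact ht
    · rw [h]; exact hK'.append_mem y ht
  · intro h
    exact ⟨u, hu, v ++ x, h, (List.append_assoc _ _ _).symm⟩

/-- The first factor of any factorisation must extend to the end of `w` or beyond. -/
theorem leftQuotient_mul_of_forall_prefix_notMem {K : Language α} (K' : Language α) {w : List α}
    (hw : ∀ s, s <+: w → s ∉ K) : (K * K').leftQuotient w = K.leftQuotient w * K' := by
  ext x
  rw [mem_leftQuotient, mem_mul, mem_mul]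
  constructor
  · rintro ⟨s, hs, t, ht, hst⟩
    rw [List.append_eq_append_iff] at hst
    rcases hst with ⟨y, rfl, rfl⟩ | ⟨y, rfl, rfl⟩
    · exact absurd hs (hw s (List.prefix_append _ _))
    · exact ⟨y, hs, t, ht, rfl⟩
  · rintro ⟨y, hy, t, ht, rfl⟩
    exact ⟨w ++ y, hy, t, ht, List.append_assoc _ _ _⟩

theorem exists_minimal_prefix_mem {K : Language α} {w : List α} (h : ∃ s, s <+: w ∧ s ∈ K) :
    ∃ u v, w = u ++ v ∧ u ∈ K ∧ ∀ s, s <+: u → s ∈ K → s = u := by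
  classical
  have h' : ∃ k, ∃ s, s <+: w ∧ s ∈ K ∧ s.length = k := by
    obtain ⟨s, h1, h2⟩ := h
    exact ⟨_, s, h1, h2, rfl⟩
  obtain ⟨u, ⟨v, hv⟩, huK, hlen⟩ := Nat.find_spec h'
  refine ⟨u, v, hv.symm, huK, fun s hs hsK => hs.eq_of_length_le ?_⟩
  rw [hlen]
  exact Nat.find_min' h' ⟨s, hs.trans ⟨v, hv⟩, hsK, rfl⟩

theorem IsLeftIdeal.quotients_mul_subset {K' : Language α} (K : Language α)
    (hK' : K'.IsLeftIdeal) :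
    (K * K').quotients ⊆ (· * K') '' {q ∈ K.quotients | [] ∉ q} ∪ K'.quotients := by
  rintro _ ⟨w, rfl⟩
  by_cases h : ∃ s, s <+: w ∧ s ∈ K
  · right
    obtain ⟨u, v, rfl, hu, hmin⟩ := exists_minimal_prefix_mem h
    rw [leftQuotient_mul_of_prefix_mem hK' hu hmin]
    exact ⟨v, rfl⟩
  · left
    push Not at h
    refine ⟨K.leftQuotient w, ⟨⟨w, rfl⟩, ?_⟩, (leftQuotient_mul_of_forall_prefix_notMem K' h).symm⟩
    rw [mem_leftQuotient, List.append_nil]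
    exact h w (List.prefix_refl w)

/-- As `K` is non-empty, one of its quotients contains the empty word; that quotient contributes
nothing to the first part of the union, whence the `- 1`. -/
theorem IsLeftIdeal.complexity_mul_le {K K' : Language α} (hK : K.IsLeftIdeal)
    (hK' : K'.IsLeftIdeal) : (K * K').complexity ≤ (K.complexity - 1) + K'.complexity := by
  obtain ⟨w, hw⟩ : ∃ w, w ∈ K := by
    by_contra! h
    exact hK.1 (by ext x; simpa using h x)
  refine (Set.encard_le_encard (hK'.quotients_mul_subset K)).trans ?_
  refine (Set.encard_union_le _ _).trans ?_
  refine add_le_add ((Set.encard_image_le _ _).trans ?_) le_rfl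
  rw [complexity, ← Set.encard_sdiff_singleton_of_mem (K.leftQuotient_mem_quotients w)]
  refine Set.encard_le_encard ?_
  rintro q ⟨hq, hnil⟩
  refine ⟨hq, ?_⟩
  rintro rfl
  exact hnil (by simpa using hw)

theorem leftQuotient_boolOp (f : Bool → Bool → Bool) (K K' : Language α) (w : List α) :
    (boolOp f K K').leftQuotient w = boolOp f (K.leftQuotient w) (K'.leftQuotient w) := rfl

theorem complexity_boolOp_le (f : Bool → Bool → Bool) (K K' : Language α) :
    (boolOp f K K').complexity ≤ K.complexity * K'.complexity := by
  rw [complexity, complexity, complexity, ← Set.encard_prod]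
  refine le_trans (Set.encard_le_encard ?_)
    (Set.encard_image_le (fun x : Language α × Language α => boolOp f x.1 x.2) _)
  rintro _ ⟨w, rfl⟩
  exact ⟨(K.leftQuotient w, K'.leftQuotient w), ⟨⟨w, rfl⟩, ⟨w, rfl⟩⟩, rfl⟩

end Language

namespace MostComplex

variable {α : Type} {m n : ℕ} {K K' : Language α}

theorem complexity_quotient_le (hK : K ∈ ofComplexity RegularLeftIdeal n α) {q : Language α}
    (hq : q ∈ K.quotients) : q.complexity ≤ (n : ℕ∞) :=
  hK.2 ▸ complexity_le_of_mem_quotients hq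

theorem complexity_kstar_le (hK : K ∈ ofComplexity RegularLeftIdeal n α) :
    (K∗).complexity ≤ ((n + 1 : ℕ) : ℕ∞) := by
  have := hK.1.2.complexity_kstar_le
  rw [hK.2] at this
  exact_mod_cast this

theorem complexity_mul_le (hm : 1 ≤ m) (hK : K ∈ ofComplexity RegularLeftIdeal m α)
    (hK' : K' ∈ ofComplexity RegularLeftIdeal n α) :
    (K * K').complexity ≤ ((m + n - 1 : ℕ) : ℕ∞) := by
  have := hK.1.2.complexity_mul_le hK'.1.2
  rw [hK.2, hK'.2] at this
  refine this.trans (le_of_eq ?_)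
  rw [show m + n - 1 = (m - 1) + n by omega]
  push_cast
  rfl

theorem complexity_boolOp_le (f : Bool → Bool → Bool)
    (hK : K ∈ ofComplexity RegularLeftIdeal m α)
    (hK' : K' ∈ ofComplexity RegularLeftIdeal n α) :
    (boolOp f K K').complexity ≤ ((m * n : ℕ) : ℕ∞) := by
  have := Language.complexity_boolOp_le f K K'
  rw [hK.2, hK'.2] at this
  exact_mod_cast this

end MostComplex

/-! ### The number of atoms -/

theorem Set.ncard_notMem {σ : Type*} [Fintype σ] (z : σ) :
    {S : Set σ | z ∉ S}.ncard = 2 ^ (Fintype.card σ - 1) := by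
  have : {S : Set σ | z ∉ S} = 𝒫 {z}ᶜ := by
    ext S; simp [Set.subset_compl_singleton_iff]
  rw [this, Set.ncard_powerset, Set.ncard_compl, Set.ncard_singleton, Nat.card_eq_fintype_card]

theorem Set.ncard_notMem_or_univ {σ : Type*} [Fintype σ] (z : σ) :
    {S : Set σ | z ∉ S ∨ S = Set.univ}.ncard = 2 ^ (Fintype.card σ - 1) + 1 := by
  have : {S : Set σ | z ∉ S ∨ S = Set.univ} = insert Set.univ {S : Set σ | z ∉ S} := by
    ext S; simp [or_comm]
  rw [this, Set.ncard_insert_of_notMem (by simp), Set.ncard_notMem]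

namespace DFA

variable {α σ : Type*} {M : DFA α σ}

/-- A word accepted from the least state is accepted from every state. -/
theorem acceptingStates_mem (hstart : ∀ q, M.acceptsFrom M.start ≤ M.acceptsFrom q)
    (x : List α) : M.acceptingStates x ∈ {S : Set σ | M.start ∉ S ∨ S = Set.univ} := by
  by_cases h : M.start ∈ M.acceptingStates x
  · exact Or.inr (Set.eq_univ_of_forall fun q => hstart q h)
  · exact Or.inl h

theorem encard_atoms_le [Fintype σ] (hM : M.IsMinimal)
    (hstart : ∀ q, M.acceptsFrom M.start ≤ M.acceptsFrom q) :
    M.accepts.atoms.encard ≤ ((2 ^ (Fintype.card σ - 1) + 1 : ℕ) : ℕ∞) := by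
  rw [hM.encard_atoms, ← Set.ncard_notMem_or_univ M.start, (Set.toFinite _).cast_ncard_eq]
  refine Set.encard_le_encard ?_
  rintro _ ⟨x, rfl⟩
  exact acceptingStates_mem hstart x

end DFA

theorem MostComplex.encard_atoms_le {α : Type} {n : ℕ} {K : Language α}
    (hK : K ∈ ofComplexity RegularLeftIdeal n α) :
    K.atoms.encard ≤ ((2 ^ (n - 1) + 1 : ℕ) : ℕ∞) := by
  obtain ⟨σ, _, M, rfl, hM, rfl, hstart⟩ := exists_minimal_dfa hK
  exact DFA.encard_atoms_le hM hstart

/-! ### Counting the pairs of sets in the atom bound -/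

section Counting

variable {σ : Type*} [Fintype σ]

/-- The pairs that index the non-empty quotients of an atom `A_S` with `|S| = s`, `S ≠ ∅`. -/
def atomPairs (z : σ) (s : ℕ) : Set (Set σ × Set σ) :=
  {P | P.1.Nonempty ∧ z ∈ P.2 ∧ Disjoint P.1 P.2 ∧ P.1.ncard ≤ s ∧
    P.2.ncard ≤ Fintype.card σ - s}

/-- Choose the first set among the points other than `z`, then the rest of the second set among the
`n - 1 - x` points still available. -/
theorem card_disjoint_pairs [DecidableEq σ] (z : σ) (x : ℕ) {y : ℕ} (hy : 1 ≤ y) :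
    (Finset.univ.filter fun P : Finset σ × Finset σ =>
        z ∈ P.2 ∧ Disjoint P.1 P.2 ∧ P.1.card = x ∧ P.2.card = y).card
      = (Fintype.card σ - 1).choose x * (Fintype.card σ - x - 1).choose (y - 1) := by
  have h : (Finset.univ.filter fun P : Finset σ × Finset σ =>
        z ∈ P.2 ∧ Disjoint P.1 P.2 ∧ P.1.card = x ∧ P.2.card = y).card
      = ((Finset.powersetCard x (Finset.univ.erase z)).sigma fun X : Finset σ =>
          Finset.powersetCard (y - 1) (Finset.univ.erase z \ X)).card := by
    refine Finset.card_nbij' (fun P => ⟨P.1, P.2.erase z⟩) (fun P => (P.1, insert z P.2))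
      ?_ ?_ ?_ ?_
    · rintro ⟨X, Y⟩ h
      simp only [Finset.coe_filter, Finset.mem_univ, true_and, Set.mem_ofPred_eq] at h
      obtain ⟨hz, hd, hX, hY⟩ := h
      have hzX : z ∉ X := fun h => Finset.disjoint_left.1 hd h hz
      simp only [Finset.coe_sigma, Set.mem_sigma_iff, Finset.mem_coe, Finset.mem_powersetCard]
      refine ⟨⟨fun p hp => ?_, hX⟩, fun p hp => ?_, ?_⟩
      · exact Finset.mem_erase.2 ⟨fun h => hzX (h ▸ hp), Finset.mem_univ _⟩
      · rw [Finset.mem_erase] at hp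
        exact Finset.mem_sdiff.2 ⟨Finset.mem_erase.2 ⟨hp.1, Finset.mem_univ _⟩,
          fun h => Finset.disjoint_left.1 hd h hp.2⟩
      · rw [Finset.card_erase_of_mem hz, hY]
    · rintro ⟨X, Y⟩ h
      simp only [Finset.coe_sigma, Set.mem_sigma_iff, Finset.mem_coe,
        Finset.mem_powersetCard] at h
      obtain ⟨⟨hX, hXc⟩, hY, hYc⟩ := h
      have hzX : z ∉ X := fun h => Finset.ne_of_mem_erase (hX h) rfl
      have hzY : z ∉ Y := fun h => Finset.ne_of_mem_erase (Finset.mem_sdiff.1 (hY h)).1 rfl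
      simp only [Finset.coe_filter, Finset.mem_univ, true_and, Set.mem_ofPred_eq]
      refine ⟨Finset.mem_insert_self _ _, ?_, hXc, ?_⟩
      · rw [Finset.disjoint_insert_right]
        refine ⟨hzX, Finset.disjoint_left.2 fun p hp hp' => (Finset.mem_sdiff.1 (hY hp')).2 hp⟩
      · rw [Finset.card_insert_of_notMem hzY, hYc]; omega
    · rintro ⟨X, Y⟩ h
      simp only [Finset.coe_filter, Finset.mem_univ, true_and, Set.mem_ofPred_eq] at h
      simp only [Finset.insert_erase h.1]
    · rintro ⟨X, Y⟩ h
      simp only [Finset.coe_sigma, Set.mem_sigma_iff, Finset.mem_coe,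
        Finset.mem_powersetCard] at h
      obtain ⟨⟨hX, hXc⟩, hY, hYc⟩ := h
      have hzY : z ∉ Y := fun h => Finset.ne_of_mem_erase (Finset.mem_sdiff.1 (hY h)).1 rfl
      simp only [Finset.erase_insert hzY]
  rw [h, Finset.card_sigma, Finset.sum_congr rfl (g := fun _ =>
    (Fintype.card σ - x - 1).choose (y - 1)), Finset.sum_const, Finset.card_powersetCard,
    Finset.card_erase_of_mem (Finset.mem_univ _), Finset.card_univ, smul_eq_mul]
  intro X hX
  rw [Finset.mem_powersetCard] at hX
  rw [Finset.card_powersetCard, Finset.card_sdiff_of_subset hX.1,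
    Finset.card_erase_of_mem (Finset.mem_univ _), Finset.card_univ, hX.2]
  congr 1
  omega

theorem ncard_atomPairs (z : σ) (s : ℕ) :
    (atomPairs z s).ncard = ∑ x ∈ Finset.Icc 1 s, ∑ y ∈ Finset.Icc 1 (Fintype.card σ - s),
      (Fintype.card σ - 1).choose x * (Fintype.card σ - x - 1).choose (y - 1) := by
  classical
  set P : Finset (Finset σ × Finset σ) := Finset.univ.filter fun P =>
    P.1.Nonempty ∧ z ∈ P.2 ∧ Disjoint P.1 P.2 ∧ P.1.card ≤ s ∧ P.2.card ≤ Fintype.card σ - s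
    with hP
  have himg : atomPairs z s
      = (fun Q : Finset σ × Finset σ => ((Q.1 : Set σ), (Q.2 : Set σ))) '' (P : Set _) := by
    ext ⟨X, Y⟩
    constructor
    · rintro ⟨h1, h2, h3, h4, h5⟩
      refine ⟨(X.toFinset, Y.toFinset), ?_, by simp⟩
      simp only [hP, Finset.coe_filter, Finset.mem_univ, true_and, Set.mem_ofPred_eq]
      rw [Set.ncard_eq_toFinset_card'] at h4 h5
      refine ⟨by simpa using h1, by simpa using h2, by simpa using h3, h4, h5⟩
    · rintro ⟨⟨X', Y'⟩, h, he⟩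
      simp only [Prod.mk.injEq] at he
      obtain ⟨rfl, rfl⟩ := he
      simp only [hP, Finset.coe_filter, Finset.mem_univ, true_and, Set.mem_ofPred_eq] at h
      obtain ⟨h1, h2, h3, h4, h5⟩ := h
      refine ⟨by simpa using h1, by simpa using h2, by simpa using h3, ?_, ?_⟩
      · simpa using h4
      · simpa using h5
  have hinj : Function.Injective fun Q : Finset σ × Finset σ => ((Q.1 : Set σ), (Q.2 : Set σ)) := by
    rintro ⟨X, Y⟩ ⟨X', Y'⟩ h
    simpa using h
  rw [himg, Set.ncard_image_of_injective _ hinj, Set.ncard_coe_finset,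
    Finset.card_eq_sum_card_fiberwise (f := fun Q => (Q.1.card, Q.2.card))
      (t := Finset.Icc 1 s ×ˢ Finset.Icc 1 (Fintype.card σ - s)), Finset.sum_product]
  · refine Finset.sum_congr rfl fun x hx => Finset.sum_congr rfl fun y hy => ?_
    rw [Finset.mem_Icc] at hx hy
    rw [← card_disjoint_pairs z x hy.1, hP, Finset.filter_filter]
    congr 1
    ext ⟨X, Y⟩
    simp only [Finset.mem_filter, Finset.mem_univ, true_and, Prod.mk.injEq]
    constructor
    · rintro ⟨⟨-, h2, h3, -, -⟩, h4, h5⟩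
      exact ⟨h2, h3, h4, h5⟩
    · rintro ⟨h2, h3, h4, h5⟩
      refine ⟨⟨Finset.card_pos.1 (by omega), h2, h3, by omega, by omega⟩, h4, h5⟩
  · rintro ⟨X, Y⟩ h
    simp only [hP, Finset.coe_filter, Finset.mem_univ, true_and, Set.mem_ofPred_eq] at h
    obtain ⟨h1, h2, h3, h4, h5⟩ := h
    have := Finset.card_pos.2 h1
    have := Finset.card_pos.2 ⟨z, h2⟩
    simp only [Finset.coe_product, Set.mem_prod, Finset.mem_coe, Finset.mem_Icc]
    exact ⟨⟨by omega, h4⟩, by omega, h5⟩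

end Counting

namespace MostComplex

theorem atomBound_self (n : ℕ) : atomBound n n = n := by simp [atomBound]

theorem atomBound_zero {n : ℕ} (hn : n ≠ 0) : atomBound n 0 = 2 ^ (n - 1) := by
  simp [atomBound, hn.symm]

/-- Only `y = 1` survives, and the remaining sum with the extra `1` is a full row of binomial
coefficients. The case is isolated because the coatom needs its own counting argument. -/
theorem atomBound_pred {n : ℕ} (hn : 2 ≤ n) : atomBound n (n - 1) = 2 ^ (n - 1) := by
  have h1 : n - 1 ≠ n := by omega
  have h2 : n - 1 ≠ 0 := by omega
  have h3 : n - (n - 1) = 1 := by omega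
  rw [atomBound, if_neg h1, if_neg h2, h3]
  simp only [Finset.Icc_self, Finset.sum_singleton, Nat.sub_self, Nat.choose_zero_right, mul_one]
  rw [← Nat.sum_range_choose, Finset.range_eq_Ico, Finset.sum_eq_sum_Ico_succ_bot (by omega)]
  simp only [Nat.choose_zero_right]
  congr 1

theorem atomBound_eq_ncard {σ : Type*} [Fintype σ] (z : σ) {s : ℕ} (hs : s ≠ 0)
    (hs' : s ≠ Fintype.card σ) : atomBound (Fintype.card σ) s = (atomPairs z s).ncard + 1 := by
  rw [atomBound, if_neg hs', if_neg hs, ncard_atomPairs, add_comm]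

end MostComplex

/-! ### Upper bounds for the complexity of atoms -/

namespace DFA

variable {α σ : Type*} {M : DFA α σ}

theorem cell_eq_zero {X Y : Set σ} (h : ¬ Disjoint X Y) : M.cell X Y = 0 := by
  ext y
  simp only [Language.notMem_zero, iff_false]
  rintro ⟨h1, h2⟩
  exact h (h2.symm.mono_left h1)

theorem disjoint_acceptingStates_of_le {Y Y' : Set σ} {x : List α}
    (h : ∀ q ∈ Y, ∃ q' ∈ Y', M.acceptsFrom q ≤ M.acceptsFrom q')
    (hx : Disjoint Y' (M.acceptingStates x)) : Disjoint Y (M.acceptingStates x) := by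
  rw [Set.disjoint_left] at hx ⊢
  intro q hq hqx
  obtain ⟨q', hq', hle⟩ := h q hq
  exact hx hq' (hle hqx)

/-- Rejection from a state implies rejection from every smaller one, so only what lies at the top of
the second set counts. `cell_congr_left` is the dual for the first set. -/
theorem cell_congr_right (X : Set σ) {Y Y' : Set σ}
    (h : ∀ q ∈ Y, ∃ q' ∈ Y', M.acceptsFrom q ≤ M.acceptsFrom q')
    (h' : ∀ q ∈ Y', ∃ q' ∈ Y, M.acceptsFrom q ≤ M.acceptsFrom q') : M.cell X Y = M.cell X Y' := by
  ext x
  exact and_congr_right fun _ =>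
    ⟨fun hx => disjoint_acceptingStates_of_le h' hx, fun hx => disjoint_acceptingStates_of_le h hx⟩

theorem cell_congr_left {X X' : Set σ} (Y : Set σ) (h : X' ⊆ X)
    (h' : ∀ q ∈ X, ∃ q' ∈ X', M.acceptsFrom q' ≤ M.acceptsFrom q) : M.cell X Y = M.cell X' Y := by
  ext x
  refine and_congr_left fun _ => ⟨fun hx => h.trans hx, fun hx q hq => ?_⟩
  obtain ⟨q', hq', hle⟩ := h' q hq
  exact hle (hx hq')

theorem atomAt_univ (hstart : ∀ q, M.acceptsFrom M.start ≤ M.acceptsFrom q) :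
    M.atomAt Set.univ = M.accepts := by
  ext x
  rw [mem_atomAt]
  constructor
  · intro h
    have : M.start ∈ M.acceptingStates x := h ▸ Set.mem_univ _
    exact this
  · intro h
    exact Set.eq_univ_of_forall fun q => hstart q h

theorem _root_.Set.encard_le_ncard_of_subset_image {β γ : Type*} [Finite β] (f : β → γ) {s : Set β} {t : Set γ}
    (h : t ⊆ f '' s) : t.encard ≤ (s.ncard : ℕ∞) := by
  rw [(Set.toFinite s).cast_ncard_eq]
  exact (Set.encard_le_encard h).trans (Set.encard_image_le _ _)

variable [Fintype σ]

/-- The first set is empty and the second is non-empty, so adjoining the initial state to the latter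
changes nothing; what remains is a subset of the non-initial states. -/
theorem complexity_atomAt_empty_le (hstart : ∀ q, M.acceptsFrom M.start ≤ M.acceptsFrom q) :
    (M.atomAt ∅).complexity ≤ ((2 ^ (Fintype.card σ - 1) : ℕ) : ℕ∞) := by
  rw [← Set.ncard_notMem M.start, Language.complexity, M.atom_quotients]
  refine Set.encard_le_ncard_of_subset_image (fun Y => M.cell ∅ (insert M.start Y)) ?_
  rintro _ ⟨w, rfl⟩
  set f := fun q => M.evalFrom q w with hf
  refine ⟨f '' Set.univ \ {M.start}, by simp, ?_⟩
  simp only [Set.image_empty, Set.compl_empty, Set.insert_sdiff_singleton]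
  refine cell_congr_right _ ?_ ?_
  · rintro q (rfl | hq)
    · exact ⟨f M.start, ⟨_, trivial, rfl⟩, hstart _⟩
    · exact ⟨q, hq, le_rfl⟩
  · rintro q hq
    exact ⟨q, Or.inr hq, le_rfl⟩

/-- The aim is to have the initial state `z` in the second set without exceeding its size bound.
Adjoining `z` is free; if it makes the set too large, `f z` is dropped instead. This is harmless
because `f z` lies below every image and, as `Sᶜ` has at least two elements, another image remains.
-/
theorem quotients_atomAt_subset (hM : M.IsMinimal)
    (hstart : ∀ q, M.acceptsFrom M.start ≤ M.acceptsFrom q) {S : Set σ} (hS : S.Nonempty)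
    (hz : M.start ∉ S) (hcard : S.ncard + 2 ≤ Fintype.card σ) :
    (M.atomAt S).quotients ⊆
      insert 0 ((fun P => M.cell P.1 P.2) '' atomPairs M.start S.ncard) := by
  rw [M.atom_quotients]
  rintro _ ⟨w, rfl⟩
  simp only
  set f := fun q => M.evalFrom q w with hf
  have hmono : ∀ q, M.acceptsFrom (f M.start) ≤ M.acceptsFrom (f q) := fun q =>
    M.acceptsFrom_evalFrom_mono (hstart q) w
  by_cases hd : Disjoint (f '' S) (f '' Sᶜ)
  swap
  · rw [cell_eq_zero hd]; exact Set.mem_insert _ _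
  right
  have hXcard : (f '' S).ncard ≤ S.ncard := Set.ncard_image_le (Set.toFinite _)
  have hYcard : (f '' Sᶜ).ncard ≤ Fintype.card σ - S.ncard := by
    refine (Set.ncard_image_le (Set.toFinite _)).trans ?_
    rw [Set.ncard_compl, Nat.card_eq_fintype_card]
  have hr : f M.start ∈ f '' Sᶜ := ⟨_, hz, rfl⟩
  -- As `f` is monotone, it can reach the least state only if it fixes it.
  have hzf : ∀ q, f q = M.start → f M.start = M.start := fun q hq =>
    hM.2 _ _ (le_antisymm (hq ▸ hmono q) (hstart _))
  have hzX : M.start ∉ f '' S := by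
    rintro ⟨q, hq, hqz⟩
    exact Set.disjoint_left.1 hd ⟨q, hq, hqz⟩ (hzf q hqz ▸ hr)
  by_cases hc : (insert M.start (f '' Sᶜ)).ncard ≤ Fintype.card σ - S.ncard
  · refine ⟨(f '' S, insert M.start (f '' Sᶜ)),
      ⟨hS.image f, Set.mem_insert _ _, Set.disjoint_insert_right.2 ⟨hzX, hd⟩, hXcard, hc⟩, ?_⟩
    refine cell_congr_right _ ?_ fun q hq => ⟨q, Or.inr hq, le_rfl⟩
    rintro q (rfl | hq)
    · exact ⟨_, hr, hstart _⟩
    · exact ⟨q, hq, le_rfl⟩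
  · have hzY : M.start ∉ f '' Sᶜ := fun h => hc (by rwa [Set.insert_eq_of_mem h])
    rw [Set.ncard_insert_of_notMem hzY (Set.toFinite _)] at hc
    have hdiff : ((f '' Sᶜ) \ {f M.start}).ncard = (f '' Sᶜ).ncard - 1 :=
      Set.ncard_sdiff_singleton_of_mem hr
    refine ⟨(f '' S, insert M.start ((f '' Sᶜ) \ {f M.start})),
      ⟨hS.image f, Set.mem_insert _ _, Set.disjoint_insert_right.2
        ⟨hzX, hd.mono_right Set.sdiff_subset⟩, hXcard, ?_⟩, ?_⟩
    · refine (Set.ncard_insert_le _ _).trans ?_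
      omega
    · obtain ⟨q', hq'⟩ : ((f '' Sᶜ) \ {f M.start}).Nonempty := by
        rw [← Set.ncard_pos (Set.toFinite _)]; omega
      have hle : M.acceptsFrom (f M.start) ≤ M.acceptsFrom q' := by
        obtain ⟨q, -, rfl⟩ := hq'.1
        exact hmono q
      refine cell_congr_right _ ?_ ?_
      · rintro q (rfl | hq)
        · exact ⟨_, hr, hstart _⟩
        · exact ⟨q, hq.1, le_rfl⟩
      · intro q hq
        by_cases hqr : q = f M.start
        · exact ⟨q', Or.inr hq', hqr ▸ hle⟩
        · exact ⟨q, Or.inr ⟨hq, hqr⟩, le_rfl⟩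

open scoped Classical in
/-- The quotients of the atom whose index is the set of all non-initial states, as a function of
a set `Z` of non-initial states. -/
noncomputable def coatomCell (M : DFA α σ) (Z : Set σ) : Language α :=
  if Z = ∅ then 0
  else if h : ∃ r ∈ Z, (∀ q ∈ Z, M.acceptsFrom r ≤ M.acceptsFrom q) ∧ Z ≠ {r} then
    M.cell (Z \ {h.choose}) {h.choose}
  else M.cell Z {M.start}

/-- The second set is a single state `r`, so `r` cannot be traded for the initial state as in the
general case. Each cell is instead coded by one set `Z` of non-initial states: the empty set if `r ∈
X`; the minimal elements of `X` if `r` is initial; `X` with `r` adjoined otherwise. The last two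
codes are told apart by whether `Z` has a least element and is not a singleton. -/
theorem complexity_atomAt_compl_le (hM : M.IsMinimal)
    (hstart : ∀ q, M.acceptsFrom M.start ≤ M.acceptsFrom q) (hσ : 2 ≤ Fintype.card σ) :
    (M.atomAt {M.start}ᶜ).complexity ≤ ((2 ^ (Fintype.card σ - 1) : ℕ) : ℕ∞) := by
  rw [← Set.ncard_notMem M.start, Language.complexity, M.atom_quotients]
  refine Set.encard_le_ncard_of_subset_image M.coatomCell ?_
  rintro _ ⟨w, rfl⟩
  simp only
  set f := fun q => M.evalFrom q w with hf
  set X : Set σ := (fun q => f q) '' {M.start}ᶜ with hX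
  set r := f M.start with hr
  have hY : f '' {M.start}ᶜᶜ = {r} := by
    ext q; simp [hr]
  rw [hY]
  have hmono : ∀ q, M.acceptsFrom r ≤ M.acceptsFrom (f q) := fun q =>
    M.acceptsFrom_evalFrom_mono (hstart q) w
  have hXr : ∀ q ∈ X, M.acceptsFrom r ≤ M.acceptsFrom q := by
    rintro _ ⟨q, -, rfl⟩; exact hmono q
  have hXne : X.Nonempty := by
    have : Nontrivial σ := Fintype.one_lt_card_iff_nontrivial.1 hσ
    obtain ⟨q, hq⟩ := exists_ne M.start
    exact ⟨f q, q, hq, rfl⟩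
  by_cases hrX : r ∈ X
  · refine ⟨∅, by simp, ?_⟩
    rw [coatomCell, if_pos rfl, cell_eq_zero]
    simpa using hrX
  by_cases hrz : r = M.start
  · let _ : PartialOrder σ := PartialOrder.lift M.acceptsFrom hM.injective
    set Z : Set σ := {q | Minimal (· ∈ X) q} with hZ
    have hZX : Z ⊆ X := fun q hq => hq.1
    have hbelow : ∀ q ∈ X, ∃ q' ∈ Z, M.acceptsFrom q' ≤ M.acceptsFrom q := by
      intro q hq
      obtain ⟨b, hb, hbm⟩ := (Set.toFinite X).exists_le_minimal hq
      exact ⟨b, hbm, hb⟩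
    have hZne : Z ≠ ∅ := by
      obtain ⟨q, hq⟩ := hXne
      obtain ⟨b, hb, -⟩ := hbelow q hq
      exact (Set.nonempty_of_mem hb).ne_empty
    refine ⟨Z, fun h => hrX (hrz ▸ hZX h), ?_⟩
    rw [coatomCell, if_neg hZne, dif_neg, hrz]
    · exact (cell_congr_left _ hZX hbelow).symm
    -- An antichain with a least element is a singleton.
    · rintro ⟨p, hp, hmin, hne⟩
      refine hne (Set.eq_singleton_iff_unique_mem.2 ⟨hp, fun q hq => ?_⟩)
      have hpq : p ≤ q := hmin q hq
      exact le_antisymm (hq.2 hp.1 hpq) hpq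
  · have hzX : M.start ∉ X := fun h =>
      hrz (hM.2 _ _ (le_antisymm (hXr _ h) (hstart _)))
    refine ⟨insert r X, ?_, ?_⟩
    · rintro (h | h)
      · exact hrz h.symm
      · exact hzX h
    · have hex : ∃ p ∈ insert r X,
          (∀ q ∈ insert r X, M.acceptsFrom p ≤ M.acceptsFrom q) ∧ insert r X ≠ {p} := by
        refine ⟨r, Set.mem_insert _ _, ?_, fun h => ?_⟩
        · rintro q (rfl | hq)
          · exact le_rfl
          · exact hXr q hq
        · obtain ⟨q, hq⟩ := hXne
          have : q = r := h.subset (Or.inr hq)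
          exact hrX (this ▸ hq)
      have hch : hex.choose = r := by
        obtain ⟨h1, h2, -⟩ := hex.choose_spec
        refine hM.2 _ _ (le_antisymm (h2 _ (Set.mem_insert _ _)) ?_)
        rcases h1 with h | h
        · exact (congr_arg M.acceptsFrom h).ge
        · exact hXr _ h
      rw [coatomCell, if_neg (Set.insert_nonempty _ _).ne_empty, dif_pos hex, hch,
        Set.insert_sdiff_self_of_notMem hrX]

theorem complexity_atomAt_le (hM : M.IsMinimal)
    (hstart : ∀ q, M.acceptsFrom M.start ≤ M.acceptsFrom q) (hσ : 2 ≤ Fintype.card σ)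
    (x : List α) :
    (M.atomAt (M.acceptingStates x)).complexity ≤
      (atomBound (Fintype.card σ) (M.acceptingStates x).ncard : ℕ∞) := by
  rcases acceptingStates_mem hstart x with hz | huniv
  swap
  · rw [huniv, atomAt_univ hstart, hM.complexity, Set.ncard_univ, Nat.card_eq_fintype_card,
      atomBound_self, ENat.card_eq_coe_fintype_card]
  generalize M.acceptingStates x = S at hz
  rcases S.eq_empty_or_nonempty with rfl | hS
  · rw [Set.ncard_empty, atomBound_zero (by omega)]
    exact complexity_atomAt_empty_le hstart
  have hpos : S.ncard ≠ 0 := ((Set.ncard_pos (Set.toFinite _)).2 hS).ne'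
  have hsub : S ⊆ {M.start}ᶜ := Set.subset_compl_singleton_iff.2 hz
  have hcompl : ({M.start}ᶜ : Set σ).ncard = Fintype.card σ - 1 := by
    rw [Set.ncard_compl, Set.ncard_singleton, Nat.card_eq_fintype_card]
  have hle := Set.ncard_le_ncard hsub (Set.toFinite _)
  by_cases heq : S = {M.start}ᶜ
  · rw [heq, hcompl, atomBound_pred hσ]
    exact complexity_atomAt_compl_le hM hstart hσ
  · have hlt := Set.ncard_lt_ncard (hsub.ssubset_of_ne heq) (Set.toFinite _)
    rw [atomBound_eq_ncard M.start hpos (by omega)]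
    refine (Set.encard_le_encard (quotients_atomAt_subset hM hstart hS hz (by omega))).trans ?_
    refine (Set.encard_insert_le _ _).trans ?_
    rw [Nat.cast_add, Nat.cast_one]
    exact add_le_add (Set.encard_le_ncard_of_subset_image _ subset_rfl) le_rfl

end DFA

theorem MostComplex.complexity_atom_le {α : Type} {n : ℕ} (hn : 2 ≤ n) {K : Language α}
    (hK : K ∈ ofComplexity RegularLeftIdeal n α) {A : Language α} (hA : A ∈ K.atoms) :
    A.complexity ≤ (atomBound n (K.atomIndex A).ncard : ℕ∞) := by
  obtain ⟨σ, _, M, rfl, hM, rfl, hstart⟩ := exists_minimal_dfa hK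
  obtain ⟨x, rfl⟩ := hM.mem_atoms.1 hA
  rw [hM.ncard_atomIndex]
  exact DFA.complexity_atomAt_le hM hstart hn x

/-! ### Lower bounds for the complexity of atoms -/

theorem Set.exists_image_eq_of_ncard_le {σ : Type*} [Finite σ] {S X : Set σ} (hX : X.Nonempty)
    (h : X.ncard ≤ S.ncard) : ∃ g : σ → σ, g '' S = X := by
  classical
  have := Fintype.ofFinite σ
  obtain ⟨i⟩ : Nonempty (X ↪ S) := by
    refine Function.Embedding.nonempty_of_card_le ?_
    rwa [← Nat.card_eq_fintype_card, ← Nat.card_eq_fintype_card, Nat.card_coe_set_eq,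
      Nat.card_coe_set_eq]
  obtain ⟨x₀, hx₀⟩ := hX
  let g : σ → σ := fun q => if h : ∃ x : X, (i x : σ) = q then h.choose else x₀
  have hg : ∀ x : X, g (i x) = x := by
    intro x
    have hex : ∃ y : X, (i y : σ) = i x := ⟨x, rfl⟩
    have hch : hex.choose = x := i.injective (Subtype.ext hex.choose_spec)
    simp only [g, dif_pos hex, hch]
  refine ⟨g, Set.Subset.antisymm ?_ fun x hx => ⟨i ⟨x, hx⟩, (i ⟨x, hx⟩).2, hg ⟨x, hx⟩⟩⟩
  rintro _ ⟨q, -, rfl⟩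
  by_cases hq : ∃ x : X, (i x : σ) = q
  · simp only [g, dif_pos hq]; exact hq.choose.2
  · simp only [g, dif_neg hq]; exact hx₀

theorem Set.exists_image_eq_of_ncard_le_of_mem {σ : Type*} [Finite σ] {S X : Set σ} {z : σ}
    (hzS : z ∈ S) (hzX : z ∈ X) (h : X.ncard ≤ S.ncard) :
    ∃ g : σ → σ, g z = z ∧ g '' S = X := by
  classical
  rcases (X \ {z}).eq_empty_or_nonempty with he | hne
  · refine ⟨fun _ => z, rfl, ?_⟩
    have hX : X = {z} := Set.Subset.antisymm (Set.sdiff_eq_empty.1 he) (by simpa using hzX)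
    rw [hX]
    exact Set.Nonempty.image_const ⟨z, hzS⟩ z
  · have hcard : (X \ {z}).ncard ≤ (S \ {z}).ncard := by
      rw [Set.ncard_sdiff_singleton_of_mem hzX, Set.ncard_sdiff_singleton_of_mem hzS]
      omega
    obtain ⟨g, hg⟩ := Set.exists_image_eq_of_ncard_le hne hcard
    refine ⟨Function.update g z z, Function.update_self _ _ _, ?_⟩
    have hS : S = insert z (S \ {z}) := by rw [Set.insert_sdiff_singleton, Set.insert_eq_of_mem hzS]
    have hX : X = insert z (X \ {z}) := by rw [Set.insert_sdiff_singleton, Set.insert_eq_of_mem hzX]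
    rw [hS, Set.image_insert_eq, Function.update_self, hX, ← hg]
    congr 1
    refine Set.image_congr fun q hq => Function.update_of_ne hq.2 _ _

namespace DFA

variable {α σ : Type*} {M : DFA α σ}

theorem transition_image_mem_quotients (S : Set σ) {t : σ → σ} (ht : t ∈ M.transitions) :
    M.cell (t '' S) (t '' Sᶜ) ∈ (M.atomAt S).quotients := by
  obtain ⟨w, rfl⟩ := ht
  rw [M.atom_quotients]
  exact ⟨w.1, rfl⟩

/-- A cell determines its pair: words with accepting set `X` and words with accepting set `Yᶜ` both
lie in it, the smallest and the largest admissible sets, and testing them against another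
description gives both inclusions. -/
theorem cell_injOn (hS : ∀ S : Set σ, M.start ∉ S → ∃ x, M.acceptingStates x = S)
    {X Y X' Y' : Set σ} (hd : Disjoint X Y) (hd' : Disjoint X' Y') (hz : M.start ∈ Y)
    (hz' : M.start ∈ Y') (h : M.cell X Y = M.cell X' Y') : X = X' ∧ Y = Y' := by
  have key : ∀ {X Y X' Y' : Set σ}, Disjoint X Y → M.start ∈ Y →
      M.cell X Y = M.cell X' Y' → X' ⊆ X ∧ Y' ⊆ Y := by
    intro X Y X' Y' hd hz h
    constructor
    · obtain ⟨x, hx⟩ := hS X fun h => Set.disjoint_left.1 hd h hz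
      have hmem : x ∈ M.cell X Y := by
        rw [mem_cell, hx]; exact ⟨subset_rfl, hd.symm⟩
      rw [h, mem_cell, hx] at hmem
      exact hmem.1
    · obtain ⟨x, hx⟩ := hS Yᶜ fun h => h hz
      have hmem : x ∈ M.cell X Y := by
        rw [mem_cell, hx]
        exact ⟨Set.subset_compl_iff_disjoint_right.2 hd, disjoint_compl_right⟩
      rw [h, mem_cell, hx] at hmem
      exact Set.disjoint_compl_right_iff_subset.1 hmem.2
  obtain ⟨h1, h2⟩ := key hd hz h
  obtain ⟨h3, h4⟩ := key hd' hz' h.symm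
  exact ⟨h3.antisymm h1, h4.antisymm h2⟩

theorem cell_ne_zero (hS : ∀ S : Set σ, M.start ∉ S → ∃ x, M.acceptingStates x = S)
    {X Y : Set σ} (hd : Disjoint X Y) (hz : M.start ∈ Y) : M.cell X Y ≠ 0 := by
  obtain ⟨x, hx⟩ := hS X fun h => Set.disjoint_left.1 hd h hz
  have hmem : x ∈ M.cell X Y := by
    rw [mem_cell, hx]; exact ⟨subset_rfl, hd.symm⟩
  intro h
  rw [h] at hmem
  exact hmem

variable [Fintype σ]

theorem le_complexity_atomAt_empty (hT : fixOrConst M.start ⊆ M.transitions)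
    (hS : ∀ S : Set σ, M.start ∉ S → ∃ x, M.acceptingStates x = S) :
    ((2 ^ (Fintype.card σ - 1) : ℕ) : ℕ∞) ≤ (M.atomAt ∅).complexity := by
  classical
  rw [← Set.ncard_notMem M.start, (Set.toFinite _).cast_ncard_eq]
  have hinj : Set.InjOn (fun Z : Set σ => M.cell ∅ Zᶜ) {Z | M.start ∉ Z} := by
    intro Z hZ Z' hZ' h
    exact compl_injective (cell_injOn hS (Set.empty_disjoint _) (Set.empty_disjoint _) hZ hZ' h).2
  rw [← hinj.encard_image]
  refine Set.encard_le_encard ?_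
  rintro _ ⟨Z, hZ, rfl⟩
  -- Collapsing `Z` to the initial state gives a map with image exactly `Zᶜ`.
  have ht : (fun q => if q ∈ Z then M.start else q) ∈ M.transitions :=
    hT (Or.inl (if_neg hZ))
  convert transition_image_mem_quotients ∅ ht using 2
  · simp
  · ext q
    simp only [Set.compl_empty, Set.image_univ, Set.mem_range]
    constructor
    · intro hq; exact ⟨q, if_neg hq⟩
    · rintro ⟨p, rfl⟩
      by_cases hp : p ∈ Z
      · simpa [hp] using hZ
      · simp [hp]

theorem le_complexity_atomAt (hT : fixOrConst M.start ⊆ M.transitions)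
    (hS : ∀ S : Set σ, M.start ∉ S → ∃ x, M.acceptingStates x = S) {S : Set σ}
    (hne : S.Nonempty) (hz : M.start ∉ S) :
    (((atomPairs M.start S.ncard).ncard + 1 : ℕ) : ℕ∞) ≤ (M.atomAt S).complexity := by
  classical
  have hinj : Set.InjOn (fun P : Set σ × Set σ => M.cell P.1 P.2) (atomPairs M.start S.ncard) := by
    rintro ⟨X, Y⟩ ⟨-, hzY, hd, -, -⟩ ⟨X', Y'⟩ ⟨-, hzY', hd', -, -⟩ h
    exact Prod.ext_iff.2 (cell_injOn hS hd hd' hzY hzY' h)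
  have h0 : (0 : Language α) ∉
      (fun P : Set σ × Set σ => M.cell P.1 P.2) '' atomPairs M.start S.ncard := by
    rintro ⟨⟨X, Y⟩, ⟨-, hzY, hd, -, -⟩, h⟩
    exact cell_ne_zero hS hd hzY h
  rw [Nat.cast_add, Nat.cast_one, (Set.toFinite _).cast_ncard_eq, ← hinj.encard_image,
    ← Set.encard_insert_of_notMem h0]
  refine Set.encard_le_encard (Set.insert_subset ?_ ?_)
  -- A constant map makes the two images meet and yields the empty quotient, the `+ 1` of the bound.
  · have ht : (fun _ => M.start) ∈ M.transitions := hT (Or.inl rfl)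
    convert transition_image_mem_quotients S ht
    rw [hne.image_const, Set.Nonempty.image_const (s := Sᶜ) ⟨M.start, hz⟩, cell_eq_zero (by simp)]
  · rintro _ ⟨⟨X, Y⟩, ⟨hX, hzY, hd, hXc, hYc⟩, rfl⟩
    obtain ⟨g₁, hg₁⟩ := Set.exists_image_eq_of_ncard_le hX hXc
    have hYc' : Y.ncard ≤ Sᶜ.ncard := by
      rwa [Set.ncard_compl, Nat.card_eq_fintype_card]
    obtain ⟨g₂, hg₂z, hg₂⟩ := Set.exists_image_eq_of_ncard_le_of_mem (S := Sᶜ) hz hzY hYc'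
    -- The maps on `S` and on `Sᶜ` are chosen independently; only the initial state, which lies in
    -- `Sᶜ`, has to be fixed.
    have ht : (fun q => if q ∈ S then g₁ q else g₂ q) ∈ M.transitions :=
      hT (Or.inl ((if_neg hz).trans hg₂z))
    convert transition_image_mem_quotients S ht using 2
    · exact hg₁.symm.trans (Set.image_congr fun q hq => (if_pos hq).symm)
    · exact hg₂.symm.trans (Set.image_congr fun q hq => (if_neg hq).symm)

/-- When the transition semigroup is as large as possible and so is the number of atoms, then all
atoms have the largest possible complexity. -/
theorem complexity_atomAt_eq (hM : M.IsMinimal)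
    (hstart : ∀ q, M.acceptsFrom M.start ≤ M.acceptsFrom q) (hσ : 2 ≤ Fintype.card σ)
    (hT : fixOrConst M.start ⊆ M.transitions)
    (hS : ∀ S : Set σ, M.start ∉ S → ∃ x, M.acceptingStates x = S) (x : List α) :
    (M.atomAt (M.acceptingStates x)).complexity =
      (atomBound (Fintype.card σ) (M.acceptingStates x).ncard : ℕ∞) := by
  refine le_antisymm (complexity_atomAt_le hM hstart hσ x) ?_
  rcases acceptingStates_mem hstart x with hz | huniv
  swap
  · rw [huniv, atomAt_univ hstart, hM.complexity, Set.ncard_univ, Nat.card_eq_fintype_card,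
      atomBound_self, ENat.card_eq_coe_fintype_card]
  generalize M.acceptingStates x = S at hz
  rcases S.eq_empty_or_nonempty with rfl | hne
  · rw [Set.ncard_empty, atomBound_zero (by omega)]
    exact le_complexity_atomAt_empty hT hS
  · have hlt : S.ncard < Fintype.card σ := by
      rw [← Nat.card_eq_fintype_card, ← Set.ncard_univ]
      exact Set.ncard_lt_ncard (Set.ssubset_univ_iff.2 fun h => hz (h ▸ trivial)) (Set.toFinite _)
    rw [atomBound_eq_ncard M.start ((Set.ncard_pos (Set.toFinite _)).2 hne).ne' hlt.ne]
    exact le_complexity_atomAt hT hS hne hz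

end DFA

/-! ### The witness: letters, minimality, ideal property and quotients -/

theorem DFA.evalFrom_replicate {α σ : Type*} (M : DFA α σ) (q : σ) (x : α) (k : ℕ) :
    M.evalFrom q (List.replicate k x) = (fun q => M.step q x)^[k] q := by
  induction k generalizing q with
  | zero => rfl
  | succ k ih => rw [List.replicate_succ, DFA.evalFrom_cons, ih, Function.iterate_succ_apply]

/-- Taking `q` as the new initial state leaves the DFA minimal. -/
theorem DFA.complexity_acceptsFrom {α σ : Type*} {M : DFA α σ} (hM : M.IsMinimal) {q : σ}
    (hq : ∀ p, ∃ w, M.evalFrom q w = p) : (M.acceptsFrom q).complexity = ENat.card σ :=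
  DFA.IsMinimal.complexity (M := { M with start := q }) ⟨hq, hM.2⟩

namespace MostComplex

section Steps

variable {n : ℕ} (hn : 4 ≤ n)

theorem val_witnessStep_a (q : Fin n) : (witnessStep hn .a q).1 =
    if q.1 = 0 then 0 else if q.1 + 1 < n then q.1 + 1 else 1 := by
  simp only [witnessStep]
  split_ifs <;> simp_all

theorem witnessStep_a_injective : Function.Injective (witnessStep hn .a) := by
  intro p q h
  have h' := congr_arg Fin.val h
  rw [val_witnessStep_a, val_witnessStep_a] at h'
  have := p.2
  have := q.2
  ext
  split_ifs at h' <;> omega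

theorem witnessStep_a_bijective : Function.Bijective (witnessStep hn .a) :=
  Finite.injective_iff_bijective.1 (witnessStep_a_injective hn)

theorem val_iterate_witnessStep_a {q : Fin n} (hq : 1 ≤ q.1) {k : ℕ} (hk : q.1 + k < n) :
    ((witnessStep hn .a)^[k] q).1 = q.1 + k := by
  induction k with
  | zero => rfl
  | succ k ih =>
    rw [Function.iterate_succ_apply', val_witnessStep_a, ih (by omega)]
    split_ifs <;> omega

theorem iterate_witnessStep_a_zero {q : Fin n} (hq : q.1 = 0) (k : ℕ) :
    (witnessStep hn .a)^[k] q = q := by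
  refine Function.iterate_fixed ?_ k
  ext
  rw [val_witnessStep_a, if_pos hq, hq]

theorem witnessStep_c_of_ne {q : Fin n} (hq : q.1 ≠ n - 1) : witnessStep hn .c q = q :=
  Function.update_of_ne (fun h => hq (congr_arg Fin.val h)) _ _

theorem witnessStep_c_last {q : Fin n} (hq : q.1 = n - 1) : (witnessStep hn .c q).1 = 1 := by
  have h : q = ⟨n - 1, Nat.sub_lt (by omega) one_pos⟩ := Fin.ext hq
  rw [h]
  simp [witnessStep]

theorem witnessStep_d_of_ne {q : Fin n} (hq : q.1 ≠ n - 1) : witnessStep hn .d q = q :=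
  Function.update_of_ne (fun h => hq (congr_arg Fin.val h)) _ _

theorem witnessStep_d_last {q : Fin n} (hq : q.1 = n - 1) : (witnessStep hn .d q).1 = 0 := by
  have h : q = ⟨n - 1, Nat.sub_lt (by omega) one_pos⟩ := Fin.ext hq
  rw [h]
  simp [witnessStep]

theorem witnessStep_e (q : Fin n) : (witnessStep hn .e q).1 = 1 := rfl

theorem witnessStep_mem_fixOrConst (x : Letter) :
    witnessStep hn x ∈ fixOrConst (⟨0, by omega⟩ : Fin n) := by
  cases x
  · left; ext; simp [val_witnessStep_a]
  · left
    exact Equiv.swap_apply_of_ne_of_ne (by simp) (by simp)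
  · left; exact witnessStep_c_of_ne hn (by simp; omega)
  · left; exact witnessStep_d_of_ne hn (by simp; omega)
  · right; exact ⟨_, rfl⟩

end Steps

/-- The witness DFA with its letters renamed by `ρ`; a dialect of the witness is of this form. -/
def witnessComap (n : ℕ) (hn : 4 ≤ n) {β : Type*} (ρ : β → Letter) : DFA β (Fin n) :=
  (witnessDFA n hn).comap ρ

section Comap

variable {n : ℕ} {hn : 4 ≤ n} {β : Type*} {ρ : β → Letter}

theorem witnessComap_step (q : Fin n) (x : β) :
    (witnessComap n hn ρ).step q x = witnessStep hn (ρ x) q := rfl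

theorem witnessComap_start : ((witnessComap n hn ρ).start) = ⟨0, by omega⟩ := rfl

theorem witnessComap_mem_accept {q : Fin n} :
    q ∈ (witnessComap n hn ρ).accept ↔ q.1 = n - 1 :=
  ⟨fun h => congr_arg Fin.val h, fun h => Fin.ext h⟩

theorem mem_acceptsFrom_witnessComap {q : Fin n} {w : List β} :
    w ∈ (witnessComap n hn ρ).acceptsFrom q ↔
      ((witnessComap n hn ρ).evalFrom q w).1 = n - 1 :=
  witnessComap_mem_accept (hn := hn) (ρ := ρ)

theorem mem_accepts_witnessComap {w : List β} :
    w ∈ (witnessComap n hn ρ).accepts ↔ w.map ρ ∈ witness n hn := by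
  rw [witnessComap, DFA.accepts_comap]; rfl

theorem witnessComap_evalFrom_replicate (q : Fin n) (x : β) (k : ℕ) :
    (witnessComap n hn ρ).evalFrom q (List.replicate k x) = (witnessStep hn (ρ x))^[k] q :=
  DFA.evalFrom_replicate _ _ _ _

theorem fixOrConst_comp {Q : Type*} {z : Q} {f g : Q → Q} (hf : f ∈ fixOrConst z)
    (hg : g ∈ fixOrConst z) : g ∘ f ∈ fixOrConst z := by
  rcases hf with hf | ⟨r, rfl⟩
  · rcases hg with hg | ⟨s, rfl⟩
    · left; rw [Function.comp_apply, hf, hg]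
    · right; exact ⟨s, rfl⟩
  · right; exact ⟨g r, rfl⟩

theorem witnessComap_evalFrom_mem_fixOrConst (w : List β) :
    (fun q => (witnessComap n hn ρ).evalFrom q w) ∈ fixOrConst (⟨0, by omega⟩ : Fin n) := by
  induction w with
  | nil => exact Or.inl rfl
  | cons x w ih => exact fixOrConst_comp (witnessStep_mem_fixOrConst hn (ρ x)) ih

/-- A word fixing the initial state is not accepted from it, since that state is not final; any
other word is constant, so the starting state is irrelevant. -/
theorem witnessComap_start_le (q : Fin n) :
    (witnessComap n hn ρ).acceptsFrom (witnessComap n hn ρ).start ≤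
      (witnessComap n hn ρ).acceptsFrom q := by
  intro w hw
  have hw' : ((witnessComap n hn ρ).evalFrom ⟨0, by omega⟩ w).1 = n - 1 :=
    mem_acceptsFrom_witnessComap.1 hw
  have goal : ((witnessComap n hn ρ).evalFrom q w).1 = n - 1 := by
    rcases witnessComap_evalFrom_mem_fixOrConst (hn := hn) (ρ := ρ) w with h | ⟨r, hr⟩
    · simp only at h
      rw [h] at hw'
      simp only at hw'
      omega
    · rw [← hw', congr_fun hr q, ← congr_fun hr ⟨0, by omega⟩]
  exact mem_acceptsFrom_witnessComap.2 goal

theorem witnessComap_evalFrom_e_a {a e : β} (ha : ρ a = .a) (he : ρ e = .e) (q : Fin n) {k : ℕ}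
    (hk : 1 + k < n) :
    ((witnessComap n hn ρ).evalFrom q (e :: List.replicate k a)).1 = 1 + k := by
  rw [DFA.evalFrom_cons, witnessComap_step, he, witnessComap_evalFrom_replicate, ha,
    val_iterate_witnessStep_a hn (by rw [witnessStep_e]) (by rw [witnessStep_e]; exact hk),
    witnessStep_e]

theorem exists_evalFrom_eq {a e : β} (ha : ρ a = .a) (he : ρ e = .e) (q : Fin n) {p : Fin n}
    (hp : 1 ≤ p.1) : ∃ w : List β, (witnessComap n hn ρ).evalFrom q w = p :=
  ⟨e :: List.replicate (p.1 - 1) a, Fin.ext (by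
    have := p.2
    rw [witnessComap_evalFrom_e_a ha he q (by omega)]; omega)⟩

/-- Powers of `a` are injective, so each non-initial state has a power of `a` accepted from it and
from no other state. -/
theorem eq_of_replicate_mem {a : β} (ha : ρ a = .a) {p q : Fin n} (hp : 1 ≤ p.1)
    (h : List.replicate (n - 1 - p.1) a ∈ (witnessComap n hn ρ).acceptsFrom q) : p = q := by
  have := p.2
  rw [mem_acceptsFrom_witnessComap, witnessComap_evalFrom_replicate, ha] at h
  refine (witnessStep_a_injective hn).iterate (n - 1 - p.1) (Fin.ext ?_)
  rw [val_iterate_witnessStep_a hn hp (by omega), h]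
  omega

theorem replicate_mem_acceptsFrom {a : β} (ha : ρ a = .a) {p : Fin n} (hp : 1 ≤ p.1) :
    List.replicate (n - 1 - p.1) a ∈ (witnessComap n hn ρ).acceptsFrom p := by
  have := p.2
  rw [mem_acceptsFrom_witnessComap, witnessComap_evalFrom_replicate, ha,
    val_iterate_witnessStep_a hn hp (by omega)]
  omega

theorem witnessComap_isMinimal {a e : β} (ha : ρ a = .a) (he : ρ e = .e) :
    (witnessComap n hn ρ).IsMinimal := by
  constructor
  · intro p
    by_cases hp : 1 ≤ p.1
    · exact exists_evalFrom_eq ha he _ hp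
    · refine ⟨[], Fin.ext ?_⟩
      change 0 = p.1
      omega
  · intro p q h
    by_cases hp : 1 ≤ p.1
    · exact eq_of_replicate_mem ha hp (h ▸ replicate_mem_acceptsFrom ha hp)
    · by_cases hq : 1 ≤ q.1
      · exact (eq_of_replicate_mem ha hq (h.symm ▸ replicate_mem_acceptsFrom ha hq)).symm
      · ext; omega

theorem witnessComap_complexity {a e : β} (ha : ρ a = .a) (he : ρ e = .e) :
    (witnessComap n hn ρ).accepts.complexity = n := by
  rw [(witnessComap_isMinimal ha he).complexity, ENat.card_eq_coe_fintype_card, Fintype.card_fin]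

theorem witnessComap_isLeftIdeal {a e : β} (ha : ρ a = .a) (he : ρ e = .e) :
    (witnessComap n hn ρ).accepts.IsLeftIdeal := by
  refine isLeftIdeal_of_le_leftQuotient ⟨e :: List.replicate (n - 2) a, ?_⟩ fun u => ?_
  · refine mem_acceptsFrom_witnessComap.2 ?_
    rw [witnessComap_evalFrom_e_a ha he _ (by omega)]
    omega
  · rw [leftQuotient_accepts_apply]
    exact witnessComap_start_le _

/-- The letter `d` leads from the final state back to the initial one, so every state reaches every
other. -/
theorem complexity_quotient_witnessComap {a d e : β} (ha : ρ a = .a) (hd : ρ d = .d)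
    (he : ρ e = .e) {q : Language β} (hq : q ∈ (witnessComap n hn ρ).accepts.quotients) :
    q.complexity = n := by
  have hmin := witnessComap_isMinimal (hn := hn) ha he
  rw [hmin.quotients] at hq
  obtain ⟨s, rfl⟩ := hq
  rw [DFA.complexity_acceptsFrom hmin, ENat.card_eq_coe_fintype_card, Fintype.card_fin]
  intro p
  by_cases hp : 1 ≤ p.1
  · exact exists_evalFrom_eq ha he _ hp
  · refine ⟨e :: List.replicate (n - 2) a ++ [d], Fin.ext ?_⟩
    rw [DFA.evalFrom_append_singleton, witnessComap_step, hd, witnessStep_d_last]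
    · omega
    · rw [witnessComap_evalFrom_e_a ha he _ (by omega)]
      omega

end Comap

theorem witnessComap_mem {n : ℕ} {hn : 4 ≤ n} {β : Type} {ρ : β → Letter} {a e : β}
    (ha : ρ a = .a) (he : ρ e = .e) :
    (witnessComap n hn ρ).accepts ∈ ofComplexity RegularLeftIdeal n β :=
  ⟨⟨⟨Fin n, inferInstance, witnessComap n hn ρ, rfl⟩, witnessComap_isLeftIdeal ha he⟩,
    witnessComap_complexity ha he⟩

end MostComplex

/-- A set closed under an injective self-map of a finite type is closed under its inverse. -/
theorem Set.MapsTo.mem_of_apply_mem {T : Type*} [Finite T] {f : T → T} {R : Set T}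
    (h : Set.MapsTo f R R) (hf : Function.Injective f) {x : T} (hx : f x ∈ R) : x ∈ R := by
  have hinj : Function.Injective (h.restrict f R R) := fun a b hab =>
    Subtype.ext (hf (congr_arg Subtype.val hab))
  obtain ⟨y, hy⟩ := Finite.surjective_of_injective hinj ⟨f x, hx⟩
  have : y.1 = x := hf (congr_arg Subtype.val hy)
  exact this ▸ y.2

namespace MostComplex

/-! ### Accepting sets of the witness -/

section Atoms

variable {n : ℕ} {hn : 4 ≤ n} {β : Type*} {ρ : β → Letter}

theorem preimage_mem_range_acceptingStates (x : β) {S : Set (Fin n)}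
    (hS : S ∈ Set.range (witnessComap n hn ρ).acceptingStates) :
    witnessStep hn (ρ x) ⁻¹' S ∈ Set.range (witnessComap n hn ρ).acceptingStates := by
  obtain ⟨w, rfl⟩ := hS
  exact ⟨x :: w, rfl⟩

/-- Prepending a letter takes preimages; since `a` is a permutation of a finite set, closure under
its preimage gives closure under its image. -/
theorem image_a_mem_range_acceptingStates {a : β} (ha : ρ a = .a) {S : Set (Fin n)}
    (hS : S ∈ Set.range (witnessComap n hn ρ).acceptingStates) :
    witnessStep hn .a '' S ∈ Set.range (witnessComap n hn ρ).acceptingStates := by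
  have hmaps : Set.MapsTo (fun S : Set (Fin n) => witnessStep hn .a ⁻¹' S)
      (Set.range (witnessComap n hn ρ).acceptingStates)
      (Set.range (witnessComap n hn ρ).acceptingStates) := fun S hS =>
    ha ▸ preimage_mem_range_acceptingStates a hS
  refine hmaps.mem_of_apply_mem
    (Set.preimage_injective.2 (witnessStep_a_bijective hn).surjective) ?_
  simpa only [Set.preimage_image_eq _ (witnessStep_a_injective hn)] using hS

/-- The set `{n-1}` belongs to the empty word and rotates to `{1}`. Taking the preimage under `c`
adds `n-1` because `c` sends it to `1`; one rotation by `a` then lengthens the segment by one. -/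
theorem initial_segment_mem_range_acceptingStates {a c : β} (ha : ρ a = .a) (hc : ρ c = .c)
    {k : ℕ} (hk : 1 ≤ k) (hkn : k < n) :
    {q : Fin n | 1 ≤ q.1 ∧ q.1 ≤ k} ∈ Set.range (witnessComap n hn ρ).acceptingStates := by
  induction k, hk using Nat.le_induction with
  | base =>
    have h0 : {q : Fin n | q.1 = n - 1} ∈ Set.range (witnessComap n hn ρ).acceptingStates :=
      ⟨[], by ext q; exact mem_acceptsFrom_witnessComap⟩
    convert image_a_mem_range_acceptingStates ha h0 using 1
    ext q
    simp only [Set.mem_ofPred_eq, Set.mem_image]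
    constructor
    · rintro ⟨h1, h2⟩
      refine ⟨⟨n - 1, by omega⟩, rfl, Fin.ext ?_⟩
      rw [val_witnessStep_a]
      simp only
      split_ifs <;> omega
    · rintro ⟨p, hp, rfl⟩
      rw [val_witnessStep_a]
      split_ifs <;> omega
  | succ k hk ih =>
    have h0 := image_a_mem_range_acceptingStates ha
      (preimage_mem_range_acceptingStates c (ih (by omega)))
    rw [hc] at h0
    convert h0 using 1
    ext q
    simp only [Set.mem_ofPred_eq, Set.mem_image, Set.mem_preimage]
    constructor
    · rintro ⟨h1, h2⟩
      by_cases hq : q.1 = 1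
      · refine ⟨⟨n - 1, by omega⟩, ?_, Fin.ext ?_⟩
        · rw [witnessStep_c_last hn rfl]; omega
        · rw [val_witnessStep_a]
          simp only
          split_ifs <;> omega
      · refine ⟨⟨q.1 - 1, by omega⟩, ?_, Fin.ext ?_⟩
        · rw [witnessStep_c_of_ne hn (by simp only; omega)]
          simp only
          omega
        · rw [val_witnessStep_a]
          simp only
          split_ifs <;> omega
    · rintro ⟨p, hp, rfl⟩
      rw [val_witnessStep_a]
      by_cases h : p.1 = n - 1
      · split_ifs <;> omega
      · rw [witnessStep_c_of_ne hn h] at hp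
        split_ifs <;> omega

/-- The preimage under `d` removes `n-1`, which `d` sends to `0 ∉ S`; conjugating by `a^k` removes
any other non-initial state. -/
theorem sdiff_singleton_mem_range_acceptingStates {a d : β} (ha : ρ a = .a) (hd : ρ d = .d)
    {k : ℕ} (hk : k + 1 < n) {S : Set (Fin n)} (h0 : ∀ q ∈ S, q.1 ≠ 0)
    (hS : S ∈ Set.range (witnessComap n hn ρ).acceptingStates) :
    {q ∈ S | q.1 + k ≠ n - 1} ∈ Set.range (witnessComap n hn ρ).acceptingStates := by
  induction k generalizing S with
  | zero =>
    have h := preimage_mem_range_acceptingStates d hS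
    rw [hd] at h
    convert h using 1
    ext q
    simp only [Set.mem_ofPred_eq, Set.mem_preimage]
    by_cases hq : q.1 = n - 1
    · constructor
      · rintro ⟨-, h2⟩; omega
      · intro h; exact absurd (witnessStep_d_last hn hq) (h0 _ h)
    · rw [witnessStep_d_of_ne hn hq]
      exact ⟨fun h => h.1, fun h => ⟨h, by omega⟩⟩
  | succ k ih =>
    have h := preimage_mem_range_acceptingStates a
      (ih (by omega) ?_ (image_a_mem_range_acceptingStates ha hS))
    · rw [ha] at h
      convert h using 1
      ext q
      simp only [Set.mem_ofPred_eq, Set.mem_preimage, (witnessStep_a_injective hn).mem_set_image]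
      refine and_congr_right fun hq => ?_
      have := h0 q hq
      rw [val_witnessStep_a]
      split_ifs <;> omega
    · rintro _ ⟨q, hq, rfl⟩
      have := h0 q hq
      rw [val_witnessStep_a]
      split_ifs <;> omega

theorem mem_range_acceptingStates {a c d : β} (ha : ρ a = .a) (hc : ρ c = .c) (hd : ρ d = .d)
    {S : Set (Fin n)} (h0 : (witnessComap n hn ρ).start ∉ S) :
    ∃ x, (witnessComap n hn ρ).acceptingStates x = S := by
  -- Start from the set of all non-initial states and delete unwanted ones one at a time.
  have key : ∀ D : Finset (Fin n), {q : Fin n | 1 ≤ q.1 ∧ q ∉ D} ∈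
      Set.range (witnessComap n hn ρ).acceptingStates := by
    intro D
    induction D using Finset.induction_on with
    | empty =>
      convert initial_segment_mem_range_acceptingStates (hn := hn) ha hc
        (show 1 ≤ n - 1 by omega) (by omega) using 1
      ext q
      have := q.2
      simp only [Finset.notMem_empty, not_false_eq_true, and_true, Set.mem_ofPred_eq]
      omega
    | insert p D _ ih =>
      by_cases hp : p.1 = 0
      · convert ih using 1
        ext q
        simp only [Finset.mem_insert, not_or, Set.mem_ofPred_eq]
        refine and_congr_right fun hq => ⟨fun h => h.2, fun h => ⟨?_, h⟩⟩
        rintro rfl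
        omega
      · have hpn := p.2
        convert sdiff_singleton_mem_range_acceptingStates ha hd
          (show n - 1 - p.1 + 1 < n by omega) ?_ ih using 1
        · ext q
          simp only [Finset.mem_insert, not_or, Set.mem_ofPred_eq, Fin.ext_iff]
          constructor
          · rintro ⟨h1, h2, h3⟩
            exact ⟨⟨h1, h3⟩, by omega⟩
          · rintro ⟨⟨h1, h3⟩, h2⟩
            exact ⟨h1, by omega, h3⟩
        · rintro q ⟨hq, -⟩
          omega
  classical
  convert key Sᶜ.toFinset
  rw [Set.mem_range]
  have : S = {q : Fin n | 1 ≤ q.1 ∧ q ∉ Sᶜ.toFinset} := by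
    ext q
    simp only [Set.mem_toFinset, Set.mem_compl_iff, not_not, Set.mem_ofPred_eq]
    refine ⟨fun hq => ⟨?_, hq⟩, fun h => h.2⟩
    by_contra hlt
    refine h0 ?_
    have : (witnessComap n hn ρ).start = q := Fin.ext (by rw [witnessComap_start]; simp only; omega)
    rwa [this]
  rw [← this]

theorem encard_atoms_witnessComap {a c d e : β} (ha : ρ a = .a) (hc : ρ c = .c)
    (hd : ρ d = .d) (he : ρ e = .e) :
    (witnessComap n hn ρ).accepts.atoms.encard = ((2 ^ (n - 1) + 1 : ℕ) : ℕ∞) := by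
  have hmin := witnessComap_isMinimal (hn := hn) ha he
  have hcard := Set.ncard_notMem_or_univ (witnessComap n hn ρ).start
  rw [Fintype.card_fin] at hcard
  rw [hmin.encard_atoms, ← hcard, (Set.toFinite _).cast_ncard_eq]
  congr 1
  ext S
  constructor
  · rintro ⟨x, rfl⟩
    exact DFA.acceptingStates_mem witnessComap_start_le x
  · rintro (h | rfl)
    · exact mem_range_acceptingStates ha hc hd h
    · refine ⟨e :: List.replicate (n - 2) a, Set.eq_univ_of_forall fun q => ?_⟩
      refine mem_acceptsFrom_witnessComap.2 ?_
      rw [witnessComap_evalFrom_e_a ha he q (by omega)]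
      omega

end Atoms

/-! ### The transition semigroup and the atoms of the witness -/

section Semigroup

variable {n : ℕ} {hn : 4 ≤ n} {β : Type*} {ρ : β → Letter}

/-- The transformations by all words. -/
def wordMaps (n : ℕ) (hn : 4 ≤ n) (ρ : β → Letter) : Set (Fin n → Fin n) :=
  Set.range fun (w : List β) q => (witnessComap n hn ρ).evalFrom q w

theorem wordMaps_comp {f g : Fin n → Fin n} (hf : f ∈ wordMaps n hn ρ)
    (hg : g ∈ wordMaps n hn ρ) : g ∘ f ∈ wordMaps n hn ρ := by
  obtain ⟨u, rfl⟩ := hf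
  obtain ⟨v, rfl⟩ := hg
  exact ⟨u ++ v, funext fun q => DFA.evalFrom_append _ _ _ _⟩

theorem witnessStep_mem_wordMaps (x : β) : witnessStep hn (ρ x) ∈ wordMaps n hn ρ := ⟨[x], rfl⟩

/-- Conjugation by `a`, without a word for its inverse: composing with `a` permutes the finite set
of word maps, so `a` can be cancelled. -/
theorem swap_apply_a_mem_wordMaps {a : β} (ha : ρ a = .a) {i j : Fin n}
    (h : ⇑(Equiv.swap i j) ∈ wordMaps n hn ρ) :
    ⇑(Equiv.swap (witnessStep hn .a i) (witnessStep hn .a j)) ∈ wordMaps n hn ρ := by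
  have hA : witnessStep hn .a ∈ wordMaps n hn ρ := ha ▸ witnessStep_mem_wordMaps a
  have hmaps : Set.MapsTo (fun f : Fin n → Fin n => f ∘ witnessStep hn .a)
      (wordMaps n hn ρ) (wordMaps n hn ρ) := fun f hf => wordMaps_comp hA hf
  refine hmaps.mem_of_apply_mem
    (witnessStep_a_bijective hn).surjective.injective_comp_right ?_
  have : ⇑(Equiv.swap (witnessStep hn .a i) (witnessStep hn .a j)) ∘ witnessStep hn .a
      = witnessStep hn .a ∘ Equiv.swap i j := by
    funext q
    exact ((witnessStep_a_injective hn).map_swap i j q).symm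
  simp only [this]
  exact wordMaps_comp h hA

theorem swap_adjacent_mem_wordMaps {a b : β} (ha : ρ a = .a) (hb : ρ b = .b) {i : ℕ}
    (hi : 1 ≤ i) (hin : i + 1 < n) :
    ⇑(Equiv.swap (⟨i, by omega⟩ : Fin n) ⟨i + 1, hin⟩) ∈ wordMaps n hn ρ := by
  induction i, hi using Nat.le_induction with
  | base =>
    have : witnessStep hn (ρ b) ∈ wordMaps n hn ρ := witnessStep_mem_wordMaps b
    rw [hb] at this
    exact this
  | succ i hi ih =>
    convert swap_apply_a_mem_wordMaps ha (ih (by omega)) using 3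
    · ext; rw [val_witnessStep_a]; simp only; split_ifs <;> omega
    · ext; rw [val_witnessStep_a]; simp only; split_ifs <;> omega

theorem swap_mem_wordMaps {a b : β} (ha : ρ a = .a) (hb : ρ b = .b) {i j : Fin n}
    (hi : 1 ≤ i.1) (hj : 1 ≤ j.1) : ⇑(Equiv.swap i j) ∈ wordMaps n hn ρ := by
  have key : ∀ (k : ℕ) (hk : k < n) (i : Fin n), 1 ≤ i.1 → i.1 < k →
      ⇑(Equiv.swap i ⟨k, hk⟩) ∈ wordMaps n hn ρ := by
    intro k
    induction k with
    | zero => intro _ i _ h; omega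
    | succ k ih =>
      intro hk i hi hik
      by_cases hik' : i.1 = k
      · have := swap_adjacent_mem_wordMaps (hn := hn) ha hb hi (show i.1 + 1 < n by omega)
        convert this using 3
        ext; simp only; omega
      · have h1 := ih (by omega) i hi (by omega)
        have h2 := swap_adjacent_mem_wordMaps (hn := hn) ha hb (show 1 ≤ k by omega) hk
        have h3 : Equiv.swap (⟨k, by omega⟩ : Fin n) ⟨k + 1, hk⟩ * Equiv.swap i ⟨k, by omega⟩ *
            Equiv.swap ⟨k, by omega⟩ ⟨k + 1, hk⟩ = Equiv.swap ⟨k + 1, hk⟩ i := by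
          apply Equiv.swap_mul_swap_mul_swap
          · intro h; exact hik' (congr_arg Fin.val h)
          · intro h; have := congr_arg Fin.val h; simp only at this; omega
        rw [Equiv.swap_comm, ← h3, Equiv.Perm.coe_mul, Equiv.Perm.coe_mul]
        exact wordMaps_comp h2 (wordMaps_comp h1 h2)
  rcases lt_trichotomy i.1 j.1 with h | h | h
  · exact key j.1 j.2 i hi h
  · have : i = j := Fin.ext h
    subst this
    rw [Equiv.swap_self]
    exact ⟨[], rfl⟩
  · rw [Equiv.swap_comm]
    exact key i.1 i.2 j hj h

/-- Following `t` by the transposition of `x` and `t x` makes `x` a fixed point and disturbs no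
other; induct on the number of moved points. -/
theorem injective_mem_wordMaps {a b : β} (ha : ρ a = .a) (hb : ρ b = .b) {t : Fin n → Fin n}
    (ht : Function.Injective t) (h0 : ∀ q : Fin n, q.1 = 0 → t q = q) : t ∈ wordMaps n hn ρ := by
  induction hk : {q | t q ≠ q}.ncard using Nat.strong_induction_on generalizing t with
  | _ k ih =>
    by_cases hid : ∀ q, t q = q
    · exact ⟨[], funext fun q => (hid q).symm⟩
    push Not at hid
    obtain ⟨x, hx⟩ := hid
    have hx0 : 1 ≤ x.1 := by
      by_contra h; exact hx (h0 x (by omega))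
    have htx0 : 1 ≤ (t x).1 := by
      by_contra h
      exact hx (ht (h0 _ (by omega)))
    set s := Equiv.swap x (t x) with hs
    have hfix : ∀ q, t q = q → (s ∘ t) q = q := by
      intro q hq
      rw [Function.comp_apply, hq]
      refine Equiv.swap_apply_of_ne_of_ne ?_ ?_
      · rintro rfl; exact hx hq
      · rintro rfl; exact hx (ht hq)
    have hlt : {q | (s ∘ t) q ≠ q}.ncard < k := by
      rw [← hk]
      refine Set.ncard_lt_ncard ⟨fun q hq hq' => hq (hfix q hq'), fun h => ?_⟩ (Set.toFinite _)
      exact h hx (Equiv.swap_apply_right _ _)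
    have hmem := ih _ hlt (s.injective.comp ht) (fun q hq => hfix q (h0 q hq)) rfl
    have : t = s ∘ (s ∘ t) := by
      funext q; simp [hs]
    rw [this]
    exact wordMaps_comp hmem (swap_mem_wordMaps ha hb hx0 htx0)

theorem update_conj_mem_wordMaps {p q : Fin n} (s : Equiv.Perm (Fin n))
    (hs : ⇑s ∈ wordMaps n hn ρ) (hs' : ⇑s.symm ∈ wordMaps n hn ρ)
    (h : Function.update id p q ∈ wordMaps n hn ρ) :
    Function.update id (s p) (s q) ∈ wordMaps n hn ρ := by
  have : Function.update id (s p) (s q) = s ∘ (Function.update id p q ∘ s.symm) := by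
    funext r
    by_cases hr : r = s p
    · subst hr; simp
    · have : s.symm r ≠ p := fun h => hr (by rw [← h]; simp)
      simp [Function.update_of_ne hr, Function.update_of_ne this]
  rw [this]
  exact wordMaps_comp (wordMaps_comp hs' h) hs

/-- The letters `d` and `c` send the last state to `0` and to `1` and fix the rest; conjugating by
transpositions of non-initial states gives every target and then every source. -/
theorem update_mem_wordMaps {a b c d : β} (ha : ρ a = .a) (hb : ρ b = .b) (hc : ρ c = .c)
    (hd : ρ d = .d) {p q : Fin n} (hp : 1 ≤ p.1) (hpq : p ≠ q) :
    Function.update id p q ∈ wordMaps n hn ρ := by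
  have hsw : ∀ {i j : Fin n} {p q : Fin n}, 1 ≤ i.1 → 1 ≤ j.1 →
      Function.update id p q ∈ wordMaps n hn ρ →
      Function.update id (Equiv.swap i j p) (Equiv.swap i j q) ∈ wordMaps n hn ρ :=
    fun hi hj h => update_conj_mem_wordMaps _ (swap_mem_wordMaps ha hb hi hj)
      (by rw [Equiv.symm_swap]; exact swap_mem_wordMaps ha hb hi hj) h
  set l : Fin n := ⟨n - 1, by omega⟩ with hl
  have hl1 : 1 ≤ l.1 := by simp only [hl]; omega
  have hlast : ∀ q : Fin n, q ≠ l → Function.update id l q ∈ wordMaps n hn ρ := by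
    intro q hq
    by_cases hq0 : q.1 = 0
    · have h := witnessStep_mem_wordMaps (hn := hn) (ρ := ρ) d
      rw [hd] at h
      have : q = ⟨0, by omega⟩ := Fin.ext hq0
      rw [this]
      exact h
    · have h := witnessStep_mem_wordMaps (hn := hn) (ρ := ρ) c
      rw [hc] at h
      have h1 := hsw (i := ⟨1, by omega⟩) (j := q) (by simp) (by omega) h
      rw [Equiv.swap_apply_left, Equiv.swap_apply_of_ne_of_ne] at h1
      · exact h1
      · intro h; have := congr_arg Fin.val h; simp only at this; omega
      · exact hq.symm
  have h1 := hsw (i := p) (j := l) hp hl1 (hlast (Equiv.swap p l q) fun h => ?_)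
  · rwa [Equiv.swap_apply_right, Equiv.swap_apply_self] at h1
  · have := congr_arg (Equiv.swap p l) h
    rw [Equiv.swap_apply_self, Equiv.swap_apply_right] at this
    exact hpq this.symm

/-- If `t p = t q`, then `t` factors as the merge of `p` into `q` followed by `t` altered at `p` to
take a missed value `r`. The altered map has a larger range, so induct on the number of missed
values. -/
theorem fixing_mem_wordMaps {a b c d : β} (ha : ρ a = .a) (hb : ρ b = .b) (hc : ρ c = .c)
    (hd : ρ d = .d) {t : Fin n → Fin n} (h0 : ∀ q : Fin n, q.1 = 0 → t q = q) :
    t ∈ wordMaps n hn ρ := by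
  induction hk : (Set.range t)ᶜ.ncard using Nat.strong_induction_on generalizing t with
  | _ k ih =>
    by_cases hinj : Function.Injective t
    · exact injective_mem_wordMaps ha hb hinj h0
    obtain ⟨r, hr⟩ : ∃ r, r ∉ Set.range t := by
      by_contra! h
      exact hinj (Finite.injective_iff_surjective.2 h)
    obtain ⟨p, q, hpq, ht, hp⟩ : ∃ p q, p ≠ q ∧ t p = t q ∧ 1 ≤ p.1 := by
      simp only [Function.Injective, not_forall] at hinj
      obtain ⟨p, q, ht, hpq⟩ := hinj
      by_cases hp : 1 ≤ p.1
      · exact ⟨p, q, hpq, ht, hp⟩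
      · refine ⟨q, p, Ne.symm hpq, ht.symm, ?_⟩
        by_contra hq
        exact hpq (Fin.ext (by omega))
    have hlt : (Set.range (Function.update t p r))ᶜ.ncard < k := by
      rw [← hk]
      refine Set.ncard_lt_ncard (compl_lt_compl_iff_lt.2 ⟨?_, fun h => ?_⟩) (Set.toFinite _)
      · rintro _ ⟨x, rfl⟩
        by_cases hx : x = p
        · exact ⟨q, by rw [Function.update_of_ne hpq.symm, hx, ht]⟩
        · exact ⟨x, Function.update_of_ne hx _ _⟩
      · exact hr (h ⟨p, Function.update_self _ _ _⟩)
    have hmem := ih _ hlt (fun x hx => by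
      rw [Function.update_of_ne (by rintro rfl; omega)]; exact h0 x hx) rfl
    have : t = Function.update t p r ∘ Function.update id p q := by
      funext x
      by_cases hx : x = p
      · subst hx; simp [Function.update_of_ne hpq.symm, ht]
      · simp [Function.update_of_ne hx]
    rw [this]
    exact wordMaps_comp (update_mem_wordMaps ha hb hc hd hp hpq) hmem

theorem transitions_witnessComap {a b c d e : β} (ha : ρ a = .a) (hb : ρ b = .b) (hc : ρ c = .c)
    (hd : ρ d = .d) (he : ρ e = .e) :
    (witnessComap n hn ρ).transitions = fixOrConst (witnessComap n hn ρ).start := by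
  ext t
  constructor
  · rintro ⟨w, rfl⟩
    exact witnessComap_evalFrom_mem_fixOrConst w.1
  · intro ht
    by_cases h0 : t (witnessComap n hn ρ).start = (witnessComap n hn ρ).start
    · obtain ⟨w, hw⟩ := fixing_mem_wordMaps (hn := hn) ha hb hc hd (t := t) fun q hq => by
        have : q = (witnessComap n hn ρ).start := Fin.ext hq
        rw [this, h0]
      -- The semigroup admits non-empty words only; `b` is an involution, so prefixing it twice does
      -- not change the action.
      refine ⟨⟨b :: b :: w, by simp⟩, ?_⟩
      rw [← hw]
      funext q
      simp only [DFA.evalFrom_cons, witnessComap_step, hb]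
      congr 1
      exact Equiv.swap_apply_self _ _ _
    · rcases ht with ht | ⟨r, rfl⟩
      · exact absurd ht h0
      · have hr : 1 ≤ r.1 := by
          by_contra h
          exact h0 (Fin.ext (by rw [witnessComap_start]; simp only; omega))
        have hrn := r.2
        refine ⟨⟨e :: List.replicate (r.1 - 1) a, by simp⟩, funext fun q => Fin.ext ?_⟩
        simp only
        rw [witnessComap_evalFrom_e_a ha he q (by omega)]
        omega

theorem syntacticSize_witnessComap {a b c d e : β} (ha : ρ a = .a) (hb : ρ b = .b)
    (hc : ρ c = .c) (hd : ρ d = .d) (he : ρ e = .e) :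
    (witnessComap n hn ρ).accepts.syntacticSize = ((n ^ (n - 1) + n - 1 : ℕ) : ℕ∞) := by
  have h := ncard_fixOrConst (witnessComap n hn ρ).start (by rw [Fintype.card_fin]; omega)
  rw [Fintype.card_fin] at h
  rw [(witnessComap_isMinimal ha he).syntacticSize, transitions_witnessComap ha hb hc hd he, ← h,
    (Set.toFinite _).cast_ncard_eq]

theorem complexity_atom_witnessComap {a b c d e : β} (ha : ρ a = .a) (hb : ρ b = .b)
    (hc : ρ c = .c) (hd : ρ d = .d) (he : ρ e = .e) {A : Language β}
    (hA : A ∈ (witnessComap n hn ρ).accepts.atoms) :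
    A.complexity =
      (atomBound n ((witnessComap n hn ρ).accepts.atomIndex A).ncard : ℕ∞) := by
  have hmin := witnessComap_isMinimal (hn := hn) ha he
  obtain ⟨x, rfl⟩ := hmin.mem_atoms.1 hA
  rw [hmin.ncard_atomIndex]
  have := DFA.complexity_atomAt_eq hmin witnessComap_start_le (by rw [Fintype.card_fin]; omega)
    (transitions_witnessComap ha hb hc hd he).ge
    (fun S hS => mem_range_acceptingStates ha hc hd hS) x
  rwa [Fintype.card_fin] at this

end Semigroup

end MostComplex

namespace MostComplex

/-! ### Star and product of the witness -/

section StarProduct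

variable {m n : ℕ} {hm : 4 ≤ m} {hn : 4 ≤ n} {β : Type*} {ρ : β → Letter} {a e : β}

theorem replicate_notMem_accepts (ha : ρ a = .a) (k : ℕ) :
    List.replicate k a ∉ (witnessComap n hn ρ).accepts := by
  intro h
  have h' : ((witnessComap n hn ρ).evalFrom ⟨0, by omega⟩ (List.replicate k a)).1 = n - 1 :=
    mem_acceptsFrom_witnessComap.1 h
  rw [witnessComap_evalFrom_replicate, ha, iterate_witnessStep_a_zero hn rfl] at h'
  simp only at h'
  omega

theorem complexity_kstar_witnessComap (ha : ρ a = .a) (he : ρ e = .e) :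
    ((witnessComap n hn ρ).accepts∗).complexity = ((n + 1 : ℕ) : ℕ∞) := by
  set K := (witnessComap n hn ρ).accepts with hK
  have hmin := witnessComap_isMinimal (hn := hn) ha he
  have hl : K.IsLeftIdeal := witnessComap_isLeftIdeal ha he
  have hnot : K∗ ∉ K.quotients := by
    rw [hmin.quotients]
    rintro ⟨q, hq⟩
    have hnil : ([] : List β) ∈ (witnessComap n hn ρ).acceptsFrom q := hq ▸ nil_mem_kstar K
    rw [mem_acceptsFrom_witnessComap, DFA.evalFrom_nil] at hnil
    -- A quotient containing the empty word belongs to the final state, from which the full cycle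
    -- `a^(n-1)` is accepted; no non-empty power of `a` lies in the star.
    have hmem : List.replicate (n - 1) a ∈ (witnessComap n hn ρ).acceptsFrom q := by
      rw [mem_acceptsFrom_witnessComap, witnessComap_evalFrom_replicate, ha,
        show n - 1 = (n - 2) + 1 by omega, Function.iterate_succ_apply]
      have h1 : (witnessStep hn .a q).1 = 1 := by
        rw [val_witnessStep_a]; split_ifs <;> omega
      rw [val_iterate_witnessStep_a hn h1.ge (by omega), h1]
      omega
    rw [hq, hl.mem_kstar] at hmem
    rcases hmem with h | h
    · have := congr_arg List.length h
      simp only [List.length_replicate, List.length_nil] at this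
      omega
    · exact replicate_notMem_accepts ha _ h
  have hq : (K∗).quotients = insert (K∗) K.quotients := by
    refine Set.Subset.antisymm ?_ (Set.insert_subset (self_mem_quotients _) ?_)
    · rintro _ ⟨w, rfl⟩
      by_cases hw : w = []
      · subst hw; exact Set.mem_insert _ _
      · rw [hl.leftQuotient_kstar hw]; exact Or.inr ⟨w, rfl⟩
    · rintro _ ⟨w, rfl⟩
      by_cases hw : w = []
      -- Because `a` fixes the initial state, `K` itself is the quotient of its star by `a`.
      · refine ⟨[a], ?_⟩
        rw [hl.leftQuotient_kstar (by simp), hw, hK, leftQuotient_accepts_apply,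
          leftQuotient_accepts_apply, DFA.eval_singleton, DFA.eval_nil, witnessComap_step, ha]
        congr 1
      · exact ⟨w, hl.leftQuotient_kstar hw⟩
  rw [complexity, hq, Set.encard_insert_of_notMem hnot, ← complexity,
    witnessComap_complexity ha he]
  norm_cast

theorem prefix_cons_replicate {s : List β} {k : ℕ} (h : s <+: e :: List.replicate k a) :
    s = [] ∨ ∃ j ≤ k, s = e :: List.replicate j a := by
  rw [List.prefix_cons_iff] at h
  rcases h with rfl | ⟨t, rfl, ht⟩
  · exact Or.inl rfl
  · obtain ⟨u, hu⟩ := ht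
    have := List.append_eq_replicate_iff.1 hu
    exact Or.inr ⟨t.length, by omega, by rw [← this.2.1]⟩

theorem nil_notMem_accepts : ([] : List β) ∉ (witnessComap n hn ρ).accepts := by
  intro h
  have h' := congr_arg Fin.val h
  change 0 = n - 1 at h'
  omega

theorem cons_replicate_mem_accepts_iff (ha : ρ a = .a) (he : ρ e = .e) {j : ℕ} (hj : 1 + j < n) :
    e :: List.replicate j a ∈ (witnessComap n hn ρ).accepts ↔ j = n - 2 := by
  change _ ∈ (witnessComap n hn ρ).acceptsFrom _ ↔ _
  rw [mem_acceptsFrom_witnessComap, witnessComap_evalFrom_e_a ha he _ hj]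
  omega

theorem acceptsFrom_mul_mem_quotients (ha : ρ a = .a) (he : ρ e = .e) {p : Fin m}
    (hp : p.1 ≠ m - 1) (K' : Language β) :
    (witnessComap m hm ρ).acceptsFrom p * K' ∈
      ((witnessComap m hm ρ).accepts * K').quotients := by
  have hpm := p.2
  by_cases h0 : 1 ≤ p.1
  · refine ⟨e :: List.replicate (p.1 - 1) a, ?_⟩
    rw [leftQuotient_mul_of_forall_prefix_notMem, leftQuotient_accepts_apply]
    · congr 2
      ext
      rw [DFA.eval_eq_evalFrom, witnessComap_evalFrom_e_a ha he _ (by omega)]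
      omega
    · intro s hs
      rcases prefix_cons_replicate hs with rfl | ⟨j, hj, rfl⟩
      · exact nil_notMem_accepts
      · rw [cons_replicate_mem_accepts_iff ha he (by omega)]
        omega
  · have : p = (witnessComap m hm ρ).start := Fin.ext (by rw [witnessComap_start]; simp only; omega)
    rw [this]
    exact self_mem_quotients _

theorem quotients_subset_quotients_mul (ha : ρ a = .a) (he : ρ e = .e) {K' : Language β}
    (hK' : K'.IsLeftIdeal) :
    K'.quotients ⊆ ((witnessComap m hm ρ).accepts * K').quotients := by
  rintro _ ⟨v, rfl⟩
  refine ⟨e :: List.replicate (m - 2) a ++ v, leftQuotient_mul_of_prefix_mem hK' ?_ ?_⟩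
  · rw [cons_replicate_mem_accepts_iff ha he (by omega)]
  · intro s hs hsK
    rcases prefix_cons_replicate hs with rfl | ⟨j, hj, rfl⟩
    · exact absurd hsK nil_notMem_accepts
    · rw [cons_replicate_mem_accepts_iff ha he (by omega)] at hsK
      rw [hsK]

theorem replicate_notMem_mul (ha : ρ a = .a) (L : Language β) (k : ℕ) :
    List.replicate k a ∉ L * (witnessComap n hn ρ).accepts := by
  rw [mem_mul]
  rintro ⟨u, -, v, hv, h⟩
  have := List.append_eq_replicate_iff.1 h
  rw [this.2.2] at hv
  exact replicate_notMem_accepts ha _ hv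

/-- The second factor is not a power of `a`, so it must contain the `e`; the first factor is then a
power of `a` of length at most `k`. -/
theorem exists_replicate_mem_of_mem_mul (ha : ρ a = .a) {L : Language β} {k l : ℕ}
    (h : List.replicate k a ++ e :: List.replicate l a ∈ L * (witnessComap n hn ρ).accepts) :
    ∃ i ≤ k, List.replicate i a ∈ L := by
  rw [mem_mul] at h
  obtain ⟨u, hu, v, hv, h⟩ := h
  rw [List.append_eq_append_iff] at h
  rcases h with ⟨s, hs, -⟩ | ⟨s, rfl, hs⟩
  · have := List.append_eq_replicate_iff.1 hs.symm
    exact ⟨u.length, by omega, by rwa [← this.2.1]⟩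
  · rcases s with _ | ⟨x, s⟩
    · exact ⟨k, le_rfl, by simpa using hu⟩
    · rw [List.cons_append, List.cons.injEq] at hs
      have := List.append_eq_replicate_iff.1 hs.2.symm
      rw [this.2.2] at hv
      exact absurd hv (replicate_notMem_accepts ha _)

theorem le_of_replicate_mem_acceptsFrom (ha : ρ a = .a) {q : Fin n} {i : ℕ}
    (h : List.replicate i a ∈ (witnessComap n hn ρ).acceptsFrom q) :
    1 ≤ q.1 ∧ n - 1 - q.1 ≤ i := by
  have := q.2
  rw [mem_acceptsFrom_witnessComap, witnessComap_evalFrom_replicate, ha] at h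
  have hq : 1 ≤ q.1 := by
    by_contra hq
    rw [iterate_witnessStep_a_zero hn (by omega)] at h
    omega
  refine ⟨hq, ?_⟩
  by_contra hlt
  rw [val_iterate_witnessStep_a hn hq (by omega)] at h
  omega

theorem complexity_mul_witnessComap (ha : ρ a = .a) (he : ρ e = .e) :
    ((witnessComap m hm ρ).accepts * (witnessComap n hn ρ).accepts).complexity
      = ((m + n - 1 : ℕ) : ℕ∞) := by
  set K := (witnessComap m hm ρ).accepts with hK
  set K' := (witnessComap n hn ρ).accepts with hK'
  have hmin' := witnessComap_isMinimal (hn := hn) ha he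
  refine le_antisymm ?_ ?_
  · have h1 : K.complexity = m := witnessComap_complexity ha he
    have h2 : K'.complexity = n := witnessComap_complexity ha he
    have hl : K.IsLeftIdeal := witnessComap_isLeftIdeal ha he
    have := hl.complexity_mul_le (witnessComap_isLeftIdeal ha he : K'.IsLeftIdeal)
    rw [h1, h2] at this
    refine this.trans (le_of_eq ?_)
    rw [show m + n - 1 = (m - 1) + n by omega]
    push_cast
    rfl
  · set s : Set (Fin m) := {p | p.1 ≠ m - 1} with hs
    have hscard : s.encard = ((m - 1 : ℕ) : ℕ∞) := by
      have : s = {(⟨m - 1, by omega⟩ : Fin m)}ᶜ := by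
        ext p; simp [hs, Fin.ext_iff]
      rw [← (Set.toFinite s).cast_ncard_eq, this, Set.ncard_compl, Set.ncard_singleton]
      simp
    have hmem : ∀ {p : Fin m}, 1 ≤ p.1 → List.replicate (m - 1 - p.1) a ++
        e :: List.replicate (n - 2) a ∈ (witnessComap m hm ρ).acceptsFrom p * K' := fun hp =>
      mem_mul.2 ⟨_, replicate_mem_acceptsFrom ha hp, _,
        (cons_replicate_mem_accepts_iff ha he (by omega)).2 rfl, rfl⟩
    -- The word `a^(m-1-p) e a^(n-2)` leaves only `m-1-p` letters before `e` for reaching the final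
    -- state, so it works only from states at or beyond `p`.
    have hle : ∀ {p p' : Fin m}, 1 ≤ p.1 → (witnessComap m hm ρ).acceptsFrom p * K'
        = (witnessComap m hm ρ).acceptsFrom p' * K' → 1 ≤ p'.1 ∧ p.1 ≤ p'.1 := by
      intro p p' hp h
      obtain ⟨i, hi, hmem⟩ := exists_replicate_mem_of_mem_mul ha (h ▸ hmem hp)
      have := le_of_replicate_mem_acceptsFrom ha hmem
      have := p.2
      exact ⟨by omega, by omega⟩
    have hinj : Function.Injective
        fun p : Fin m => (witnessComap m hm ρ).acceptsFrom p * K' := by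
      intro p p' h
      ext
      by_cases hp : 1 ≤ p.1
      · have h1 := hle hp h
        have h2 := hle h1.1 h.symm
        omega
      · by_cases hp' : 1 ≤ p'.1
        · have := hle hp' h.symm
          omega
        · omega
    have hdisj : Disjoint ((fun p : Fin m => (witnessComap m hm ρ).acceptsFrom p * K') '' s)
        K'.quotients := by
      rw [Set.disjoint_left]
      rintro _ ⟨p, hp, rfl⟩ hq
      rw [hmin'.quotients] at hq
      obtain ⟨q, hq⟩ := hq
      simp only at hq
      by_cases hq1 : 1 ≤ q.1
      -- The language of a non-initial state contains a power of `a`, which no product with `K'`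
      -- does.
      · exact replicate_notMem_mul ha _ _ (hq ▸ replicate_mem_acceptsFrom ha hq1)
      · have hq0 : q = (witnessComap n hn ρ).start :=
          Fin.ext (by rw [witnessComap_start]; simp only; omega)
        subst hq0
        have hw : e :: List.replicate (n - 2) a ∈ K' :=
          (cons_replicate_mem_accepts_iff ha he (by omega)).2 rfl
        have hw' : List.replicate 0 a ++ e :: List.replicate (n - 2) a ∈
            (witnessComap m hm ρ).acceptsFrom p * K' := hq ▸ hw
        obtain ⟨i, hi, hmem⟩ := exists_replicate_mem_of_mem_mul ha hw'
        have h1 := le_of_replicate_mem_acceptsFrom ha hmem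
        have h2 := p.2
        have h3 : p.1 ≠ m - 1 := hp
        omega
    have hsub : (fun p : Fin m => (witnessComap m hm ρ).acceptsFrom p * K') '' s ∪ K'.quotients ⊆
        (K * K').quotients := by
      refine Set.union_subset ?_
        (quotients_subset_quotients_mul ha he (witnessComap_isLeftIdeal ha he))
      rintro _ ⟨p, hp, rfl⟩
      exact acceptsFrom_mul_mem_quotients ha he hp K'
    refine le_trans (le_of_eq ?_) (Set.encard_le_encard hsub)
    rw [Set.encard_union_eq hdisj, hinj.encard_image, hscard, ← complexity,
      witnessComap_complexity ha he, show m + n - 1 = (m - 1) + n by omega, Nat.cast_add]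

end StarProduct

/-! ### Boolean operations on the witness -/

section Boolean

variable {m n : ℕ} {hm : 4 ≤ m} {hn : 4 ≤ n} {β : Type*} {ρ₁ ρ₂ : β → Letter} {a c e : β}

theorem exists_iterate_a_eq {p r : Fin m} (hp : 1 ≤ p.1) (hr : 1 ≤ r.1) :
    ∃ i, (witnessStep hm .a)^[i] p = r := by
  have h1 := p.2
  have h2 := r.2
  -- Go to the last state, wrap around to `1`, then advance to `r`.
  refine ⟨(r.1 - 1) + 1 + (m - 1 - p.1), Fin.ext ?_⟩
  rw [Function.iterate_add_apply, Function.iterate_add_apply, Function.iterate_one]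
  have h3 := val_iterate_witnessStep_a hm hp (k := m - 1 - p.1) (by omega)
  have h4 : (witnessStep hm .a ((witnessStep hm .a)^[m - 1 - p.1] p)).1 = 1 := by
    rw [val_witnessStep_a, h3]; split_ifs <;> omega
  rw [val_iterate_witnessStep_a hm h4.ge (by omega), h4]
  omega

/-- A power of `a` must bring `1` to the last state on the second side, while the state it brings to
the last one on the first side is not last itself. The exponent `n-2` works unless `a^(n-2)` fixes
the last state of the first DFA; a further full turn of `n-1` steps then shifts the preimage to
`m-2`. -/
theorem exists_synchronized_iterate (hm : 4 ≤ m) (hn : 4 ≤ n) :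
    ∃ (k : ℕ) (p : Fin m), 1 ≤ p.1 ∧ p.1 ≠ m - 1 ∧ ((witnessStep hm .a)^[k] p).1 = m - 1 ∧
      ∀ q : Fin n, q.1 = 1 → ((witnessStep hn .a)^[k] q).1 = n - 1 := by
  have hlast : ∀ q : Fin n, q.1 = 1 → ((witnessStep hn .a)^[n - 2] q).1 = n - 1 := by
    intro q hq
    rw [val_iterate_witnessStep_a hn hq.ge (by omega)]; omega
  obtain ⟨p, hp⟩ := ((witnessStep_a_bijective hm).iterate (n - 2)).surjective ⟨m - 1, by omega⟩
  have hp1 : 1 ≤ p.1 := by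
    by_contra h
    rw [iterate_witnessStep_a_zero hm (by omega)] at hp
    rw [hp] at h
    simp only at h
    omega
  by_cases hpm : p.1 = m - 1
  · have hpl : p = ⟨m - 1, by omega⟩ := Fin.ext hpm
    refine ⟨(n - 2) + ((n - 2) + 1), ⟨m - 2, by omega⟩, by simp only; omega,
      by simp only; omega, ?_, ?_⟩
    · have h1 : witnessStep hm .a ⟨m - 2, by omega⟩ = p := by
        ext; rw [val_witnessStep_a, hpm]; simp only; split_ifs <;> omega
      rw [Function.iterate_add_apply, Function.iterate_succ_apply, h1, hp, ← hpl, hp]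
    · intro q hq
      rw [add_comm (n - 2), Function.iterate_add_apply, Function.iterate_succ_apply]
      refine hlast _ ?_
      rw [val_witnessStep_a, hlast q hq]
      split_ifs <;> omega
  · exact ⟨n - 2, p, hp1, hpm, by rw [hp], hlast⟩

/-- Words `a^i c a^k` are used: on the second side `c` acts as `e`, so acceptance there depends on
`k` alone and can be prescribed. On the first side `c` only merges the last state with `1`, so a
suitable `i` keeps the pair apart. -/
theorem exists_separating_word (ha₁ : ρ₁ a = .a) (ha₂ : ρ₂ a = .a) (hc₁ : ρ₁ c = .c)
    (hc₂ : ρ₂ c = .e) {p p' : Fin m} (hpp : p ≠ p') (q q' : Fin n) (T : Prop) :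
    ∃ w : List β,
      ¬ (w ∈ (witnessComap m hm ρ₁).acceptsFrom p ↔ w ∈ (witnessComap m hm ρ₁).acceptsFrom p') ∧
      (w ∈ (witnessComap n hn ρ₂).acceptsFrom q ↔ T) ∧
      (w ∈ (witnessComap n hn ρ₂).acceptsFrom q' ↔ T) := by
  wlog hp : 1 ≤ p.1 generalizing p p' q q'
  · have hp' : 1 ≤ p'.1 := by
      by_contra h
      exact hpp (Fin.ext (by omega))
    obtain ⟨w, h1, h2, h3⟩ := this hpp.symm q q' hp'
    exact ⟨w, fun h => h1 h.symm, h2, h3⟩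
  have hA₁ : ∀ (u : Fin m) (i k : ℕ), (witnessComap m hm ρ₁).evalFrom u
      (List.replicate i a ++ c :: List.replicate k a)
        = (witnessStep hm .a)^[k] (witnessStep hm .c ((witnessStep hm .a)^[i] u)) := by
    intro u i k
    rw [DFA.evalFrom_append, DFA.evalFrom_cons, witnessComap_evalFrom_replicate,
      witnessComap_evalFrom_replicate, witnessComap_step, ha₁, hc₁]
  have hA₂ : ∀ (u : Fin n) (i k : ℕ), ∃ v : Fin n, v.1 = 1 ∧ (witnessComap n hn ρ₂).evalFrom u
      (List.replicate i a ++ c :: List.replicate k a) = (witnessStep hn .a)^[k] v := by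
    intro u i k
    refine ⟨witnessStep hn .e ((witnessStep hn .a)^[i] u), rfl, ?_⟩
    rw [DFA.evalFrom_append, DFA.evalFrom_cons, witnessComap_evalFrom_replicate,
      witnessComap_evalFrom_replicate, witnessComap_step, ha₂, hc₂]
  have hinj := fun k => (witnessStep_a_injective hm).iterate k
  -- it suffices to move one state to `r` and the other to a state not sent to `r` by `c`
  have main : ∀ (r : Fin m) (i k : ℕ) (u u' : Fin m), r.1 ≠ m - 1 →
      ((witnessStep hm .a)^[k] r).1 = m - 1 → (witnessStep hm .a)^[i] u = r →
      witnessStep hm .c ((witnessStep hm .a)^[i] u') ≠ r →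
      (List.replicate i a ++ c :: List.replicate k a) ∈
        (witnessComap m hm ρ₁).acceptsFrom u ∧
      (List.replicate i a ++ c :: List.replicate k a) ∉
        (witnessComap m hm ρ₁).acceptsFrom u' := by
    intro r i k u u' hr hk hu hu'
    rw [mem_acceptsFrom_witnessComap, mem_acceptsFrom_witnessComap, hA₁, hA₁, hu,
      witnessStep_c_of_ne hm hr]
    exact ⟨hk, fun h => hu' (hinj k (Fin.ext (h.trans hk.symm)))⟩
  by_cases hT : T
  · obtain ⟨k, r, hr1, hrm, hk, hk'⟩ := exists_synchronized_iterate hm hn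
    have hsecond : ∀ (u : Fin n) (i : ℕ), ((List.replicate i a ++ c :: List.replicate k a) ∈
        (witnessComap n hn ρ₂).acceptsFrom u ↔ T) := by
      intro u i
      rw [mem_acceptsFrom_witnessComap]
      obtain ⟨v, hv, h⟩ := hA₂ u i k
      rw [h]
      exact ⟨fun _ => hT, fun _ => hk' v hv⟩
    obtain ⟨i, hi⟩ := exists_iterate_a_eq (hm := hm) hp hr1
    have hne : (witnessStep hm .a)^[i] p' ≠ r := fun h => hpp (hinj i (hi.trans h.symm))
    -- Trouble arises only if the other state is last and `r = 1`; one more `a` brings that state to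
    -- `r` and the first one to `2`, so the roles are exchanged.
    by_cases hcr : witnessStep hm .c ((witnessStep hm .a)^[i] p') = r
    · have hlast : ((witnessStep hm .a)^[i] p').1 = m - 1 := by
        by_contra h
        rw [witnessStep_c_of_ne hm h] at hcr
        exact hne hcr
      have hr : r.1 = 1 := by rw [← hcr, witnessStep_c_last hm hlast]
      have h1 : (witnessStep hm .a)^[i + 1] p' = r := by
        ext
        rw [Function.iterate_succ_apply', val_witnessStep_a, hlast, hr]
        split_ifs <;> omega
      have h2 : ((witnessStep hm .a)^[i + 1] p).1 = 2 := by
        rw [Function.iterate_succ_apply', hi, val_witnessStep_a, hr]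
        split_ifs <;> omega
      obtain ⟨h3, h4⟩ := main r (i + 1) k p' p hrm hk h1 (by
        rw [witnessStep_c_of_ne hm (by omega)]
        intro h
        rw [h] at h2
        omega)
      exact ⟨_, fun h => h4 (h.2 h3), hsecond q _, hsecond q' _⟩
    · obtain ⟨h3, h4⟩ := main r i k p p' hrm hk hi hcr
      exact ⟨_, fun h => h4 (h.1 h3), hsecond q _, hsecond q' _⟩
  -- With `k = 1` the second side stops at `2`, not final as `n ≥ 4`; on the first side `r = m-2`
  -- differs from `1`, the image of the last state under `c`, as `m ≥ 4`.
  · have hr : 1 ≤ (⟨m - 2, by omega⟩ : Fin m).1 := by simp only; omega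
    obtain ⟨i, hi⟩ := exists_iterate_a_eq (hm := hm) hp hr
    have hne : (witnessStep hm .a)^[i] p' ≠ ⟨m - 2, by omega⟩ :=
      fun h => hpp (hinj i (hi.trans h.symm))
    have hsecond : ∀ u : Fin n, ((List.replicate i a ++ c :: List.replicate 1 a) ∈
        (witnessComap n hn ρ₂).acceptsFrom u ↔ T) := by
      intro u
      rw [mem_acceptsFrom_witnessComap]
      obtain ⟨v, hv, h⟩ := hA₂ u i 1
      rw [h]
      refine ⟨fun h => absurd h ?_, fun h => absurd h hT⟩
      rw [Function.iterate_one, val_witnessStep_a, hv]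
      split_ifs <;> omega
    obtain ⟨h3, h4⟩ := main ⟨m - 2, by omega⟩ i 1 p p' (by simp only; omega) (by
      rw [Function.iterate_one, val_witnessStep_a]; simp only; split_ifs <;> omega) hi (by
      intro h
      by_cases hl : ((witnessStep hm .a)^[i] p').1 = m - 1
      · have := witnessStep_c_last hm hl
        rw [h] at this
        simp only at this
        omega
      · rw [witnessStep_c_of_ne hm hl] at h
        exact hne h)
    exact ⟨_, fun h => h4 (h.1 h3), hsecond q, hsecond q'⟩

/-- Pairs with an initial component come from `c` or `e` followed by powers of `a`. Next come the
pairs with second component `1`, and the rest follow by acting with `a` on both sides. -/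
theorem exists_eval_pair_eq (ha₁ : ρ₁ a = .a) (ha₂ : ρ₂ a = .a) (hc₁ : ρ₁ c = .c)
    (hc₂ : ρ₂ c = .e) (he₁ : ρ₁ e = .e) (he₂ : ρ₂ e = .c) (p : Fin m) (q : Fin n) :
    ∃ w : List β,
      (witnessComap m hm ρ₁).eval w = p ∧ (witnessComap n hn ρ₂).eval w = q := by
  set R : Set (Fin m × Fin n) := Set.range fun w : List β =>
    ((witnessComap m hm ρ₁).eval w, (witnessComap n hn ρ₂).eval w) with hR
  suffices h : (p, q) ∈ R by
    obtain ⟨w, hw⟩ := h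
    exact ⟨w, (Prod.ext_iff.1 hw).1, (Prod.ext_iff.1 hw).2⟩
  have hstep : ∀ {p : Fin m} {q : Fin n} (x : β), (p, q) ∈ R →
      (witnessStep hm (ρ₁ x) p, witnessStep hn (ρ₂ x) q) ∈ R := by
    rintro p q x ⟨w, hw⟩
    refine ⟨w ++ [x], ?_⟩
    simp only [Prod.mk.injEq] at hw
    simp only [DFA.eval_append_singleton, hw.1, hw.2]
    rfl
  have hstepA : ∀ {p : Fin m} {q : Fin n}, (p, q) ∈ R →
      (witnessStep hm .a p, witnessStep hn .a q) ∈ R := fun h => by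
    simpa only [ha₁, ha₂] using hstep a h
  have hback : ∀ {p : Fin m} {q : Fin n},
      (witnessStep hm .a p, witnessStep hn .a q) ∈ R → (p, q) ∈ R := by
    intro p q h
    have hmaps : Set.MapsTo (Prod.map (witnessStep hm .a) (witnessStep hn .a)) R R := by
      rintro ⟨p, q⟩ h; exact hstepA h
    exact hmaps.mem_of_apply_mem
      ((witnessStep_a_injective hm).prodMap (witnessStep_a_injective hn)) h
  have hiter : ∀ {p : Fin m} {q : Fin n} (k : ℕ), (p, q) ∈ R →
      ((witnessStep hm .a)^[k] p, (witnessStep hn .a)^[k] q) ∈ R := by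
    intro p q k h
    induction k with
    | zero => exact h
    | succ k ih => rw [Function.iterate_succ_apply', Function.iterate_succ_apply']; exact hstepA ih
  set z : Fin m := ⟨0, by omega⟩ with hz
  set z' : Fin n := ⟨0, by omega⟩ with hz'
  have h00 : (z, z') ∈ R := ⟨[], rfl⟩
  have hleft : ∀ q : Fin n, (z, q) ∈ R := by
    intro q
    by_cases hq : 1 ≤ q.1
    · have h1 := hiter (q.1 - 1) (hstep c h00)
      have hqn := q.2
      rw [hc₁, hc₂, witnessStep_c_of_ne hm (by simp only [hz]; omega),
        iterate_witnessStep_a_zero hm rfl] at h1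
      convert h1 using 2
      ext
      rw [val_iterate_witnessStep_a hn (by rw [witnessStep_e]) (by rw [witnessStep_e]; omega),
        witnessStep_e]
      omega
    · convert h00
      ext; simp only [hz']; omega
  have hright : ∀ p : Fin m, (p, z') ∈ R := by
    intro p
    by_cases hp : 1 ≤ p.1
    · have h1 := hiter (p.1 - 1) (hstep e h00)
      have hpm := p.2
      rw [he₁, he₂, witnessStep_c_of_ne hn (by simp only [hz']; omega),
        iterate_witnessStep_a_zero hn rfl] at h1
      convert h1 using 2
      ext
      rw [val_iterate_witnessStep_a hm (by rw [witnessStep_e]) (by rw [witnessStep_e]; omega),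
        witnessStep_e]
      omega
    · convert h00
      ext; simp only [hz]; omega
  have hone : ∀ p : Fin m, (p, (⟨1, by omega⟩ : Fin n)) ∈ R := by
    intro p
    by_cases hp : p.1 = m - 1
    -- Here `c` would move the first component. The pair is obtained by undoing `a` from `(1, 2)`,
    -- which `e` produces from `(0, 2)`.
    · refine hback ?_
      have h1 := hstep e (hleft ⟨2, by omega⟩)
      rw [he₁, he₂, witnessStep_c_of_ne hn (by simp only; omega)] at h1
      convert h1 using 2
      · ext; rw [val_witnessStep_a, witnessStep_e]; split_ifs <;> omega
      · ext; rw [val_witnessStep_a]; simp only; split_ifs <;> omega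
    · have h1 := hstep c (hright p)
      rw [hc₁, hc₂, witnessStep_c_of_ne hm hp] at h1
      exact h1
  by_cases hq : 1 ≤ q.1
  · have key : ∀ k (_ : 1 ≤ k) (hk : k < n) (p : Fin m), (p, (⟨k, hk⟩ : Fin n)) ∈ R := by
      intro k hk1
      induction k, hk1 using Nat.le_induction with
      | base => intro _ p; exact hone p
      | succ k hk ih =>
        intro hkn p
        obtain ⟨p, rfl⟩ := (witnessStep_a_bijective hm).surjective p
        convert hstepA (ih (by omega) p) using 2
        ext; rw [val_witnessStep_a]; simp only; split_ifs <;> omega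
    exact key q.1 hq q.2 p
  · convert hright p
    ext; simp only [hz']; omega

theorem IsProper.exists_ne_left {f : Bool → Bool → Bool} (hf : IsProper f) :
    ∃ y, f true y ≠ f false y := by
  by_contra! h
  exact hf.2 ⟨f true, fun x y => by cases x; exacts [(h y).symm, rfl]⟩

theorem IsProper.exists_ne_right {f : Bool → Bool → Bool} (hf : IsProper f) :
    ∃ x, f x true ≠ f x false := by
  by_contra! h
  exact hf.1 ⟨fun x => f x true, fun x y => by cases y; exacts [(h x).symm, rfl]⟩

theorem mem_boolOp {f : Bool → Bool → Bool} {L L' : Language β} {w : List β} {x y : Bool}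
    (hx : w ∈ L ↔ x = true) (hy : w ∈ L' ↔ y = true) : w ∈ boolOp f L L' ↔ f x y = true := by
  classical
  change f (decide (w ∈ L)) (decide (w ∈ L')) = true ↔ _
  rw [show decide (w ∈ L) = x by simp [hx], show decide (w ∈ L') = y by simp [hy]]

theorem apply_ne_of_ne {g : Bool → Bool} (hg : g true ≠ g false) {x y : Bool} (hxy : x ≠ y)
    (h : g x = true ↔ g y = true) : False := by
  cases x <;> cases y <;> simp_all

theorem complexity_boolOp_witnessComap {f : Bool → Bool → Bool} (hf : IsProper f)
    (ha₁ : ρ₁ a = .a) (ha₂ : ρ₂ a = .a) (hc₁ : ρ₁ c = .c) (hc₂ : ρ₂ c = .e) (he₁ : ρ₁ e = .e)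
    (he₂ : ρ₂ e = .c) :
    (boolOp f (witnessComap m hm ρ₁).accepts (witnessComap n hn ρ₂).accepts).complexity
      = ((m * n : ℕ) : ℕ∞) := by
  classical
  have hq : (boolOp f (witnessComap m hm ρ₁).accepts (witnessComap n hn ρ₂).accepts).quotients
      = Set.range fun x : Fin m × Fin n => boolOp f ((witnessComap m hm ρ₁).acceptsFrom x.1)
        ((witnessComap n hn ρ₂).acceptsFrom x.2) := by
    ext L
    constructor
    · rintro ⟨w, rfl⟩
      refine ⟨((witnessComap m hm ρ₁).eval w, (witnessComap n hn ρ₂).eval w), ?_⟩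
      rw [leftQuotient_boolOp, leftQuotient_accepts_apply, leftQuotient_accepts_apply]
    · rintro ⟨⟨p, q⟩, rfl⟩
      obtain ⟨w, hw₁, hw₂⟩ :=
        exists_eval_pair_eq (hm := hm) (hn := hn) ha₁ ha₂ hc₁ hc₂ he₁ he₂ p q
      refine ⟨w, ?_⟩
      rw [leftQuotient_boolOp, leftQuotient_accepts_apply, leftQuotient_accepts_apply, hw₁, hw₂]
  have hinj : Function.Injective fun x : Fin m × Fin n =>
      boolOp f ((witnessComap m hm ρ₁).acceptsFrom x.1)
        ((witnessComap n hn ρ₂).acceptsFrom x.2) := by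
    rintro ⟨p, q⟩ ⟨p', q'⟩ h
    simp only at h
    have hp : p = p' := by
      by_contra hp
      obtain ⟨y, hy⟩ := hf.exists_ne_left
      obtain ⟨w, h1, h2, h3⟩ :=
        -- The word keeps the second operand at a value `y` where `f` depends on its first argument,
        -- and separates the first operands.
        exists_separating_word (hm := hm) (hn := hn) ha₁ ha₂ hc₁ hc₂ hp q q' (y = true)
      have h4 := mem_boolOp (f := f) (L := (witnessComap m hm ρ₁).acceptsFrom p) (w := w)
        (x := decide (w ∈ (witnessComap m hm ρ₁).acceptsFrom p)) (by simp) h2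
      have h5 := mem_boolOp (f := f) (L := (witnessComap m hm ρ₁).acceptsFrom p') (w := w)
        (x := decide (w ∈ (witnessComap m hm ρ₁).acceptsFrom p')) (by simp) h3
      rw [h] at h4
      exact apply_ne_of_ne (g := fun x => f x y) hy (fun h => h1 (by simpa using h))
        (h4.symm.trans h5)
    have hq : q = q' := by
      by_contra hq
      obtain ⟨x, hx⟩ := hf.exists_ne_right
      obtain ⟨w, h1, h2, h3⟩ :=
        exists_separating_word (hm := hn) (hn := hm) ha₂ ha₁ he₂ he₁ hq p p' (x = true)
      have h4 := mem_boolOp (f := f) (L' := (witnessComap n hn ρ₂).acceptsFrom q) (w := w)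
        (y := decide (w ∈ (witnessComap n hn ρ₂).acceptsFrom q)) h2 (by simp)
      have h5 := mem_boolOp (f := f) (L' := (witnessComap n hn ρ₂).acceptsFrom q') (w := w)
        (y := decide (w ∈ (witnessComap n hn ρ₂).acceptsFrom q')) h3 (by simp)
      rw [h] at h4
      exact apply_ne_of_ne (g := f x) hx (fun h => h1 (by simpa using h)) (h4.symm.trans h5)
    rw [hp, hq]
  rw [complexity, hq, ← Set.image_univ, hinj.encard_image, Set.encard_univ,
    ENat.card_eq_coe_fintype_card]
  simp

end Boolean

end MostComplex

/-! ### Dialects as renamed witnesses, and assembly of the results -/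

namespace MostComplex

/-- As `ρ` inverts `π` on the letters in use, a word has a single preimage under the substitution.
-/
theorem map_eq_map_some_iff {β : Type*} {π : Letter → Option Letter} {ρ v : β → Letter}
    (h : ∀ x y, π x = some (v y) ↔ x = ρ y) (u : List Letter) (w : List β) :
    u.map π = (w.map v).map some ↔ u = w.map ρ := by
  induction u generalizing w with
  | nil => cases w <;> simp
  | cons x u ih =>
    cases w with
    | nil => simp
    | cons y w => simp only [List.map_cons, List.cons.injEq, h, ih]

theorem dialect_witness_eq {n : ℕ} (hn : 4 ≤ n) {π : Letter → Option Letter} {ρ : Letter → Letter}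
    (h : ∀ x y, π x = some y ↔ x = ρ y) :
    (witness n hn).dialect π = (witnessComap n hn ρ).accepts := by
  ext w
  rw [mem_accepts_witnessComap]
  have key := fun u => map_eq_map_some_iff (v := id) h u w
  simp only [List.map_id] at key
  constructor
  · rintro ⟨u, hu, he⟩
    rwa [(key u).1 he] at hu
  · intro hw
    exact ⟨_, hw, (key _).2 rfl⟩

theorem witnessOver_eq {n : ℕ} (hn : 4 ≤ n) {Γ : Set Letter} {π : Letter → Option Letter}
    {ρ : Γ → Letter} (h : ∀ x (y : Γ), π x = some y.1 ↔ x = ρ y) :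
    witnessOver n hn Γ π = (witnessComap n hn ρ).accepts := by
  ext w
  rw [mem_accepts_witnessComap]
  constructor
  · rintro ⟨u, hu, he⟩
    rwa [(map_eq_map_some_iff h u w).1 he] at hu
  · intro hw
    exact ⟨_, hw, (map_eq_map_some_iff h _ w).2 rfl⟩

theorem witness_eq {n : ℕ} (hn : 4 ≤ n) : witness n hn = (witnessComap n hn id).accepts := rfl

/-- The transposition of the letters `c` and `e`. -/
def swapCE : Letter → Letter
  | .a => .a
  | .b => .b
  | .c => .e
  | .d => .d
  | .e => .c

section Dialects

variable {n : ℕ} (hn : 4 ≤ n)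

theorem dialect_abedc : (witness n hn).dialect
    (assign (some .a) (some .b) (some .e) (some .d) (some .c))
      = (witnessComap n hn swapCE).accepts :=
  dialect_witness_eq hn fun x y => by cases x <;> cases y <;> simp [assign, swapCE]

theorem witnessOver_ade :
    witnessOver n hn {.a, .d, .e} (assign (some .a) none none (some .d) (some .e))
      = (witnessComap n hn Subtype.val).accepts :=
  witnessOver_eq hn fun x ⟨y, hy⟩ => by
    rcases hy with rfl | rfl | rfl <;> cases x <;> simp [assign]

theorem witnessOver_acde :
    witnessOver n hn {.a, .c, .d, .e} (assign (some .a) none (some .c) (some .d) (some .e))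
      = (witnessComap n hn Subtype.val).accepts :=
  witnessOver_eq hn fun x ⟨y, hy⟩ => by
    rcases hy with rfl | rfl | rfl | rfl <;> cases x <;> simp [assign]

theorem witnessOver_ae :
    witnessOver n hn {.a, .e} (assign (some .a) none none none (some .e))
      = (witnessComap n hn Subtype.val).accepts :=
  witnessOver_eq hn fun x ⟨y, hy⟩ => by
    rcases hy with rfl | rfl <;> cases x <;> simp [assign]

theorem witnessOver_ace :
    witnessOver n hn {.a, .c, .e} (assign (some .a) none (some .c) none (some .e))
      = (witnessComap n hn Subtype.val).accepts :=
  witnessOver_eq hn fun x ⟨y, hy⟩ => by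
    rcases hy with rfl | rfl | rfl <;> cases x <;> simp [assign]

theorem witnessOver_aec :
    witnessOver n hn {.a, .c, .e} (assign (some .a) none (some .e) none (some .c))
      = (witnessComap n hn fun x => swapCE x.1).accepts :=
  witnessOver_eq hn fun x ⟨y, hy⟩ => by
    rcases hy with rfl | rfl | rfl <;> cases x <;> simp [assign, swapCE]

end Dialects

theorem witness_mem {n : ℕ} (hn : 4 ≤ n) :
    witness n hn ∈ ofComplexity RegularLeftIdeal n Letter :=
  witnessComap_mem (hn := hn) (ρ := id) (a := .a) (e := .e) rfl rfl

theorem finite_quotients {α : Type} {n : ℕ} {K : Language α}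
    (hK : K ∈ ofComplexity RegularLeftIdeal n α) : K.quotients.Finite :=
  Set.finite_of_encard_eq_coe hK.2

theorem isMostComplex_witness :
    IsMostComplex RegularLeftIdeal 4 witness
      (assign (some .a) (some .b) (some .e) (some .d) (some .c)) where
  isPartialPerm := by
    intro x y z hx hy
    cases x <;> cases y <;> cases z <;> simp_all [assign]
  mem n hn := witness_mem hn
  semigroup n hn α _ K hK := by
    rw [witness_eq hn, syntacticSize_witnessComap (ρ := id) (a := .a) (b := .b) (c := .c) (d := .d)
      (e := .e) rfl rfl rfl rfl rfl]
    exact syntacticSize_le hn hK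
  quotient n hn α _ K hK := by
    have h1 : K.quotients.encard = (witness n hn).quotients.encard :=
      hK.2.trans (witness_mem hn).2.symm
    have hfin := finite_quotients hK
    have hfin' := finite_quotients (witness_mem hn)
    have : Finite K.quotients := hfin
    have : Finite (witness n hn).quotients := hfin'
    have hcard : Nat.card K.quotients = Nat.card (witness n hn).quotients := by
      rw [Nat.card_coe_set_eq, Nat.card_coe_set_eq, Set.ncard, Set.ncard, h1]
    -- All quotients of the witness have the maximal complexity `n`, so any bijection will do.
    refine ⟨(Finite.card_eq.1 hcard).some, fun q => ?_⟩
    have hq := ((Finite.card_eq.1 hcard).some q).2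
    rw [complexity_quotient_witnessComap (hn := hn) (ρ := id) (a := .a) (d := .d) (e := .e)
      rfl rfl rfl hq]
    exact complexity_quotient_le hK q.2
  atoms n hn α _ K hK := by
    rw [witness_eq hn, encard_atoms_witnessComap (ρ := id) (a := .a) (c := .c) (d := .d) (e := .e)
      rfl rfl rfl rfl]
    exact encard_atoms_le hK
  atom n hn α _ K hK A hA B hB h := by
    rw [witness_eq hn] at hB h
    rw [complexity_atom_witnessComap (ρ := id) (a := .a) (b := .b) (c := .c) (d := .d) (e := .e)
      rfl rfl rfl rfl rfl hB, Set.ncard, ← h]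
    exact complexity_atom_le (by omega) hK hA
  reverse n hn α _ K hK := by
    rw [complexity_reverse, complexity_reverse, witness_eq hn, encard_atoms_witnessComap (ρ := id)
      (a := .a) (c := .c) (d := .d) (e := .e) rfl rfl rfl rfl]
    exact encard_atoms_le hK
  star n hn α _ K hK := by
    rw [witness_eq hn, complexity_kstar_witnessComap (ρ := id) (a := .a) (e := .e) rfl rfl]
    exact complexity_kstar_le hK
  product m hm n hn α _ K hK K' hK' := by
    rw [witness_eq hm, witness_eq hn,
      complexity_mul_witnessComap (ρ := id) (a := .a) (e := .e) rfl rfl]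
    exact complexity_mul_le (by omega) hK hK'
  boolean m hm n hn f hf α _ K hK K' hK' := by
    rw [dialect_abedc, witness_eq hm, complexity_boolOp_witnessComap hf (ρ₁ := id) (a := .a)
      (c := .c) (e := .e) rfl rfl rfl rfl rfl rfl]
    exact complexity_boolOp_le f hK hK'

end MostComplex
theorem mainTheorem1 :
    -- `D_n` is minimal and `L_n` is a (regular) left ideal of complexity `n`
    (∀ (n : ℕ) (hn : 4 ≤ n), (witnessDFA n hn).IsMinimal ∧
      witness n hn ∈ ofComplexity RegularLeftIdeal n Letter) ∧
    -- the stream, with the dialect stream `L_n(a,b,e,d,c)`, is most complex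
    IsMostComplex RegularLeftIdeal 4 witness
      (assign (some .a) (some .b) (some .e) (some .d) (some .c)) ∧
    -- the dialects over restricted alphabets used below are left ideals of complexity `n`
    (∀ (n : ℕ) (hn : 4 ≤ n),
      witnessOver n hn {.a, .d, .e} (assign (some .a) none none (some .d) (some .e))
        ∈ ofComplexity RegularLeftIdeal n _ ∧
      witnessOver n hn {.a, .c, .d, .e}
        (assign (some .a) none (some .c) (some .d) (some .e))
        ∈ ofComplexity RegularLeftIdeal n _ ∧
      witnessOver n hn {.a, .e} (assign (some .a) none none none (some .e))
        ∈ ofComplexity RegularLeftIdeal n _ ∧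
      witnessOver n hn {.a, .c, .e} (assign (some .a) none (some .c) none (some .e))
        ∈ ofComplexity RegularLeftIdeal n _ ∧
      witnessOver n hn {.a, .c, .e} (assign (some .a) none (some .e) none (some .c))
        ∈ ofComplexity RegularLeftIdeal n _) ∧
    -- 1. syntactic semigroup: value, maximality, and at least five letters are needed
    (∀ (n : ℕ) (hn : 4 ≤ n),
      (witness n hn).syntacticSize = ((n ^ (n - 1) + n - 1 : ℕ) : ℕ∞) ∧
      (∀ (α : Type) [Finite α], ∀ K ∈ ofComplexity RegularLeftIdeal n α,
        K.syntacticSize ≤ ((n ^ (n - 1) + n - 1 : ℕ) : ℕ∞)) ∧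
      (∀ (α : Type) [Finite α], Nat.card α < 5 → ∀ K ∈ ofComplexity RegularLeftIdeal n α,
        K.syntacticSize < ((n ^ (n - 1) + n - 1 : ℕ) : ℕ∞))) ∧
    -- 2. quotients of `L_n(a,-,-,d,e)`
    (∀ (n : ℕ) (hn : 4 ≤ n),
      (∀ q : Language ({.a, .d, .e} : Set Letter),
        q ∈ (witnessOver n hn {.a, .d, .e}
          (assign (some .a) none none (some .d) (some .e))).quotients →
        q.complexity = (n : ℕ∞)) ∧
      (∀ (α : Type) [Finite α], ∀ K ∈ ofComplexity RegularLeftIdeal n α,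
        ∀ q ∈ K.quotients, q.complexity ≤ (n : ℕ∞))) ∧
    -- 3. number of atoms of `L_n(a,-,c,d,e)`
    (∀ (n : ℕ) (hn : 4 ≤ n),
      (witnessOver n hn {.a, .c, .d, .e}
        (assign (some .a) none (some .c) (some .d) (some .e))).atoms.encard
        = ((2 ^ (n - 1) + 1 : ℕ) : ℕ∞) ∧
      (∀ (α : Type) [Finite α], ∀ K ∈ ofComplexity RegularLeftIdeal n α,
        K.atoms.encard ≤ ((2 ^ (n - 1) + 1 : ℕ) : ℕ∞))) ∧
    -- 4. complexity of the atoms of `L_n(a,b,c,d,e)`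
    (∀ (n : ℕ) (hn : 4 ≤ n),
      (∀ A ∈ (witness n hn).atoms,
        A.complexity = (atomBound n ((witness n hn).atomIndex A).ncard : ℕ∞)) ∧
      (∀ (α : Type) [Finite α], ∀ K ∈ ofComplexity RegularLeftIdeal n α, ∀ A ∈ K.atoms,
        A.complexity ≤ (atomBound n (K.atomIndex A).ncard : ℕ∞))) ∧
    -- 5. reverse of `L_n(a,-,c,d,e)`
    (∀ (n : ℕ) (hn : 4 ≤ n),
      (witnessOver n hn {.a, .c, .d, .e}
        (assign (some .a) none (some .c) (some .d) (some .e))).reverse.complexity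
        = ((2 ^ (n - 1) + 1 : ℕ) : ℕ∞) ∧
      (∀ (α : Type) [Finite α], ∀ K ∈ ofComplexity RegularLeftIdeal n α,
        K.reverse.complexity ≤ ((2 ^ (n - 1) + 1 : ℕ) : ℕ∞))) ∧
    -- 6. star of `L_n(a,-,-,-,e)`
    (∀ (n : ℕ) (hn : 4 ≤ n),
      ((witnessOver n hn {.a, .e}
        (assign (some .a) none none none (some .e)))∗).complexity = ((n + 1 : ℕ) : ℕ∞) ∧
      (∀ (α : Type) [Finite α], ∀ K ∈ ofComplexity RegularLeftIdeal n α,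
        (K∗).complexity ≤ ((n + 1 : ℕ) : ℕ∞))) ∧
    -- 7. product of `L_m(a,-,-,-,e)` and `L_n(a,-,-,-,e)`
    (∀ (m : ℕ) (hm : 4 ≤ m) (n : ℕ) (hn : 4 ≤ n),
      (witnessOver m hm {.a, .e} (assign (some .a) none none none (some .e)) *
        witnessOver n hn {.a, .e}
          (assign (some .a) none none none (some .e))).complexity
        = ((m + n - 1 : ℕ) : ℕ∞) ∧
      (∀ (α : Type) [Finite α], ∀ K ∈ ofComplexity RegularLeftIdeal m α,
        ∀ K' ∈ ofComplexity RegularLeftIdeal n α,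
          (K * K').complexity ≤ ((m + n - 1 : ℕ) : ℕ∞))) ∧
    -- 8. proper boolean operations on `L_m(a,-,c,-,e)` and `L_n(a,-,e,-,c)`
    (∀ (m : ℕ) (hm : 4 ≤ m) (n : ℕ) (hn : 4 ≤ n) (f : Bool → Bool → Bool), IsProper f →
      (boolOp f
        (witnessOver m hm {.a, .c, .e}
          (assign (some .a) none (some .c) none (some .e)))
        (witnessOver n hn {.a, .c, .e}
          (assign (some .a) none (some .e) none (some .c)))).complexity
        = ((m * n : ℕ) : ℕ∞) ∧
      (∀ (α : Type) [Finite α], ∀ K ∈ ofComplexity RegularLeftIdeal m α,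
        ∀ K' ∈ ofComplexity RegularLeftIdeal n α,
          (boolOp f K K').complexity ≤ ((m * n : ℕ) : ℕ∞))) := by
  refine ⟨fun n hn => ⟨?_, witness_mem hn⟩, isMostComplex_witness, fun n hn => ⟨?_, ?_, ?_, ?_, ?_⟩,
    fun n hn => ⟨?_, fun α _ K hK => syntacticSize_le hn hK,
      fun α _ hα K hK => syntacticSize_lt hn hα hK⟩,
    fun n hn => ⟨?_, fun α _ K hK q hq => complexity_quotient_le hK hq⟩,
    fun n hn => ⟨?_, fun α _ K hK => encard_atoms_le hK⟩,
    fun n hn => ⟨?_, fun α _ K hK A hA => complexity_atom_le (by omega) hK hA⟩,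
    fun n hn => ⟨?_, fun α _ K hK => (complexity_reverse K).trans_le (encard_atoms_le hK)⟩,
    fun n hn => ⟨?_, fun α _ K hK => complexity_kstar_le hK⟩,
    fun m hm n hn => ⟨?_, fun α _ K hK K' hK' => complexity_mul_le (by omega) hK hK'⟩,
    fun m hm n hn f hf => ⟨?_, fun α _ K hK K' hK' => complexity_boolOp_le f hK hK'⟩⟩
  · exact witnessComap_isMinimal (hn := hn) (ρ := id) (a := .a) (e := .e) rfl rfl
  · rw [witnessOver_ade]
    exact witnessComap_mem (a := ⟨.a, by simp⟩) (e := ⟨.e, by simp⟩) rfl rfl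
  · rw [witnessOver_acde]
    exact witnessComap_mem (a := ⟨.a, by simp⟩) (e := ⟨.e, by simp⟩) rfl rfl
  · rw [witnessOver_ae]
    exact witnessComap_mem (a := ⟨.a, by simp⟩) (e := ⟨.e, by simp⟩) rfl rfl
  · rw [witnessOver_ace]
    exact witnessComap_mem (a := ⟨.a, by simp⟩) (e := ⟨.e, by simp⟩) rfl rfl
  · rw [witnessOver_aec]
    -- In this dialect the letter `c` acts as the constant map.
    exact witnessComap_mem (a := ⟨.a, by simp⟩) (e := ⟨.c, by simp⟩) rfl rfl
  · exact syntacticSize_witnessComap (hn := hn) (ρ := id) (a := .a) (b := .b) (c := .c)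
      (d := .d) (e := .e) rfl rfl rfl rfl rfl
  · rw [witnessOver_ade]
    intro q hq
    exact complexity_quotient_witnessComap (a := ⟨.a, by simp⟩) (d := ⟨.d, by simp⟩)
      (e := ⟨.e, by simp⟩) rfl rfl rfl hq
  · rw [witnessOver_acde]
    exact encard_atoms_witnessComap (a := ⟨.a, by simp⟩) (c := ⟨.c, by simp⟩)
      (d := ⟨.d, by simp⟩) (e := ⟨.e, by simp⟩) rfl rfl rfl rfl
  · intro A hA
    exact complexity_atom_witnessComap (hn := hn) (ρ := id) (a := .a) (b := .b) (c := .c)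
      (d := .d) (e := .e) rfl rfl rfl rfl rfl hA
  · rw [witnessOver_acde, complexity_reverse]
    exact encard_atoms_witnessComap (a := ⟨.a, by simp⟩) (c := ⟨.c, by simp⟩)
      (d := ⟨.d, by simp⟩) (e := ⟨.e, by simp⟩) rfl rfl rfl rfl
  · rw [witnessOver_ae]
    exact complexity_kstar_witnessComap (a := ⟨.a, by simp⟩) (e := ⟨.e, by simp⟩) rfl rfl
  · rw [witnessOver_ae, witnessOver_ae]
    exact complexity_mul_witnessComap (a := ⟨.a, by simp⟩) (e := ⟨.e, by simp⟩) rfl rfl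
  · rw [witnessOver_ace, witnessOver_aec]
    exact complexity_boolOp_witnessComap hf (a := ⟨.a, by simp⟩) (c := ⟨.c, by simp⟩)
      (e := ⟨.e, by simp⟩) rfl rfl rfl rfl rfl rfl
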